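/- Let $M$ be a finite 0-1 matrix with an ordered sequence of rows. Rows are treated as sets of columns. A set of rows has the consecutive-ones property if the columns can be ordered so that in each of these rows the 1's are consecutive. Two sets overlap if they intersect and neither contains the other; the overlap graph of a collection of rows joins two rows when they overlap. A PQ tree of rows $\mathcal R'$ with the consecutive-ones property is a rooted ordered tree whose leaves are the columns and whose internal nodes are P nodes (at least 2 children) and Q nodes (at least 3 children), such that the leaf orders obtainable by permuting the children of each P node arbitrarily and keeping or reversing the children of each Q node are exactly the consecutive-ones orderings of $\mathcal R'$. A node is regarded as the set of leaves below it. A Tucker submatrix of $M$ is a submatrix that equals, up to permutation of rows and columns, one of Tucker's minimal forbidden matrices. Written as lists of rows on the columns $0,1,2,\dots$, these are: * $M_I$ ($k\ge 3$ columns): $\{0,1\},\{1,2\},\dots,\{k-2,k-1\},\{0,k-1\}$; * $M_{II}$ ($k\ge 4$ columns): $\{0,1\},\dots,\{k-3,k-2\}$, all columns except $k-2$, all columns except $0$; * $M_{III}$ ($k\ge 4$ columns): $\{0,1\},\dots,\{k-3,k-2\}$, all columns except $0$ and $k-2$; * $M_{IV}$ (6 columns): $\{0,1\},\{2,3\},\{4,5\},\{1,3,5\}$;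 * $M_V$ (5 columns): $\{0,1\},\{2,3\},\{0,1,2,3\},\{1,2,4\}$. Algorithm initialRows$(M,4)$ repeats the following for $i=1,2,\dots$ as long as $i\le 5$ and the current matrix has at least $i-1$ rows: find the minimal prefix $(R_1,\dots,R_r,Z)$ of the current row sequence that fails the consecutive-ones property, and replace the current row sequence by $(Z,R_1,\dots,R_r)$. Algorithm findRows$(M)$ does the following. 1. It runs initialRows$(M,4)$ and selects an iteration, at the end of which the row sequence is $(Z,R_1,\dots,R_r)$, and rows $A,B\in\mathcal R'=\{R_1,\dots,R_r\}$ such that the PQ tree of $\mathcal R'$ has a Q node $Q$ with children $(X_1,\dots,X_k)$ and indices $h<i<j$ with these properties: $X_h$ and $X_j$ each contain a 1 of row $Z$ and $X_i$ contains a 0 of row $Z$; $A$ and $B$ are members of a component of the overlap graph of $\mathcal R'$ whose union is $Q$; $A$ contains $X_h$ and is disjoint from $X_i$ and $X_j$; $B$ contains $X_j$ and is disjoint from $X_h$ and $X_i$. 2. It takes a shortest path $P$ from $A$ to $B$ in the overlap graph of $\mathcal R'$. 3. It takes a minimal prefix $P_1$ of $P$ whose rows, together with $Z$, do not have the consecutive-ones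 property. 4. It takes a minimal suffix $P_2$ of $P_1$ whose rows, together with $Z$, do not have the consecutive-ones property. 5. It returns the set that consists of $Z$ and the rows of $P_2$. Statement. Suppose that $M$ does not have the consecutive-ones property and that every Tucker submatrix of $M$ has at least five rows. Then findRows$(M)$ returns the row set of a Tucker submatrix of $M$. That is: initialRows$(M,4)$ terminates, a selection as in step 1 exists, for every selection and all choices in earlier steps the objects $P$, $P_1$, $P_2$ of steps 2--4 exist, and for all choices the returned set is exactly the set of rows of a Tucker submatrix of $M$. -/

import Mathlib

namespace ConsOnes

/-! ### 0-1 matrices and the consecutive-ones property -/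

/-- Row `i` of a 0-1 matrix, as the set of columns in which it has a 1. -/
def rowSet {m n : ℕ} (M : Matrix (Fin m) (Fin n) Bool) (i : Fin m) : Set (Fin n) :=
  {c | M i c = true}

/-- The sequence `l` lists every column exactly once, and in this order of the columns the 1's of
every row in `S` are consecutive: a column that lies between two columns of a row is in that row.
(`[a, b, c].Sublist l` says that `a`, `b`, `c` occur in `l` in this order.) -/
def IsConsecutiveOrdering {m n : ℕ} (M : Matrix (Fin m) (Fin n) Bool) (S : Set (Fin m))
    (l : List (Fin n)) : Prop :=
  l.Nodup ∧ (∀ c, c ∈ l) ∧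
    ∀ i ∈ S, ∀ a b c, [a, b, c].Sublist l → a ∈ rowSet M i → c ∈ rowSet M i → b ∈ rowSet M i

/-- The rows in `S` have the consecutive-ones property. -/
def HasConsecutiveOnes {m n : ℕ} (M : Matrix (Fin m) (Fin n) Bool) (S : Set (Fin m)) : Prop :=
  ∃ l, IsConsecutiveOrdering M S l

/-! ### Tucker matrices -/

/-- `M_I` with `t + 3` rows and columns: rows `{0,1}, {1,2}, …, {t+1,t+2}` and `{0,t+2}`. -/
def tuckerI (t : ℕ) : Matrix (Fin (t + 3)) (Fin (t + 3)) Bool := fun i j =>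
  if i.val < t + 2 then decide (j.val = i.val ∨ j.val = i.val + 1)
  else decide (j.val = 0 ∨ j.val = t + 2)

/-- `M_II` with `t + 4` rows and columns: rows `{0,1}, {1,2}, …, {t+1,t+2}`, then the row of all
columns but `t+2`, and the row of all columns but `0`. -/
def tuckerII (t : ℕ) : Matrix (Fin (t + 4)) (Fin (t + 4)) Bool := fun i j =>
  if i.val < t + 2 then decide (j.val = i.val ∨ j.val = i.val + 1)
  else if i.val = t + 2 then decide (j.val ≠ t + 2)
  else decide (j.val ≠ 0)

/-- `M_III` with `t + 3` rows and `t + 4` columns: rows `{0,1}, {1,2}, …, {t+1,t+2}`, and the row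
of all columns but `0` and `t+2`. -/
def tuckerIII (t : ℕ) : Matrix (Fin (t + 3)) (Fin (t + 4)) Bool := fun i j =>
  if i.val < t + 2 then decide (j.val = i.val ∨ j.val = i.val + 1)
  else decide (j.val ≠ 0 ∧ j.val ≠ t + 2)

/-- `M_IV`. -/
def tuckerIV : Matrix (Fin 4) (Fin 6) Bool :=
  !![true, true, false, false, false, false;
     false, false, true, true, false, false;
     false, false, false, false, true, true;
     false, true, false, true, false, true]

/-- `M_V`. -/
def tuckerV : Matrix (Fin 4) (Fin 5) Bool :=
  !![true, true, false, false, false;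
     false, false, true, true, false;
     true, true, true, true, false;
     false, true, true, false, true]

/-- Tucker's minimal forbidden matrices, each in one order of its rows and columns. -/
inductive IsTucker : {r c : ℕ} → Matrix (Fin r) (Fin c) Bool → Prop
  | I (t : ℕ) : IsTucker (tuckerI t)
  | II (t : ℕ) : IsTucker (tuckerII t)
  | III (t : ℕ) : IsTucker (tuckerIII t)
  | IV : IsTucker tuckerIV
  | V : IsTucker tuckerV

/-- `X` is the set of rows of a Tucker submatrix of `M`: some choice of columns gives, together
with the rows `X`, a Tucker matrix up to the order of rows and columns. -/
def IsTuckerRowSet {m n : ℕ} (M : Matrix (Fin m) (Fin n) Bool) (X : Set (Fin m)) : Prop :=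
  ∃ (r c : ℕ) (T : Matrix (Fin r) (Fin c) Bool) (f : Fin r ↪ Fin m) (g : Fin c ↪ Fin n),
    IsTucker T ∧ (∀ i j, M (f i) (g j) = T i j) ∧ Set.range f = X

/-! ### Overlap graphs -/

/-- Two sets overlap if they meet and neither is a subset of the other. -/
def Overlap {α : Type*} (R₁ R₂ : Set α) : Prop :=
  (R₁ ∩ R₂).Nonempty ∧ ¬ R₁ ⊆ R₂ ∧ ¬ R₂ ⊆ R₁

/-- The overlap graph of the rows in the sequence `R`. -/
def overlapGraph {m n : ℕ} (M : Matrix (Fin m) (Fin n) Bool) (R : List (Fin m)) :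
    SimpleGraph {i // i ∈ R} where
  Adj i j := Overlap (rowSet M i) (rowSet M j)
  symm := ⟨fun _ _ h => ⟨by rw [Set.inter_comm]; exact h.1, h.2.2, h.2.1⟩⟩
  loopless := ⟨fun _ h => h.2.1 subset_rfl⟩

/-! ### PQ trees -/

/-- Rooted ordered trees whose internal nodes are P nodes and Q nodes; a node with `k` children
carries them as a sequence indexed by `Fin k`. -/
inductive PQTree (α : Type) : Type
  | leaf (c : α) : PQTree α
  | pnode (k : ℕ) (child : Fin k → PQTree α) : PQTree α
  | qnode (k : ℕ) (child : Fin k → PQTree α) : PQTree α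

namespace PQTree

/-- The set of leaf descendants of the root: a node of a PQ tree regarded as a set. -/
def leafSet {α : Type} : PQTree α → Set α
  | leaf c => {c}
  | pnode _ f => ⋃ i, (f i).leafSet
  | qnode _ f => ⋃ i, (f i).leafSet

/-- The leaf orders that the tree allows: the children of each P node may be put in any order,
those of each Q node only in the given order or its reverse. -/
def leafOrders {α : Type} : PQTree α → Set (List α)
  | leaf c => {[c]}
  | pnode k f => {l | ∃ (σ : Equiv.Perm (Fin k)) (g : Fin k → List α),
      (∀ i, g i ∈ (f i).leafOrders) ∧ l = (List.ofFn fun i => g (σ i)).flatten}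
  | qnode k f => {l | ∃ g : Fin k → List α, (∀ i, g i ∈ (f i).leafOrders) ∧
      (l = (List.ofFn g).flatten ∨ l = (List.ofFn fun i => g i.rev).flatten)}

/-- The nodes of the tree, each given as the subtree below it. -/
def nodes {α : Type} : PQTree α → Set (PQTree α)
  | leaf c => {leaf c}
  | pnode k f => {pnode k f} ∪ ⋃ i, (f i).nodes
  | qnode k f => {qnode k f} ∪ ⋃ i, (f i).nodes

/-- Every P node has at least two children and every Q node at least three. -/
def Proper {α : Type} : PQTree α → Prop
  | leaf _ => True
  | pnode k f => 2 ≤ k ∧ ∀ i, (f i).Proper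
  | qnode k f => 3 ≤ k ∧ ∀ i, (f i).Proper

end PQTree

/-- `T` is a PQ tree of the rows in `R`: the leaf orders it allows are exactly the
consecutive-ones orderings of these rows. In particular each column is exactly one leaf. -/
def IsPQTree {m n : ℕ} (M : Matrix (Fin m) (Fin n) Bool) (R : List (Fin m))
    (T : PQTree (Fin n)) : Prop :=
  T.Proper ∧ ∀ l, l ∈ T.leafOrders ↔ IsConsecutiveOrdering M {i | i ∈ R} l

/-- The children `h`, `i`, `j` of a Q node with sequence of children `child` form a 1-0-1
configuration for the row `Z`. -/
def Is101 {m n : ℕ} (M : Matrix (Fin m) (Fin n) Bool) (Z : Fin m) {k : ℕ}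
    (child : Fin k → PQTree (Fin n)) (h i j : Fin k) : Prop :=
  h < i ∧ i < j ∧ (∃ c ∈ (child h).leafSet, c ∈ rowSet M Z) ∧
    (∃ c ∈ (child i).leafSet, c ∉ rowSet M Z) ∧ (∃ c ∈ (child j).leafSet, c ∈ rowSet M Z)

/-- The PQ tree of `R` has a Q node `Q` with a 1-0-1 configuration `(X_h, X_i, X_j)` for `Z`, the
rows `A` and `B` belong to the component of the overlap graph of `R` whose union is `Q`, the row
`A` contains `X_h` and is disjoint from `X_i` and `X_j`, and `B` contains `X_j` and is disjoint
from `X_h` and `X_i`. -/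
def IsCorral {m n : ℕ} (M : Matrix (Fin m) (Fin n) Bool) (R : List (Fin m)) (Z : Fin m)
    (A B : {i // i ∈ R}) : Prop :=
  ∃ T, IsPQTree M R T ∧
    ∃ (k : ℕ) (child : Fin k → PQTree (Fin n)), PQTree.qnode k child ∈ T.nodes ∧
    ∃ h i j : Fin k, Is101 M Z child h i j ∧
      (∃ K : (overlapGraph M R).ConnectedComponent, A ∈ K.supp ∧ B ∈ K.supp ∧
        ⋃ r ∈ K.supp, rowSet M r = (PQTree.qnode k child).leafSet) ∧
      (child h).leafSet ⊆ rowSet M A ∧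
      Disjoint (rowSet M A) (child i).leafSet ∧ Disjoint (rowSet M A) (child j).leafSet ∧
      (child j).leafSet ⊆ rowSet M B ∧
      Disjoint (rowSet M B) (child h).leafSet ∧ Disjoint (rowSet M B) (child i).leafSet

/-! ### The algorithms -/

/-- `L₁` is a minimal prefix of `L` with the property `p`. -/
def IsMinimalPrefix {α : Type*} (p : List α → Prop) (L L₁ : List α) : Prop :=
  L₁ <+: L ∧ p L₁ ∧ ∀ L', L' <+: L₁ → p L' → L' = L₁

/-- `L₁` is a minimal suffix of `L` with the property `p`. -/
def IsMinimalSuffix {α : Type*} (p : List α → Prop) (L L₁ : List α) : Prop :=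
  L₁ <:+ L ∧ p L₁ ∧ ∀ L', L' <:+ L₁ → p L' → L' = L₁

/-- One execution of the loop body of `initialRows`: if `(R_1, …, R_r, Z)` is the minimal prefix
of the row sequence `L` that fails the consecutive-ones property, the new row sequence is
`(Z, R_1, …, R_r)`. -/
def InitialRowsStep {m n : ℕ} (M : Matrix (Fin m) (Fin n) Bool) (L L' : List (Fin m)) : Prop :=
  ∃ R Z, IsMinimalPrefix (fun L₁ => ¬ HasConsecutiveOnes M {i | i ∈ L₁}) L (R ++ [Z]) ∧
    L' = Z :: R

/-- `AfterIteration M k t L`: the loop of `initialRows (M, k)` has been executed `t` times, and the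
row sequence of the current matrix is `L`. Iteration number `i = t + 1` is executed
only if `i ≤ k + 1` and the current matrix has at least `i - 1 = t` rows. -/
inductive AfterIteration {m n : ℕ} (M : Matrix (Fin m) (Fin n) Bool) (k : ℕ) :
    ℕ → List (Fin m) → Prop
  | start : AfterIteration M k 0 (List.finRange m)
  | step {t : ℕ} {L L' : List (Fin m)} : AfterIteration M k t L → t + 1 ≤ k + 1 → t ≤ L.length →
      InitialRowsStep M L L' → AfterIteration M k (t + 1) L'

/-- `initialRows (M, k)` returns the matrix with row sequence `L`: its loop condition fails
there. -/
def InitialRowsReturns {m n : ℕ} (M : Matrix (Fin m) (Fin n) Bool) (k : ℕ)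
    (L : List (Fin m)) : Prop :=
  ∃ t, AfterIteration M k t L ∧ ¬ (t + 1 ≤ k + 1 ∧ t ≤ L.length)

/-- First step of `findRows (M)`: `(Z, R_1, …, R_r)` is the row sequence at the end of one of the
iterations of `initialRows (M, 4)`, and `A`, `B` are as required for `R = (R_1, …, R_r)`
and `Z`. -/
def Finds {m n : ℕ} (M : Matrix (Fin m) (Fin n) Bool) (R : List (Fin m)) (Z : Fin m)
    (A B : {i // i ∈ R}) : Prop :=
  (∃ t, 1 ≤ t ∧ AfterIteration M 4 t (Z :: R)) ∧ IsCorral M R Z A B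

/-- Second step: `P` is a shortest path from `A` to `B`. -/
def IsShortestPath {V : Type*} {G : SimpleGraph V} {A B : V} (P : G.Walk A B) : Prop :=
  P.IsPath ∧ ∀ P' : G.Walk A B, P.length ≤ P'.length

/-- The set that consists of `Z` and the rows on the sequence `L`. -/
def rowsWith {m : ℕ} {R : List (Fin m)} (Z : Fin m) (L : List {i // i ∈ R}) : Set (Fin m) :=
  insert Z {i | ∃ r ∈ L, r.val = i}

/-- The rows on the sequence `L` together with `Z` fail the consecutive-ones property. -/
def FailsWith {m n : ℕ} (M : Matrix (Fin m) (Fin n) Bool) {R : List (Fin m)} (Z : Fin m)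
    (L : List {i // i ∈ R}) : Prop :=
  ¬ HasConsecutiveOnes M (rowsWith Z L)

/-- `findRows (M)` can return the set `X` of rows. -/
def FindRowsReturns {m n : ℕ} (M : Matrix (Fin m) (Fin n) Bool) (X : Set (Fin m)) : Prop :=
  ∃ (R : List (Fin m)) (Z : Fin m) (A B : {i // i ∈ R}) (P : (overlapGraph M R).Walk A B)
    (P₁ P₂ : List {i // i ∈ R}), Finds M R Z A B ∧ IsShortestPath P ∧
      IsMinimalPrefix (FailsWith M Z) P.support P₁ ∧ IsMinimalSuffix (FailsWith M Z) P₁ P₂ ∧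
      X = rowsWith Z P₂

end ConsOnes

/-!
The proof regards orders of the columns as circular orders. If one column `v` is fixed, every row
that contains `v` may be replaced by its complement (`flip`), and the consecutive-ones property for
the new rows does not depend on `v` (`C1.change_base`): an order of the columns is cut open at another
place. With an additional column `none` that lies in no row, the given rows are the case `v = none`.
Whether two such rows overlap does not depend on `v` either (`ov_flip`).

A minimal set `S` of rows without the property is connected by overlaps (`linked_of_minimal`), and
the columns of a connected set of rows have just one order, up to reversal and up to the order inside
its cells (`exists_same_orientation`). Let `Z` and `D` be two rows of `S` without which `S` is still
connected. The order of `S` without `Z` is essentially unique, so `Z` must alternate on four columns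
of it (`exists_alternation`); since `S` without `D` has the property, some two neighbours among the
four columns are separated only by `D`. Cutting there shows that `Z` and `D` share a column outside
the remaining rows, which force them to opposite ends. A shortest path of rows from `Z` to `D` then
closes to a cycle of rows, except for some configurations of three or four rows
(`obstruction_of_minimal`). Those configurations contain a Tucker matrix with at most four rows,
whichever rows are complemented. In a cycle the rows to be complemented are adjacent, so there are
none, one or two of them, and the matrix is `M_I`, `M_III` or `M_II` (`IsRowCycle.isTuckerRowSet`).
Hence, if all Tucker submatrices have at least five rows, the minimal sets `S` are the rows of cycles.
All but at most four rows `Z` of `S` are straddled by their two neighbours in the cycle: in each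
order for the other rows, a column outside `Z` lies between a column of `Z` in one neighbour and a
column of `Z` in the other (`structure_of_minimal`).

The first five iterations of `initialRows` find five different rows, and each of them lies in every
minimal set `S` inside the last row sequence (`exists_afterIteration`). One of them is straddled. A PQ
tree of the rows found with it exists (`exists_tree`): its Q nodes are the unions of the components of
overlapping rows, with the cells as children. The neighbours of the straddled row thus give
the required 1-0-1 configuration (`exists_isCorral`).

Conversely, a 1-0-1 configuration for `A` and `B` persists for the rows of any path from `A` to `B`,
by uniqueness of the order (`IsCorral.failsWith`), so the prefix and the suffix exist. A minimal set
`S` among the returned rows contains `Z` and both ends of the subpath. Its rows other than `Z` form a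
cycle with one row missing, so they are connected by overlaps; as a shortest path has no chords, they
are all the rows of the subpath (`isTuckerRowSet_rowsWith`).
-/

namespace ConsOnes

/-! ### Keys of columns and the consecutive-ones property -/

/-- `R` is convex for the key `f`: it contains each point whose key lies between those of two of its
points. Points with equal keys are allowed; a convex set cannot tell them apart. -/
def Cvx {β L : Type*} [LinearOrder L] (f : β → L) (R : Set β) : Prop :=
  ∀ a ∈ R, ∀ c ∈ R, ∀ b, f a ≤ f b → f b ≤ f c → b ∈ R

/-- The consecutive-ones property of the sets `ρ i`, `i ∈ S`, expressed by an integer key. -/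
def C1 {ι β : Type*} (ρ : ι → Set β) (S : Set ι) : Prop :=
  ∃ f : β → ℤ, ∀ i ∈ S, Cvx f (ρ i)

theorem C1.mono {ι β : Type*} {ρ : ι → Set β} {S S' : Set ι} (h : C1 ρ S) (hS : S' ⊆ S) :
    C1 ρ S' :=
  let ⟨f, hf⟩ := h; ⟨f, fun i hi => hf i (hS hi)⟩

/-- An integer key that orders a finite type as a given key does. -/
theorem exists_int_key {β L : Type*} [Finite β] [LinearOrder L] (k : β → L) :
    ∃ f : β → ℤ, ∀ a b, f a ≤ f b ↔ k a ≤ k b := by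
  classical
  have := Fintype.ofFinite β
  have key : ∀ a b, k a < k b →
      (Finset.univ.filter fun x => k x < k a).card < (Finset.univ.filter fun x => k x < k b).card := by
    intro a b hab
    apply Finset.card_lt_card
    refine ⟨fun x hx => ?_, fun h => ?_⟩
    · simp only [Finset.mem_filter, Finset.mem_univ, true_and] at hx ⊢
      exact hx.trans hab
    · have : a ∈ Finset.univ.filter fun x => k x < k a := h (by simpa using hab)
      simp at this
  refine ⟨fun c => ((Finset.univ.filter fun x => k x < k c).card : ℤ), fun a b => ?_⟩
  rcases lt_trichotomy (k a) (k b) with h | h | h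
  · simpa [h.le] using (key a b h).le
  · simp [h]
  · exact iff_of_false (by simpa using key b a h) (not_le.2 h)

theorem C1.of_key {ι β L : Type*} [Finite β] [LinearOrder L] {ρ : ι → Set β} {S : Set ι}
    (k : β → L) (h : ∀ i ∈ S, Cvx k (ρ i)) : C1 ρ S := by
  obtain ⟨f, hf⟩ := exists_int_key k
  exact ⟨f, fun i hi a ha c hc b hab hbc =>
    h i hi a ha c hc b ((hf _ _).1 hab) ((hf _ _).1 hbc)⟩

theorem Cvx.neg {β : Type*} {f : β → ℤ} {R : Set β} (h : Cvx f R) : Cvx (fun c => -f c) R :=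
  fun a ha c hc b hab hbc => h c hc a ha b (by simpa using hbc) (by simpa using hab)

/-- A point outside a convex set lies on one side of it. -/
theorem Cvx.lt_of_lt {β L : Type*} [LinearOrder L] {f : β → L} {R : Set β} (h : Cvx f R)
    {a b : β} (ha : a ∈ R) (hb : b ∉ R) (hab : f a ≤ f b) {c : β} (hc : c ∈ R) : f c < f b := by
  by_contra! hbc
  exact hb (h a ha c hc b hab hbc)

theorem Cvx.gt_of_gt {β L : Type*} [LinearOrder L] {f : β → L} {R : Set β} (h : Cvx f R)
    {a b : β} (ha : a ∈ R) (hb : b ∉ R) (hab : f b ≤ f a) {c : β} (hc : c ∈ R) : f b < f c := by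
  by_contra! hbc
  exact hb (h c hc a ha b hbc hab)

theorem Cvx.ne {β L : Type*} [LinearOrder L] {f : β → L} {R : Set β} (h : Cvx f R)
    {a b : β} (ha : a ∈ R) (hb : b ∉ R) : f a ≠ f b :=
  fun hab => hb (h a ha a ha b hab.le hab.ge)

theorem Overlap.symm {α : Type*} {R T : Set α} (h : Overlap R T) : Overlap T R :=
  ⟨by rw [Set.inter_comm]; exact h.1, h.2.2, h.2.1⟩

/-- Sets that meet without overlapping are nested. -/
theorem subset_or_subset_of_not_overlap {α : Type*} {R T : Set α} (h : ¬ Overlap R T) {a : α}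
    (hR : a ∈ R) (hT : a ∈ T) : R ⊆ T ∨ T ⊆ R := by
  by_contra! hc
  exact h ⟨⟨a, hR, hT⟩, hc.1, hc.2⟩

/-! ### Linked sets of rows -/

/-- `S` is connected under `r`, stated as an induction principle: a property of one member of `S`
that is handed on along `r` holds for all members. -/
def Linked {ι : Type*} (r : ι → ι → Prop) (S : Set ι) : Prop :=
  ∀ P : ι → Prop, (∃ i ∈ S, P i) → (∀ i ∈ S, ∀ j ∈ S, P i → r i j → P j) → ∀ j ∈ S, P j

theorem linked_singleton {ι : Type*} (r : ι → ι → Prop) (i : ι) : Linked r {i} := by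
  rintro P ⟨j, rfl, hj⟩ - k rfl
  exact hj

theorem Linked.insert_of_rel {ι : Type*} {r : ι → ι → Prop} (hr : ∀ i j, r i j → r j i) {S : Set ι}
    (h : Linked r S) {i j : ι} (hi : i ∈ S) (hij : r i j) : Linked r (insert j S) := by
  intro P hP hstep
  have hi' : P i := by
    obtain ⟨k, hk, hPk⟩ := hP
    rcases hk with rfl | hk
    · exact hstep k (.inl rfl) i (.inr hi) hPk (hr _ _ hij)
    · exact h P ⟨k, hk, hPk⟩ (fun a ha b hb => hstep a (.inr ha) b (.inr hb)) i hi
  rintro k (rfl | hk)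
  · exact hstep i (.inr hi) k (.inl rfl) hi' hij
  · exact h P ⟨i, hi, hi'⟩ (fun a ha b hb => hstep a (.inr ha) b (.inr hb)) k hk

/-- A linked set has, next to a proper part of it, a member that is related to this part. -/
theorem Linked.exists_rel {ι : Type*} {r : ι → ι → Prop} {S C : Set ι} (h : Linked r S)
    (hC : ∃ i ∈ S, i ∈ C) (hS : ∃ j ∈ S, j ∉ C) : ∃ i ∈ S, ∃ j ∈ S, i ∈ C ∧ j ∉ C ∧ r i j := by
  by_contra! hc
  obtain ⟨j, hj, hjC⟩ := hS
  exact hjC (h (· ∈ C) hC (fun a ha b hb haC hab => by_contra fun hbC => hc a ha b hb haC hbC hab)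
    j hj)

/-- Besides any given member, a finite linked set with at least two members has a member whose
removal leaves a linked set: the one that a maximal proper linked part lacks. -/
theorem Linked.exists_removable {ι : Type*} {r : ι → ι → Prop} (hr : ∀ i j, r i j → r j i)
    {S : Set ι} (hfin : S.Finite) (h : Linked r S) {i : ι} (hi : i ∈ S) (hne : ∃ j ∈ S, j ≠ i) :
    ∃ d ∈ S, d ≠ i ∧ Linked r (S \ {d}) := by
  have hf : {C : Set ι | C ⊆ S ∧ i ∈ C ∧ C ≠ S ∧ Linked r C}.Finite :=
    hfin.finite_subsets.subset fun C hC => hC.1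
  obtain ⟨C, hC, hmax⟩ := hf.exists_maximal (by
    refine ⟨{i}, by simpa using hi, rfl, fun hS => ?_, linked_singleton r i⟩
    obtain ⟨j, hj, hji⟩ := hne
    rw [← hS] at hj
    exact hji hj)
  obtain ⟨hCS, hiC, hCne, hCl⟩ := hC
  obtain ⟨j, hj, hjC⟩ := Set.exists_of_ssubset (lt_of_le_of_ne hCS hCne)
  obtain ⟨a, -, b, hb, haC, hbC, hab⟩ := h.exists_rel ⟨i, hi, hiC⟩ ⟨j, hj, hjC⟩
  have hins : insert b C = S := by
    by_contra hne'
    have := hmax (y := insert b C)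
      ⟨Set.insert_subset hb hCS, .inr hiC, hne', hCl.insert_of_rel hr haC hab⟩ (Set.subset_insert b C)
    exact hbC (this (.inl rfl))
  refine ⟨b, hb, fun hbi => hbC (hbi ▸ hiC), ?_⟩
  have : S \ {b} = C := by
    rw [← hins]
    ext x
    simp only [Set.mem_sdiff, Set.mem_insert_iff, Set.mem_singleton_iff]
    constructor
    · rintro ⟨h1 | h1, h2⟩
      · exact absurd h1 h2
      · exact h1
    · exact fun hx => ⟨.inr hx, fun hxb => hbC (hxb ▸ hx)⟩
  rw [this]
  exact hCl

/-- In a linked set there is a shortest path `R 0, …, R p` from the members with `P` to those with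
`Q`: it is chordless, and only its ends have `P` and `Q`. -/
theorem Linked.exists_path {ι : Type*} {r : ι → ι → Prop} {S : Set ι} (h : Linked r S)
    {P Q : ι → Prop} (hP : ∃ i ∈ S, P i) (hQ : ∃ i ∈ S, Q i) :
    ∃ (p : ℕ) (R : ℕ → ι), (∀ i ≤ p, R i ∈ S) ∧ (∀ i < p, r (R i) (R (i + 1))) ∧ P (R 0) ∧
      Q (R p) ∧ (∀ i ≤ p, P (R i) → i = 0) ∧ (∀ i ≤ p, Q (R i) → i = p) ∧
      ∀ i j, i + 1 < j → j ≤ p → ¬ r (R i) (R j) := by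
  classical
  have hex : ∃ p, ∃ R : ℕ → ι, (∀ i ≤ p, R i ∈ S) ∧ (∀ i < p, r (R i) (R (i + 1))) ∧ P (R 0) ∧
      Q (R p) := by
    obtain ⟨a, ha, hPa⟩ := hP
    obtain ⟨b, hb, hQb⟩ := hQ
    obtain ⟨p, R, h1, h2, h3, h4⟩ := h (fun k => ∃ p, ∃ R : ℕ → ι, (∀ i ≤ p, R i ∈ S) ∧
      (∀ i < p, r (R i) (R (i + 1))) ∧ P (R 0) ∧ R p = k)
      ⟨a, ha, 0, fun _ => a, by simpa using ha, by simp, hPa, rfl⟩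
      (by
        rintro i - j hj ⟨p, R, h1, h2, h3, h4⟩ hij
        refine ⟨p + 1, fun k => if k ≤ p then R k else j, ?_, ?_, ?_, ?_⟩
        · intro k hk
          by_cases hkp : k ≤ p
          · simpa [hkp] using h1 k hkp
          · simpa [hkp] using hj
        · intro k hk
          by_cases hkp : k + 1 ≤ p
          · simpa [hkp, show k ≤ p by omega] using h2 k (by omega)
          · obtain rfl : k = p := by omega
            simpa [h4] using hij
        · simpa using h3
        · simp) b hb
    exact ⟨p, R, h1, h2, h3, h4 ▸ hQb⟩
  obtain ⟨R, h1, h2, h3, h4⟩ := Nat.find_spec hex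
  set p := Nat.find hex with hp
  have hmin : ∀ q, q < p → ¬ ∃ R : ℕ → ι, (∀ i ≤ q, R i ∈ S) ∧
      (∀ i < q, r (R i) (R (i + 1))) ∧ P (R 0) ∧ Q (R q) := fun q hq => Nat.find_min hex hq
  refine ⟨p, R, h1, h2, h3, h4, ?_, ?_, ?_⟩
  · intro i hi hPi
    by_contra h0
    refine hmin (p - i) (by omega) ⟨fun k => R (k + i), fun k hk => h1 _ (by omega), ?_, ?_, ?_⟩
    · intro k hk
      have := h2 (k + i) (by omega)
      rwa [show k + i + 1 = k + 1 + i by omega] at this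
    · simpa using hPi
    · simpa [show p - i + i = p by omega] using h4
  · intro i hi hQi
    by_contra h0
    exact hmin i (by omega) ⟨R, fun k hk => h1 _ (by omega), fun k hk => h2 _ (by omega), h3, hQi⟩
  · intro i j hij hj hr
    refine hmin (p - (j - i - 1)) (by omega)
      ⟨fun k => if k ≤ i then R k else R (k + (j - i - 1)), ?_, ?_, ?_, ?_⟩
    · intro k hk
      dsimp only
      split_ifs
      · exact h1 _ (by omega)
      · exact h1 _ (by omega)
    · intro k hk
      by_cases hki : k + 1 ≤ i
      · simpa [hki, show k ≤ i by omega] using h2 k (by omega)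
      · by_cases hki' : k = i
        · subst hki'
          simpa [show k + 1 + (j - k - 1) = j by omega] using hr
        · have := h2 (k + (j - i - 1)) (by omega)
          simp only [hki, show ¬ k ≤ i by omega, if_false]
          rwa [show k + (j - i - 1) + 1 = k + 1 + (j - i - 1) by omega] at this
    · simpa using h3
    · simp only [show ¬ p - (j - i - 1) ≤ i by omega, if_false]
      rwa [show p - (j - i - 1) + (j - i - 1) = p by omega]

/-! ### Cells of a linked family, and the rigidity of its orders -/

/-- Some set of the family `G` contains exactly one of `a` and `b`. The classes of columns that are
not separated are the cells of the family. -/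
def Sep {ι β : Type*} (ρ : ι → Set β) (G : Set ι) (a b : β) : Prop :=
  ∃ i ∈ G, ¬ (a ∈ ρ i ↔ b ∈ ρ i)

/-- Some set of the family `G` contains `c`. -/
def Cov {ι β : Type*} (ρ : ι → Set β) (G : Set ι) (c : β) : Prop :=
  ∃ i ∈ G, c ∈ ρ i

/-- The overlap relation of the rows `ρ`. -/
def Ov {ι β : Type*} (ρ : ι → Set β) (i j : ι) : Prop := Overlap (ρ i) (ρ j)

theorem Ov.symm {ι β : Type*} {ρ : ι → Set β} (i j : ι) (h : Ov ρ i j) : Ov ρ j i :=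
  Overlap.symm h

theorem Sep.symm {ι β : Type*} {ρ : ι → Set β} {G : Set ι} {a b : β} (h : Sep ρ G a b) :
    Sep ρ G b a :=
  let ⟨i, hi, hab⟩ := h; ⟨i, hi, fun h => hab h.symm⟩

theorem iff_of_not_sep {ι β : Type*} {ρ : ι → Set β} {G : Set ι} {a b : β} (h : ¬ Sep ρ G a b)
    {i : ι} (hi : i ∈ G) : a ∈ ρ i ↔ b ∈ ρ i :=
  by_contra fun hc => h ⟨i, hi, hc⟩

theorem sep_of_not_sep {ι β : Type*} {ρ : ι → Set β} {G : Set ι} {a b c : β}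
    (h : ¬ Sep ρ G a b) (hac : Sep ρ G a c) : Sep ρ G b c :=
  let ⟨i, hi, hc⟩ := hac; ⟨i, hi, by rwa [← iff_of_not_sep h hi]⟩

theorem sep_of_cov {ι β : Type*} {ρ : ι → Set β} {G : Set ι} {a b : β} (ha : Cov ρ G a)
    (hb : ¬ Cov ρ G b) : Sep ρ G a b :=
  let ⟨i, hi, h⟩ := ha; ⟨i, hi, fun hab => hb ⟨i, hi, hab.1 h⟩⟩

theorem Sep.ne_key {ι β L : Type*} [LinearOrder L] {ρ : ι → Set β} {G : Set ι} {f : β → L}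
    (hf : ∀ i ∈ G, Cvx f (ρ i)) {a b : β} (h : Sep ρ G a b) : f a ≠ f b := by
  obtain ⟨i, hi, hab⟩ := h
  by_cases ha : a ∈ ρ i
  · exact (hf i hi).ne ha fun hb => hab (iff_of_true ha hb)
  · exact ((hf i hi).ne (by tauto) ha).symm

/-- The union of a linked family is convex. -/
theorem cov_cvx {ι β L : Type*} [LinearOrder L] {ρ : ι → Set β} {G : Set ι}
    (hG : Linked (Ov ρ) G) {f : β → L} (hf : ∀ i ∈ G, Cvx f (ρ i)) :
    Cvx f {c | Cov ρ G c} := by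
  rintro a ⟨i, hi, ha⟩ c ⟨j, hj, hc⟩ b hab hbc
  by_contra hb
  have hb' : ∀ k ∈ G, b ∉ ρ k := fun k hk h => hb ⟨k, hk, h⟩
  have := hG (fun k => ∀ d ∈ ρ k, f d < f b)
    ⟨i, hi, fun d hd => (hf i hi).lt_of_lt ha (hb' i hi) hab hd⟩
    (by
      rintro k hk l hl hlt ⟨⟨e, he, he'⟩, -⟩ d hd
      exact (hf l hl).lt_of_lt he' (hb' l hl) (hlt e he).le hd) j hj c hc
  exact absurd this (not_lt.2 hbc)

/-- Between two columns of the same cell there are, in the union of a linked family, only columns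
of this cell. -/
theorem cell_contiguous {ι β L : Type*} [LinearOrder L] {ρ : ι → Set β} {G : Set ι}
    (hG : Linked (Ov ρ) G) {f : β → L} (hf : ∀ i ∈ G, Cvx f (ρ i)) {a b c : β}
    (ha : Cov ρ G a) (hac : ¬ Sep ρ G a c) (hab : f a ≤ f b) (hbc : f b ≤ f c) :
    ¬ Sep ρ G a b := by
  rintro ⟨t, ht, hsep⟩
  have hin : ∀ k ∈ G, a ∈ ρ k → b ∈ ρ k := fun k hk h =>
    hf k hk a h c ((iff_of_not_sep hac hk).1 h) b hab hbc
  have hat : a ∉ ρ t := fun h => hsep (iff_of_true h (hin t ht h))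
  have hbt : b ∈ ρ t := by tauto
  -- a row that misses `a` and meets the part between `a` and `c` lies in this part
  have key : ∀ k ∈ G, a ∉ ρ k → ∀ e ∈ ρ k, f a ≤ f e → f e ≤ f c →
      ∀ d ∈ ρ k, f a < f d ∧ f d < f c := fun k hk hak e he hae hec d hd =>
    ⟨(hf k hk).gt_of_gt he hak hae hd,
      (hf k hk).lt_of_lt he (fun h => hak ((iff_of_not_sep hac hk).2 h)) hec hd⟩
  obtain ⟨i, hi, hai⟩ := ha
  have := hG (fun k => a ∉ ρ k ∧ ∀ d ∈ ρ k, f a < f d ∧ f d < f c)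
    ⟨t, ht, hat, key t ht hat b hbt hab hbc⟩
    (by
      rintro k hk l hl ⟨hak, hin'⟩ ⟨⟨e, he, he'⟩, hkl, -⟩
      have hal : a ∉ ρ l := fun h => hkl fun d hd =>
        hf l hl a h c ((iff_of_not_sep hac hl).1 h) d (hin' d hd).1.le (hin' d hd).2.le
      exact ⟨hal, key l hl hal e he' (hin' e he).1.le (hin' e he).2.le⟩) i hi
  exact this.1 hai

/-- The order of two covered columns of different cells depends only on the cells. -/
theorem cell_lt {ι β L : Type*} [LinearOrder L] {ρ : ι → Set β} {G : Set ι}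
    (hG : Linked (Ov ρ) G) {f : β → L} (hf : ∀ i ∈ G, Cvx f (ρ i)) {a a' b : β}
    (ha : Cov ρ G a) (haa : ¬ Sep ρ G a a') (hab : Sep ρ G a b) (hlt : f a < f b) :
    f a' < f b := by
  by_contra! h
  exact cell_contiguous hG hf ha haa hlt.le h hab

theorem cell_gt {ι β L : Type*} [LinearOrder L] {ρ : ι → Set β} {G : Set ι}
    (hG : Linked (Ov ρ) G) {f : β → L} (hf : ∀ i ∈ G, Cvx f (ρ i)) {a a' b : β}
    (ha : Cov ρ G a) (haa : ¬ Sep ρ G a a') (hab : Sep ρ G a b) (hlt : f b < f a) :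
    f b < f a' := by
  by_contra! h
  have ha' : Cov ρ G a' := by
    obtain ⟨i, hi, h⟩ := ha
    exact ⟨i, hi, (iff_of_not_sep haa hi).1 h⟩
  exact cell_contiguous hG hf ha' (fun h => haa h.symm) h hlt.le (sep_of_not_sep haa hab)

/-- `f` puts the part of `A` outside `B` before the part of `B` outside `A`. -/
def Before {β L : Type*} [LinearOrder L] (f : β → L) (A B : Set β) : Prop :=
  ∀ a ∈ A, a ∉ B → ∀ b ∈ B, b ∉ A → f a < f b

theorem Overlap.before_or_before {β L : Type*} [LinearOrder L] {f : β → L} {A B : Set β}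
    (h : Overlap A B) (hA : Cvx f A) (hB : Cvx f B) : Before f A B ∨ Before f B A := by
  obtain ⟨⟨e, heA, heB⟩, hAB, hBA⟩ := h
  obtain ⟨x, hxA, hxB⟩ := Set.not_subset.1 hAB
  -- the side of the common point on which `x` lies decides
  rcases le_total (f x) (f e) with hx | hx
  · left
    intro a ha haB b hb hbA
    have h1 : f x < f b := hB.gt_of_gt heB hxB hx hb
    exact hA.lt_of_lt hxA hbA h1.le ha
  · right
    intro b hb hbA a ha haB
    have h1 : f b < f x := hB.lt_of_lt heB hxB hx hb
    exact hA.gt_of_gt hxA hbA h1.le ha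

theorem Overlap.not_before {β L : Type*} [LinearOrder L] {f : β → L} {A B : Set β}
    (h : Overlap A B) (h1 : Before f A B) (h2 : Before f B A) : False := by
  obtain ⟨-, hAB, hBA⟩ := h
  obtain ⟨x, hxA, hxB⟩ := Set.not_subset.1 hAB
  obtain ⟨y, hyB, hyA⟩ := Set.not_subset.1 hBA
  exact lt_asymm (h1 x hxA hxB y hyB hyA) (h2 y hyB hyA x hxA hxB)

/-- Whether `C` continues the direction in which `B` follows `A` can be seen from the sets: the
parts of `A` and `C` outside `B` are then disjoint, and else they meet next to `B`. -/
theorem before_iff_disjoint {β L : Type*} [LinearOrder L] {f : β → L} {A B C : Set β}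
    (hAB : Overlap A B) (hBC : Overlap B C) (hA : Cvx f A) (hB : Cvx f B) (hC : Cvx f C)
    (h : Before f A B) : Before f B C ↔ Disjoint (A \ B) (C \ B) := by
  obtain ⟨⟨e, heA, heB⟩, hAB', hBA'⟩ := id hAB
  obtain ⟨⟨d, hdB, hdC⟩, hBC', hCB'⟩ := id hBC
  obtain ⟨x, hxA, hxB⟩ := Set.not_subset.1 hAB'
  obtain ⟨y, hyB, hyA⟩ := Set.not_subset.1 hBA'
  obtain ⟨z, hzC, hzB⟩ := Set.not_subset.1 hCB'
  obtain ⟨u, huB, huC⟩ := Set.not_subset.1 hBC'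
  have hxy := h x hxA hxB y hyB hyA
  constructor
  · intro h'
    rw [Set.disjoint_left]
    rintro w ⟨hwA, hwB⟩ ⟨hwC, -⟩
    have h1 := h w hwA hwB y hyB hyA
    have h2 := h' u huB huC w hwC hwB
    exact hwB (hB u huB y hyB w h2.le h1.le)
  · intro hd
    rcases hBC.before_or_before hB hC with h' | h'
    · exact h'
    · exfalso
      have h1 := h' z hzC hzB u huB huC
      -- `x` and `z` lie before `B`; the later one of them belongs to both `A` and `C`
      have hxe : f x < f e := hB.gt_of_gt hyB hxB hxy.le heB
      have hzd : f z < f d := hB.gt_of_gt huB hzB h1.le hdB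
      rcases le_total (f x) (f z) with hxz | hxz
      · have hze : f z < f e := hB.gt_of_gt hdB hzB hzd.le heB
        exact Set.disjoint_left.1 hd ⟨hA x hxA e heA z hxz hze.le, hzB⟩ ⟨hzC, hzB⟩
      · have hxd : f x < f d := hB.gt_of_gt heB hxB hxe.le hdB
        exact Set.disjoint_left.1 hd ⟨hxA, hxB⟩ ⟨hC z hzC d hdC x hxz hxd.le, hxB⟩

/-- Reversal exchanges the two directions. -/
theorem before_neg {β : Type*} {f : β → ℤ} {A B : Set β} :
    Before (fun c => -f c) A B ↔ Before f B A := by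
  constructor
  · intro h b hb hbA a ha haB
    simpa using h a ha haB b hb hbA
  · intro h a ha haB b hb hbA
    simpa using h b hb hbA a ha haB

/-- If two keys give one overlapping pair of a linked family the same direction, they give every
overlapping pair the same direction. -/
theorem before_agree {ι β L : Type*} [LinearOrder L] {ρ : ι → Set β} {G : Set ι}
    (hG : Linked (Ov ρ) G) {f g : β → L} (hf : ∀ i ∈ G, Cvx f (ρ i)) (hg : ∀ i ∈ G, Cvx g (ρ i))
    {i j : ι} (hi : i ∈ G) (hj : j ∈ G) (hij : Ov ρ i j) (hfi : Before f (ρ i) (ρ j))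
    (hgi : Before g (ρ i) (ρ j)) :
    ∀ k ∈ G, ∀ l ∈ G, Ov ρ k l → Before f (ρ k) (ρ l) → Before g (ρ k) (ρ l) := by
  -- from a pair `a, b` on which the keys agree, in either direction, to a pair `b, c`
  have step : ∀ a ∈ G, ∀ b ∈ G, ∀ c ∈ G, Ov ρ a b → Ov ρ b c →
      (Before f (ρ a) (ρ b) ↔ Before g (ρ a) (ρ b)) →
      (Before f (ρ b) (ρ c) ↔ Before g (ρ b) (ρ c)) := by
    have pos : ∀ (f' g' : β → L), (∀ i ∈ G, Cvx f' (ρ i)) → (∀ i ∈ G, Cvx g' (ρ i)) →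
        ∀ a ∈ G, ∀ b ∈ G, ∀ c ∈ G, Ov ρ a b → Ov ρ b c → Before f' (ρ a) (ρ b) →
        Before g' (ρ a) (ρ b) → (Before f' (ρ b) (ρ c) ↔ Before g' (ρ b) (ρ c)) := by
      intro f' g' hf' hg' a ha b hb c hc hab hbc h1 h2
      rw [before_iff_disjoint hab hbc (hf' a ha) (hf' b hb) (hf' c hc) h1,
        before_iff_disjoint hab hbc (hg' a ha) (hg' b hb) (hg' c hc) h2]
    intro a ha b hb c hc hab hbc hag
    by_cases hfab : Before f (ρ a) (ρ b)
    · exact pos f g hf hg a ha b hb c hc hab hbc hfab (hag.1 hfab)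
    · have hgab : ¬ Before g (ρ a) (ρ b) := fun h => hfab (hag.2 h)
      have hfba := (Overlap.before_or_before hab (hf a ha) (hf b hb)).resolve_left hfab
      have hgba := (Overlap.before_or_before hab (hg a ha) (hg b hb)).resolve_left hgab
      -- the same reasoning in the dual order
      have dual : ∀ h : β → L, Before (L := Lᵒᵈ) (fun c => OrderDual.toDual (h c)) (ρ a) (ρ b) ↔
          Before h (ρ b) (ρ a) := by
        intro h
        constructor
        · intro h' x hx hx' y hy hy'
          exact h' y hy hy' x hx hx'
        · intro h' x hx hx' y hy hy'
          exact h' y hy hy' x hx hx'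
      have dual' : ∀ h : β → L, (∀ i ∈ G, Cvx h (ρ i)) →
          (Before h (ρ b) (ρ c) ↔ ¬ Disjoint (ρ a \ ρ b) (ρ c \ ρ b) ) ∨
          ¬ Before h (ρ b) (ρ a) := by
        intro h hcv
        by_cases hba : Before h (ρ b) (ρ a)
        · left
          have hcv' : ∀ i ∈ G, Cvx (L := Lᵒᵈ) (fun c => OrderDual.toDual (h c)) (ρ i) :=
            fun i hi x hx y hy z hxz hzy => hcv i hi y hy x hx z hzy hxz
          have h3 := before_iff_disjoint (L := Lᵒᵈ) hab hbc (hcv' a ha) (hcv' b hb) (hcv' c hc)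
            ((dual h).2 hba)
          rw [← h3]
          constructor
          · intro h4 h5
            exact Overlap.not_before hbc h4 fun x hx hx' y hy hy' => h5 y hy hy' x hx hx'
          · intro h4
            refine (Overlap.before_or_before hbc (hcv b hb) (hcv c hc)).resolve_right fun h5 => h4 ?_
            intro x hx hx' y hy hy'
            exact h5 y hy hy' x hx hx'
        · exact .inr hba
      rw [(dual' f hf).resolve_right (not_not.2 hfba), (dual' g hg).resolve_right (not_not.2 hgba)]
  have flip : ∀ a ∈ G, ∀ b ∈ G, Ov ρ a b → (Before f (ρ a) (ρ b) ↔ Before g (ρ a) (ρ b)) →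
      (Before f (ρ b) (ρ a) ↔ Before g (ρ b) (ρ a)) := by
    intro a ha b hb hab h
    have h1 := Overlap.before_or_before hab (hf a ha) (hf b hb)
    have h2 := Overlap.before_or_before hab (hg a ha) (hg b hb)
    have h3 := fun x y => Overlap.not_before (f := f) hab x y
    have h4 := fun x y => Overlap.not_before (f := g) hab x y
    tauto
  have all := hG (fun k => ∀ l ∈ G, Ov ρ k l → (Before f (ρ k) (ρ l) ↔ Before g (ρ k) (ρ l)))
    ⟨i, hi, fun l hl hil => step j hj i hi l hl hij.symm hil
      (flip i hi j hj hij (iff_of_true hfi hgi))⟩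
    (fun k hk l hl hP hkl m hm hlm => step k hk l hl m hm hkl hlm (hP l hl hkl))
  exact fun k hk l hl hkl => (all k hk l hl hkl).1

/-- If two keys give all overlapping pairs of a linked family the same direction, they agree on the
order of any two covered columns of different cells. -/
theorem lt_of_before_agree {ι β L : Type*} [LinearOrder L] {ρ : ι → Set β} {G : Set ι}
    (hG : Linked (Ov ρ) G) {f g : β → L} (hf : ∀ i ∈ G, Cvx f (ρ i)) (hg : ∀ i ∈ G, Cvx g (ρ i))
    (hfg : ∀ k ∈ G, ∀ l ∈ G, Ov ρ k l → Before f (ρ k) (ρ l) → Before g (ρ k) (ρ l))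
    {a b : β} (hb : Cov ρ G b) {t : ι} (ht : t ∈ G) (hat : a ∈ ρ t) (hbt : b ∉ ρ t) :
    (f a < f b → g a < g b) ∧ (f b < f a → g b < g a) := by
  obtain ⟨s, hs, hbs⟩ := hb
  -- the rows that are reached from `t` through rows without `b` lie on one side of `b`
  let C : Set ι := {k | b ∉ ρ k ∧
    ((f a < f b → ∀ d ∈ ρ k, f d < f b) ∧ (f b < f a → ∀ d ∈ ρ k, f b < f d)) ∧
    ((g a < g b ↔ ∀ d ∈ ρ k, g d < g b) ∧ (g b < g a ↔ ∀ d ∈ ρ k, g b < g d))}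
  have htC : t ∈ C := by
    refine ⟨hbt, ⟨fun h d hd => (hf t ht).lt_of_lt hat hbt h.le hd,
      fun h d hd => (hf t ht).gt_of_gt hat hbt h.le hd⟩, ⟨fun h d hd =>
      (hg t ht).lt_of_lt hat hbt h.le hd, fun h => h a hat⟩, ⟨fun h d hd =>
      (hg t ht).gt_of_gt hat hbt h.le hd, fun h => h a hat⟩⟩
  obtain ⟨k, hk, l, hl, hkC, hlC, hkl⟩ := hG.exists_rel (C := C) ⟨t, ht, htC⟩
    ⟨s, hs, fun h => h.1 hbs⟩
  obtain ⟨hbk, ⟨hk1, hk2⟩, hk3, hk4⟩ := hkC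
  obtain ⟨⟨e, hek, hel⟩, hkl1, hkl2⟩ := id hkl
  have hbl : b ∈ ρ l := by
    by_contra hbl
    apply hlC
    refine ⟨hbl, ⟨fun h d hd => (hf l hl).lt_of_lt hel hbl (hk1 h e hek).le hd,
      fun h d hd => (hf l hl).gt_of_gt hel hbl (hk2 h e hek).le hd⟩, ⟨fun h d hd =>
      (hg l hl).lt_of_lt hel hbl (hk3.1 h e hek).le hd, fun h => ?_⟩, ⟨fun h d hd =>
      (hg l hl).gt_of_gt hel hbl (hk4.1 h e hek).le hd, fun h => ?_⟩⟩
    · exact hk3.2 fun d hd => (hg k hk).lt_of_lt hek hbk (h e hel).le hd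
    · exact hk4.2 fun d hd => (hg k hk).gt_of_gt hek hbk (h e hel).le hd
  obtain ⟨x, hxk, hxl⟩ := Set.not_subset.1 hkl1
  constructor
  · intro h
    have hB : Before f (ρ k) (ρ l) := by
      rcases Overlap.before_or_before hkl (hf k hk) (hf l hl) with h' | h'
      · exact h'
      · exact absurd (h' b hbl hbk x hxk hxl) (not_lt.2 (hk1 h x hxk).le)
    have := hfg k hk l hl hkl hB x hxk hxl b hbl hbk
    exact hk3.2 fun d hd => (hg k hk).lt_of_lt hxk hbk this.le hd
  · intro h
    have hB : Before f (ρ l) (ρ k) := by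
      rcases Overlap.before_or_before hkl (hf k hk) (hf l hl) with h' | h'
      · exact absurd (h' x hxk hxl b hbl hbk) (not_lt.2 (hk2 h x hxk).le)
      · exact h'
    have := hfg l hl k hk hkl.symm hB b hbl hbk x hxk hxl
    exact hk4.2 fun d hd => (hg k hk).gt_of_gt hxk hbk this.le hd

/-- Rigidity: two keys for which the sets of a linked family are convex agree on the order of the
covered columns of different cells, up to reversal of one of them. -/
theorem exists_same_orientation {ι β : Type*} {ρ : ι → Set β} {G : Set ι}
    (hG : Linked (Ov ρ) G) {f g : β → ℤ} (hf : ∀ i ∈ G, Cvx f (ρ i))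
    (hg : ∀ i ∈ G, Cvx g (ρ i)) :
    ∃ g' : β → ℤ, (g' = g ∨ g' = fun c => -g c) ∧ (∀ R, Cvx g R → Cvx g' R) ∧
      ∀ a b, Cov ρ G a → Cov ρ G b → Sep ρ G a b → f a < f b → g' a < g' b := by
  have fin : ∀ g' : β → ℤ, (∀ i ∈ G, Cvx g' (ρ i)) →
      (∀ k ∈ G, ∀ l ∈ G, Ov ρ k l → Before f (ρ k) (ρ l) → Before g' (ρ k) (ρ l)) →
      ∀ a b, Cov ρ G a → Cov ρ G b → Sep ρ G a b → f a < f b → g' a < g' b := by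
    rintro g' hg' hfg a b ha hb ⟨t, ht, hab⟩ hlt
    by_cases hat : a ∈ ρ t
    · exact (lt_of_before_agree hG hf hg' hfg hb ht hat fun h => hab (iff_of_true hat h)).1 hlt
    · exact (lt_of_before_agree hG hf hg' hfg ha ht (by tauto) hat).2 hlt
  by_cases hex : ∃ i ∈ G, ∃ j ∈ G, Ov ρ i j ∧ Before f (ρ i) (ρ j)
  · obtain ⟨i, hi, j, hj, hij, hfij⟩ := hex
    rcases Overlap.before_or_before hij (hg i hi) (hg j hj) with h | h
    · exact ⟨g, .inl rfl, fun R h => h, fin g hg (before_agree hG hf hg hi hj hij hfij h)⟩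
    · have hg' : ∀ i ∈ G, Cvx (fun c => -g c) (ρ i) := fun i hi => (hg i hi).neg
      exact ⟨fun c => -g c, .inr rfl, fun R h => h.neg, fin _ hg'
        (before_agree hG hf hg' hi hj hij hfij (before_neg.2 h))⟩
  · push Not at hex
    exact ⟨g, .inl rfl, fun R h => h, fin g hg fun k hk l hl hkl h =>
      absurd h (hex k hk l hl hkl)⟩

/-! ### Minimal families without the consecutive-ones property are linked -/

/-- If each set of a family lies inside `U`, contains `U` or misses `U`, then orders for the sets
inside and for the other sets combine: `U` replaces one of its points in the latter order. -/
theorem C1.glue {ι β : Type*} [Finite β] {ρ : ι → Set β} {S₁ S₂ : Set ι} {U : Set β}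
    (h₁ : C1 ρ S₁) (h₂ : C1 ρ S₂) (hin : ∀ i ∈ S₁, ρ i ⊆ U)
    (hout : ∀ i ∈ S₂, U ⊆ ρ i ∨ Disjoint (ρ i) U) : C1 ρ (S₁ ∪ S₂) := by
  classical
  obtain ⟨f₁, hf₁⟩ := h₁
  obtain ⟨f₂, hf₂⟩ := h₂
  rcases U.eq_empty_or_nonempty with rfl | ⟨u, hu⟩
  · refine ⟨f₂, ?_⟩
    rintro i (hi | hi)
    · exact fun a ha => absurd (hin i hi ha) (Set.notMem_empty a)
    · exact hf₂ i hi
  let φ : β → β := fun c => if c ∈ U then u else c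
  -- the columns outside `U` get odd first entries, so that none of them falls into `U`
  let k : β → ℤ ×ₗ ℤ := fun c =>
    toLex (2 * f₂ (φ c) + (if c ∈ U then 0 else 1), if c ∈ U then f₁ c else 0)
  have hk1 : ∀ a b, k a ≤ k b → f₂ (φ a) ≤ f₂ (φ b) := by
    intro a b hab
    have h := Prod.Lex.le_iff.1 hab
    simp only [k, ofLex_toLex] at h
    rcases h with h | ⟨h, -⟩ <;> split_ifs at h <;> omega
  apply C1.of_key k
  rintro i (hi | hi) a ha c hc b hab hbc
  · have haU := hin i hi ha
    have hcU := hin i hi hc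
    have h1 := hk1 _ _ hab
    have h2 := hk1 _ _ hbc
    have h3 := Prod.Lex.le_iff.1 hab
    have h4 := Prod.Lex.le_iff.1 hbc
    simp only [φ, haU, hcU, if_true, k, ofLex_toLex] at h1 h2 h3 h4
    by_cases hbU : b ∈ U
    · simp only [hbU, if_true, lt_self_iff_false, true_and, false_or] at h3 h4
      exact hf₁ i hi a ha c hc b h3 h4
    · simp only [hbU, if_false] at h1 h2 h3 h4
      omega
  · have hφ : ∀ d, d ∈ ρ i ↔ φ d ∈ ρ i := by
      intro d
      by_cases hd : d ∈ U
      · simp only [φ, hd, if_true]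
        rcases hout i hi with h | h
        · exact iff_of_true (h hd) (h hu)
        · exact iff_of_false (fun h' => Set.disjoint_left.1 h h' hd)
            (fun h' => Set.disjoint_left.1 h h' hu)
      · simp [φ, hd]
    rw [hφ] at ha hc ⊢
    exact hf₂ i hi _ ha _ hc _ (hk1 _ _ hab) (hk1 _ _ hbc)

theorem linked_of_minimal {ι β : Type*} [Finite β] {ρ : ι → Set β} {S : Set ι}
    (hS : ¬ C1 ρ S) (hmin : ∀ S', S' ⊂ S → C1 ρ S') : Linked (Ov ρ) S := by
  by_contra hl
  simp only [Linked, not_forall] at hl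
  obtain ⟨P, ⟨i, hi, hPi⟩, hstep, j, hj, hPj⟩ := hl
  -- the component of a row, and the induction principle for it
  let K : ι → Set ι := fun a => {b | Relation.ReflTransGen (fun x y => y ∈ S ∧ Ov ρ x y) a b}
  have hind : ∀ (Q : ι → Prop) a, a ∈ S → Q a →
      (∀ x ∈ S, ∀ y ∈ S, y ∈ K a → Q x → Ov ρ x y → Q y) → ∀ b ∈ K a, b ∈ S ∧ Q b := by
    intro Q a ha hQa hQ b hb
    induction hb with
    | refl => exact ⟨ha, hQa⟩
    | tail h1 h2 ih => exact ⟨h2.1, hQ _ ih.1 _ h2.1 (h1.tail h2) ih.2 h2.2⟩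
  have hKS : ∀ a ∈ S, K a ⊆ S := fun a ha b hb =>
    (hind (fun _ => True) a ha trivial (fun _ _ _ _ _ _ _ => trivial) b hb).1
  have hnov : ∀ a, ∀ b ∈ K a, ∀ c ∈ S, c ∉ K a → ¬ Ov ρ b c := fun a b hb c hc hcK h =>
    hcK (Relation.ReflTransGen.tail hb ⟨hc, h⟩)
  -- a row outside the component that meets it either contains all of it or lies in one of its rows
  have hout : ∀ a ∈ S, ∀ t ∈ S, t ∉ K a → ¬ ((⋃ b ∈ K a, ρ b) ⊆ ρ t ∨
      Disjoint (ρ t) (⋃ b ∈ K a, ρ b)) → ∃ b ∈ K a, ρ t ⊆ ρ b := by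
    intro a ha t ht htK h
    rw [not_or] at h
    obtain ⟨c, hct, hc⟩ := Set.not_disjoint_iff.1 h.2
    simp only [Set.mem_iUnion, exists_prop] at hc
    obtain ⟨b, hb, hcb⟩ := hc
    rcases subset_or_subset_of_not_overlap (hnov a b hb t ht htK) hcb hct with h1 | h1
    · exfalso
      apply h.1
      have hall := hind (fun x => x ∈ K a → ρ x ⊆ ρ t)
      have step : ∀ x ∈ K a, ∀ y ∈ K a, ρ x ⊆ ρ t → Ov ρ x y → ρ y ⊆ ρ t := by
        rintro x hx y hy hxt ⟨⟨e, hex, hey⟩, hxy, -⟩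
        rcases subset_or_subset_of_not_overlap (hnov a y hy t ht htK) hey (hxt hex) with h2 | h2
        · exact h2
        · exact absurd (hxt.trans h2) hxy
      have hsym : ∀ x, x ∈ K a → ∀ y ∈ K x, y ∈ K a := fun x hx y hy =>
        Relation.ReflTransGen.trans hx hy
      have hback : a ∈ K b := by
        have : ∀ x ∈ K a, a ∈ K x := by
          intro x hx
          refine (hind (fun x => a ∈ K x) a ha Relation.ReflTransGen.refl ?_ x hx).2
          intro x hx y _ _ hax hxy
          exact Relation.ReflTransGen.head ⟨hx, hxy.symm⟩ hax
        exact this b hb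
      have hbS := hKS a ha hb
      have h3 : ∀ x ∈ K b, x ∈ S ∧ ρ x ⊆ ρ t :=
        hind (fun x => ρ x ⊆ ρ t) b hbS h1 (fun x hx y hy hyK hxt hxy => by
          obtain ⟨⟨e, hex, hey⟩, hxy', -⟩ := hxy
          rcases subset_or_subset_of_not_overlap (hnov a y (hsym b hb y hyK) t ht htK) hey
            (hxt hex) with h2 | h2
          · exact h2
          · exact absurd (hxt.trans h2) hxy')
      refine Set.iUnion₂_subset fun x hx => (h3 x ?_).2
      exact Relation.ReflTransGen.trans hback hx
    · exact ⟨b, hb, h1⟩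
  -- a component that some row contains or misses splits the family
  have hsplit : ∀ a ∈ S, ∀ t ∈ S, t ∉ K a → ((⋃ b ∈ K a, ρ b) ⊆ ρ t ∨
      Disjoint (ρ t) (⋃ b ∈ K a, ρ b)) → False := by
    intro a ha t ht htK h
    set U := ⋃ b ∈ K a, ρ b with hU
    let S₂ : Set ι := {t ∈ S | t ∉ K a ∧ (U ⊆ ρ t ∨ Disjoint (ρ t) U)}
    have hS₂ : S₂ ⊆ S := fun x hx => hx.1
    have h1 : C1 ρ (S \ S₂) := hmin _ ⟨Set.sdiff_subset, fun hc => (hc ht).2 ⟨ht, htK, h⟩⟩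
    have h2 : C1 ρ S₂ := hmin _ ⟨hS₂, fun hc => (hc ha).2.1 Relation.ReflTransGen.refl⟩
    apply hS
    rw [← Set.sdiff_union_of_subset hS₂]
    refine h1.glue h2 (U := U) (fun x hx => ?_) (fun x hx => hx.2.2)
    by_cases hxK : x ∈ K a
    · exact Set.subset_biUnion_of_mem (u := ρ) hxK
    · obtain ⟨b, hb, hxb⟩ := hout a ha x hx.1 hxK fun h' => hx.2 ⟨hx.1, hxK, h'⟩
      exact hxb.trans (Set.subset_biUnion_of_mem (u := ρ) hb)
  have hPK : ∀ b ∈ K i, P b := fun b hb =>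
    (hind P i hi hPi (fun x hx y hy _ => hstep x hx y hy) b hb).2
  have hPK' : ∀ b ∈ K j, ¬ P b := fun b hb =>
    (hind (fun b => ¬ P b) j hj hPj
      (fun x hx y hy _ hPx hxy hPy => hPx (hstep y hy x hx hPy hxy.symm)) b hb).2
  have hji : j ∉ K i := fun h => hPj (hPK j h)
  obtain ⟨b, hb, hjb⟩ := hout i hi j hj hji (hsplit i hi j hj hji)
  have hbS := hKS i hi hb
  have hbj : b ∉ K j := fun h => hPK' b h (hPK b hb)
  refine hsplit j hj b hbS hbj (.inl (Set.iUnion₂_subset fun x hx => ?_))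
  refine (hind (fun x => ρ x ⊆ ρ b) j hj hjb (fun x hx y hy hyK hxb hxy => ?_) x hx).2
  obtain ⟨⟨e, hex, hey⟩, hxy', -⟩ := hxy
  rcases subset_or_subset_of_not_overlap (hnov j y hyK b hbS hbj) hey (hxb hex) with h2 | h2
  · exact h2
  · exact absurd (hxb.trans h2) hxy'

/-! ### Change of the base column -/

/-- The rows normalized at the column `v`: each row that contains `v` is replaced by its complement.
Orders of the columns are thereby regarded as circular orders that are cut open at `v`. -/
def flip {ι β : Type*} (ρ : ι → Set β) (v : β) (i : ι) : Set β :=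
  {x | ¬ (x ∈ ρ i ↔ v ∈ ρ i)}

theorem mem_flip {ι β : Type*} {ρ : ι → Set β} {v x : β} {i : ι} :
    x ∈ flip ρ v i ↔ ¬ (x ∈ ρ i ↔ v ∈ ρ i) := Iff.rfl

theorem base_notMem_flip {ι β : Type*} (ρ : ι → Set β) (v : β) (i : ι) : v ∉ flip ρ v i :=
  fun h => h Iff.rfl

theorem flip_of_notMem {ι β : Type*} {ρ : ι → Set β} {v : β} {i : ι} (h : v ∉ ρ i) :
    flip ρ v i = ρ i := by
  ext x
  simp only [mem_flip]
  tauto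

theorem mem_flip_flip {ι β : Type*} (ρ : ι → Set β) (v w x : β) (i : ι) :
    x ∈ flip ρ w i ↔ ¬ (x ∈ flip ρ v i ↔ w ∈ flip ρ v i) := by
  simp only [mem_flip]
  tauto

theorem sep_flip {ι β : Type*} {ρ : ι → Set β} {v a b : β} {G : Set ι} :
    Sep (flip ρ v) G a b ↔ Sep ρ G a b := by
  simp only [Sep, mem_flip]
  refine exists_congr fun i => and_congr_right fun _ => ?_
  tauto

theorem cov_flip {ι β : Type*} {ρ : ι → Set β} {v a : β} {G : Set ι} :
    Cov (flip ρ v) G a ↔ Sep ρ G a v := Iff.rfl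

/-- Overlap of normalized rows means that all four combinations of membership occur, which does not
depend on the base column. -/
theorem ov_flip {ι β : Type*} {ρ : ι → Set β} {v w : β} {i j : ι} (h : Ov (flip ρ v) i j) :
    Ov (flip ρ w) i j := by
  obtain ⟨⟨e, he, he'⟩, h1, h2⟩ := h
  obtain ⟨x, hx, hx'⟩ := Set.not_subset.1 h1
  obtain ⟨y, hy, hy'⟩ := Set.not_subset.1 h2
  simp only [mem_flip] at he he' hx hx' hy hy'
  have key : ∀ p q r : β, p ∈ flip ρ w i → p ∈ flip ρ w j → q ∈ flip ρ w i → q ∉ flip ρ w j →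
      r ∈ flip ρ w j → r ∉ flip ρ w i → Ov (flip ρ w) i j := fun p q r hp hp' hq hq' hr hr' =>
    ⟨⟨p, hp, hp'⟩, Set.not_subset.2 ⟨q, hq, hq'⟩, Set.not_subset.2 ⟨r, hr, hr'⟩⟩
  simp only [mem_flip] at key
  by_cases hi : v ∈ ρ i ↔ w ∈ ρ i <;> by_cases hj : v ∈ ρ j ↔ w ∈ ρ j
  · exact key e x y (by grind) (by grind) (by grind) (by grind) (by grind) (by grind)
  · exact key x e v (by grind) (by grind) (by grind) (by grind) (by grind) (by grind)
  · exact key y v e (by grind) (by grind) (by grind) (by grind) (by grind) (by grind)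
  · exact key v y x (by grind) (by grind) (by grind) (by grind) (by grind) (by grind)

theorem ov_flip_eq {ι β : Type*} (ρ : ι → Set β) (v w : β) : Ov (flip ρ v) = Ov (flip ρ w) := by
  ext i j
  exact ⟨ov_flip, ov_flip⟩

/-- The key that orders the columns from the successor of `y` around to `y`. -/
theorem exists_rotation {ι β : Type*} [Finite β] (ρ : ι → Set β) (v y : β) (f : β → ℤ) :
    ∃ (N : ℤ) (f' : β → ℤ), (∀ a b, f a < f b + N) ∧ (∀ c, f y < f c → f' c = f c) ∧
      (∀ c, f c ≤ f y → f' c = f c + N) ∧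
      ∀ i, Cvx f (flip ρ v i) → Cvx f' (flip ρ y i) := by
  obtain ⟨B, hB⟩ : ∃ B : ℤ, ∀ c, -B < f c ∧ f c < B := by
    obtain ⟨B, hB⟩ := (Set.finite_range fun c => |f c|).bddAbove
    refine ⟨B + 1, fun c => ?_⟩
    have := abs_le.1 (hB ⟨c, rfl⟩ : |f c| ≤ B)
    constructor <;> omega
  have hN : ∀ a b, f a < f b + 2 * B := fun a b => by
    have h1 := hB a
    have h2 := hB b
    omega
  let f' : β → ℤ := fun c => if f y < f c then f c else f c + 2 * B
  have h1 : ∀ c, f y < f c → f' c = f c := fun c hc => by simp [f', hc]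
  have h2 : ∀ c, f c ≤ f y → f' c = f c + 2 * B := fun c hc => by simp [f', not_lt.2 hc]
  refine ⟨2 * B, f', hN, h1, h2, fun i hf => ?_⟩
  have side : ∀ c, (f y < f c ∧ f' c = f c) ∨ (f c ≤ f y ∧ f' c = f c + 2 * B) := fun c => by
    rcases lt_or_ge (f y) (f c) with h | h
    · exact .inl ⟨h, h1 c h⟩
    · exact .inr ⟨h, h2 c h⟩
  intro a ha c hc b hab hbc
  have hac := hN a c
  have hba := hN b a
  have hbc' := hN b c
  have hcb' := hN c b
  have hca := hN c a
  have hab' := hN a b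
  rw [mem_flip_flip ρ v y] at ha hc ⊢
  by_cases hy : y ∈ flip ρ v i
  · simp only [hy, iff_true] at ha hc ⊢
    intro hb
    rcases side b with ⟨hb1, hb2⟩ | ⟨hb1, hb2⟩
    · rcases side a with ⟨ha1, ha2⟩ | ⟨ha1, ha2⟩
      · exact ha (hf y hy b hb a ha1.le (by omega))
      · omega
    · rcases side c with ⟨hc1, hc2⟩ | ⟨hc1, hc2⟩
      · omega
      · exact hc (hf b hb y hy c (by omega) hc1)
  · simp only [hy, iff_false, not_not] at ha hc ⊢
    rcases side a with ⟨ha1, ha2⟩ | ⟨ha1, ha2⟩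
    · have h3 := hf.gt_of_gt ha hy ha1.le hc
      have h4 := h1 c h3
      rcases side b with ⟨hb1, hb2⟩ | ⟨hb1, hb2⟩
      · exact hf a ha c hc b (by omega) (by omega)
      · omega
    · have h3 := hf.lt_of_lt ha hy ha1 hc
      have h4 := h2 c h3.le
      rcases side b with ⟨hb1, hb2⟩ | ⟨hb1, hb2⟩
      · omega
      · exact hf a ha c hc b (by omega) (by omega)

theorem C1.change_base {ι β : Type*} [Finite β] {ρ : ι → Set β} {v w : β} {S : Set ι}
    (h : C1 (flip ρ v) S) : C1 (flip ρ w) S := by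
  obtain ⟨f, hf⟩ := h
  obtain ⟨N, f', -, -, -, h⟩ := exists_rotation ρ v w f
  exact ⟨f', fun i hi => h i (hf i hi)⟩

/-! ### One row against a linked family -/

/-- A key of the cells that orders them as `f` does. -/
theorem exists_cell_key {ι β : Type*} (ρ : ι → Set β) (G : Set ι) (f : β → ℤ) :
    ∃ r : β → ℤ, (∀ a, ∃ a', ¬ Sep ρ G a a' ∧ r a = f a') ∧ ∀ a b, ¬ Sep ρ G a b → r a = r b := by
  let s : Setoid β := ⟨fun a b => ¬ Sep ρ G a b, fun a ⟨i, _, h⟩ => h Iff.rfl,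
    fun h h' => h h'.symm, fun h h' h'' => h' (sep_of_not_sep h h'')⟩
  refine ⟨fun a => f (Quotient.out (Quotient.mk s a)), fun a => ⟨_, ?_, rfl⟩, fun a b h => ?_⟩
  · exact fun h => Quotient.mk_out (s := s) a h.symm
  · have : Quotient.mk s a = Quotient.mk s b := Quotient.sound h
    simp only [this]

theorem cell_key_lt {ι β : Type*} {ρ : ι → Set β} {G : Set ι} (hG : Linked (Ov ρ) G) {f : β → ℤ}
    (hf : ∀ i ∈ G, Cvx f (ρ i)) {r : β → ℤ} (hr : ∀ a, ∃ a', ¬ Sep ρ G a a' ∧ r a = f a')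
    {a b : β} (ha : Cov ρ G a) (hb : Cov ρ G b) (hab : Sep ρ G a b) (hlt : f a < f b) :
    r a < r b := by
  obtain ⟨a', ha', hra⟩ := hr a
  obtain ⟨b', hb', hrb⟩ := hr b
  rw [hra, hrb]
  have h1 := cell_lt hG hf ha ha' hab hlt
  exact cell_gt hG hf hb hb' (sep_of_not_sep ha' hab).symm h1

/-- A linked family with two overlapping sets has, besides any two covered columns, a third cell. -/
theorem exists_third_cell {ι β : Type*} {ρ : ι → Set β} {G : Set ι}
    (hov : ∃ i ∈ G, ∃ j ∈ G, Ov ρ i j) (a b : β) :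
    ∃ c, Cov ρ G c ∧ Sep ρ G c a ∧ Sep ρ G c b := by
  obtain ⟨i, hi, j, hj, ⟨e, he, he'⟩, h1, h2⟩ := hov
  obtain ⟨x, hx, hx'⟩ := Set.not_subset.1 h1
  obtain ⟨y, hy, hy'⟩ := Set.not_subset.1 h2
  by_contra! hc
  have key : ∀ d, Cov ρ G d → (¬ (d ∈ ρ i ↔ a ∈ ρ i) ∨ ¬ (d ∈ ρ j ↔ a ∈ ρ j)) →
      ¬ (¬ (d ∈ ρ i ↔ b ∈ ρ i) ∨ ¬ (d ∈ ρ j ↔ b ∈ ρ j)) := by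
    intro d hd h h'
    exact hc d hd (h.elim (fun h => ⟨i, hi, h⟩) fun h => ⟨j, hj, h⟩)
      (h'.elim (fun h => ⟨i, hi, h⟩) fun h => ⟨j, hj, h⟩)
  have k1 := key e ⟨i, hi, he⟩
  have k2 := key x ⟨i, hi, hx⟩
  have k3 := key y ⟨j, hj, hy⟩
  clear key hc h1 h2
  simp only [he, he', hx, hx', hy, hy', true_iff, false_iff, not_not] at k1 k2 k3
  by_cases h1 : a ∈ ρ i <;> by_cases h2 : a ∈ ρ j <;> by_cases h3 : b ∈ ρ i <;>
    by_cases h4 : b ∈ ρ j <;> simp [h1, h2, h3, h4] at k1 k2 k3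

/-- If a linked family has the consecutive-ones property and loses it when a row is added, then this
row alternates on four columns that the family separates and that are in circular order. -/
theorem exists_alternation {ι β : Type*} [Finite β] {ρ : ι → Set β} {F : Set ι} {Z : ι} {ω : β}
    (hF : Linked (Ov ρ) F) (hov : ∃ i ∈ F, ∃ j ∈ F, Ov ρ i j) {f : β → ℤ}
    (hf : ∀ i ∈ F, Cvx f (ρ i)) (hω : ¬ Cov ρ F ω) (hωZ : ω ∉ ρ Z)
    (hno : ¬ C1 ρ (insert Z F)) :
    ∃ x y z v, Cov ρ F x ∧ Cov ρ F y ∧ Cov ρ F z ∧ ¬ Cov ρ F v ∧ f x < f y ∧ f y < f z ∧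
      Sep ρ F x y ∧ Sep ρ F y z ∧ (x ∈ ρ Z ↔ z ∈ ρ Z) ∧ (y ∈ ρ Z ↔ v ∈ ρ Z) ∧
      ¬ (x ∈ ρ Z ↔ y ∈ ρ Z) := by
  classical
  by_contra hnone
  have hα : ∀ x y z, Cov ρ F x → Cov ρ F y → Cov ρ F z → f x < f y → f y < f z → Sep ρ F x y →
      Sep ρ F y z → x ∈ ρ Z → z ∈ ρ Z → y ∈ ρ Z := fun x y z h1 h2 h3 h4 h5 h6 h7 h8 h9 => by
    by_contra h
    exact hnone ⟨x, y, z, ω, h1, h2, h3, hω, h4, h5, h6, h7, by tauto, by tauto, by tauto⟩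
  obtain ⟨B, hB⟩ : ∃ B : ℤ, ∀ c, -B < f c ∧ f c < B := by
    obtain ⟨B, hB⟩ := (Set.finite_range fun c => |f c|).bddAbove
    refine ⟨B + 1, fun c => ?_⟩
    have := abs_le.1 (hB ⟨c, rfl⟩ : |f c| ≤ B)
    constructor <;> omega
  -- any key that keeps the order of the cells is good for the family
  have good : ∀ (g : β → ℤ) (r : β → ℤ) (k : β → ℤ ×ₗ ℤ), (∀ i ∈ F, Cvx g (ρ i)) →
      (∀ c, -B < g c ∧ g c < B) → (∀ a, ∃ a', ¬ Sep ρ F a a' ∧ r a = g a') →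
      (∀ c, Cov ρ F c → (ofLex (k c)).1 = r c) →
      (∀ c, ¬ Cov ρ F c → (ofLex (k c)).1 = B ∨ (ofLex (k c)).1 = -B) →
      ∀ i ∈ F, Cvx k (ρ i) := by
    intro g r k hg hgB hr hkU hkW i hi a ha c hc b hab hbc
    obtain ⟨a', haa, hra⟩ := hr a
    obtain ⟨b', hbb, hrb⟩ := hr b
    obtain ⟨c', hcc, hrc⟩ := hr c
    have h1 := (Prod.Lex.le_iff.1 hab).imp_right And.left
    have h2 := (Prod.Lex.le_iff.1 hbc).imp_right And.left
    rw [hkU a ⟨i, hi, ha⟩, ← le_iff_lt_or_eq, hra] at h1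
    rw [hkU c ⟨i, hi, hc⟩, ← le_iff_lt_or_eq, hrc] at h2
    have h3 := hgB a'
    have h4 := hgB c'
    by_cases hb : Cov ρ F b
    · rw [hkU b hb, hrb] at h1 h2
      rw [iff_of_not_sep hbb hi]
      exact hg i hi a' ((iff_of_not_sep haa hi).1 ha) c' ((iff_of_not_sep hcc hi).1 hc) b' h1 h2
    · have := hkW b hb
      omega
  have hB0 : 0 < B := by
    have := hB ω
    omega
  by_cases hW : ∃ w ∈ ρ Z, ¬ Cov ρ F w
  · obtain ⟨w, hwZ, hw⟩ := hW
    have hβ : ∀ x y z, Cov ρ F x → Cov ρ F y → Cov ρ F z → f x < f y → f y < f z → Sep ρ F x y →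
        Sep ρ F y z → x ∉ ρ Z → z ∉ ρ Z → y ∉ ρ Z := fun x y z h1 h2 h3 h4 h5 h6 h7 h8 h9 h => by
      exact hnone ⟨x, y, z, w, h1, h2, h3, hw, h4, h5, h6, h7, by tauto, by tauto, by tauto⟩
    -- the row covers an initial part of the union of the family, and its other columns come first
    have main : ∀ g : β → ℤ, (∀ i ∈ F, Cvx g (ρ i)) → (∀ c, -B < g c ∧ g c < B) →
        (∀ c u, Cov ρ F c → Cov ρ F u → Sep ρ F c u → c ∈ ρ Z → u ∉ ρ Z → g c < g u) →
        False := by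
      intro g hg hgB hpre
      obtain ⟨r, hr, hr'⟩ := exists_cell_key ρ F g
      let k : β → ℤ ×ₗ ℤ := fun c => if Cov ρ F c then toLex (r c, if c ∈ ρ Z then -1 else 0)
        else toLex (if c ∈ ρ Z then -B else B, 0)
      have hkU : ∀ c, Cov ρ F c → (ofLex (k c)).1 = r c := fun c hc => by simp [k, hc]
      apply hno
      apply C1.of_key k
      rintro i (rfl | hi)
      · intro a ha c hc b hab hbc
        by_contra hb
        have h2 := Prod.Lex.le_iff.1 hbc
        have hrc : -B < r c ∧ r c < B := by
          obtain ⟨c', -, hrc⟩ := hr c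
          rw [hrc]
          exact hgB c'
        by_cases hcU : Cov ρ F c
        · by_cases hbU : Cov ρ F b
          · simp only [k, hcU, hbU, hc, hb, if_true, if_false, ofLex_toLex] at h2
            by_cases hcb : Sep ρ F c b
            · have := cell_key_lt hF hg hr hcU hbU hcb (hpre c b hcU hbU hcb hc hb)
              omega
            · have := hr' c b hcb
              omega
          · simp only [k, hcU, hbU, hc, hb, if_true, if_false, ofLex_toLex] at h2
            omega
        · by_cases hbU : Cov ρ F b
          · have hrb : -B < r b := by
              obtain ⟨b', -, hrb⟩ := hr b
              rw [hrb]
              exact (hgB b').1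
            simp only [k, hcU, hbU, hc, hb, if_true, if_false, ofLex_toLex] at h2
            omega
          · simp only [k, hcU, hbU, hc, hb, if_true, if_false, ofLex_toLex] at h2
            omega
      · refine good g r k hg hgB hr hkU (fun c hc => ?_) i hi
        by_cases hcZ : c ∈ ρ Z
        · simp [k, hc, hcZ]
        · simp [k, hc, hcZ]
    by_cases hpre : ∀ c u, Cov ρ F c → Cov ρ F u → Sep ρ F c u → c ∈ ρ Z → u ∉ ρ Z → f c < f u
    · exact main f hf hB hpre
    · push Not at hpre
      obtain ⟨c, u, hc, hu, hcu, hcZ, huZ, huc⟩ := hpre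
      have huc := lt_of_le_of_ne huc (hcu.ne_key hf).symm
      apply main (fun c => -f c) (fun i hi => (hf i hi).neg) (fun c => by have := hB c; omega)
      intro c' u' hc' hu' hcu' hcZ' huZ'
      by_contra hlt
      simp only [neg_lt_neg_iff, not_lt] at hlt
      have hlt := lt_of_le_of_ne hlt (hcu'.ne_key hf)
      have tr : ∀ {a b}, Cov ρ F a → Cov ρ F b → Sep ρ F a b → f a < f b ∨ f b < f a :=
        fun _ _ h => lt_or_gt_of_ne (h.ne_key hf)
      -- comparing the two pairs leaves only that `u`, `c'` and `c`, `u'` share their cells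
      have e1 : ¬ Sep ρ F u c' := by
        intro h
        rcases tr hu hc' h with h' | h'
        · exact hβ u c' u' hu hc' hu' h' hlt h hcu' huZ huZ' hcZ'
        · exact huZ (hα c' u c hc' hu hc h' huc h.symm hcu.symm hcZ' hcZ)
      have e2 : ¬ Sep ρ F c u' := by
        intro h
        rcases tr hc hu' h with h' | h'
        · exact hβ u c u' hu hc hu' huc h' hcu.symm h huZ huZ' hcZ
        · exact huZ' (hα c' u' c hc' hu' hc hlt h' hcu' h.symm hcZ' hcZ)
      obtain ⟨s, hs, hsu, hsc⟩ := exists_third_cell hov u c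
      have hsc' : Sep ρ F s c' := (sep_of_not_sep e1 hsu.symm).symm
      have hsu' : Sep ρ F s u' := (sep_of_not_sep e2 hsc.symm).symm
      rcases tr hs hu hsu with h1 | h1
      · by_cases hsZ : s ∈ ρ Z
        · exact huZ (hα s u c hs hu hc h1 huc hsu hcu.symm hsZ hcZ)
        · exact hβ s c' u' hs hc' hu' (cell_gt hF hf hu e1 hsu.symm h1) hlt hsc' hcu' hsZ huZ' hcZ'
      · rcases tr hs hc hsc with h2 | h2
        · by_cases hsZ : s ∈ ρ Z
          · exact hβ u s u' hu hs hu' h1 (cell_gt hF hf hc e2 hsc.symm h2) hsu.symm hsu' huZ huZ' hsZ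
          · exact hsZ (hα c' s c hc' hs hc (cell_lt hF hf hu e1 hsu.symm h1) h2 hsc'.symm hsc
              hcZ' hcZ)
        · by_cases hsZ : s ∈ ρ Z
          · exact huZ' (hα c' u' s hc' hu' hs hlt (cell_lt hF hf hc e2 hsc.symm h2) hcu' hsu'.symm
              hcZ' hsZ)
          · exact hβ u c s hu hc hs huc h2 hcu.symm hsc.symm huZ hsZ hcZ
  · push Not at hW
    obtain ⟨r, hr, hr'⟩ := exists_cell_key ρ F f
    -- within its cell a column of the row moves towards the later cells that the row meets
    let k : β → ℤ ×ₗ ℤ := fun c => if Cov ρ F c then toLex (r c, if c ∈ ρ Z then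
      (if ∃ z ∈ ρ Z, Sep ρ F c z ∧ f c < f z then 1 else -1) else 0) else toLex (B, 0)
    have hkU : ∀ c, Cov ρ F c → (ofLex (k c)).1 = r c := fun c hc => by simp [k, hc]
    apply hno
    apply C1.of_key k
    rintro i (rfl | hi)
    · intro a ha c hc b hab hbc
      by_contra hb
      have h1 := Prod.Lex.le_iff.1 hab
      have h2 := Prod.Lex.le_iff.1 hbc
      have haU := hW a ha
      have hcU := hW c hc
      have hrc : r c < B := by
        obtain ⟨c', -, hrc⟩ := hr c
        rw [hrc]
        exact (hB c').2
      have hbU : Cov ρ F b := by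
        by_contra hbU
        simp only [k, hcU, hbU, hc, if_true, if_false, ofLex_toLex] at h2
        omega
      simp only [k, haU, hcU, hbU, ha, hc, hb, if_true, if_false, ofLex_toLex] at h1 h2
      -- compare the cells of `a`, `b` and of `b`, `c`
      have hrab : r a < r b → Sep ρ F a b ∧ f a < f b := fun h => by
        have hs : Sep ρ F a b := by
          by_contra hs
          have := hr' a b hs
          omega
        refine ⟨hs, lt_of_not_ge fun hle => ?_⟩
        have := cell_key_lt hF hf hr hbU haU hs.symm (lt_of_le_of_ne hle (hs.ne_key hf).symm)
        omega
      have hrbc : r b < r c → Sep ρ F b c ∧ f b < f c := fun h => by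
        have hs : Sep ρ F b c := by
          by_contra hs
          have := hr' b c hs
          omega
        refine ⟨hs, lt_of_not_ge fun hle => ?_⟩
        have := cell_key_lt hF hf hr hcU hbU hs.symm (lt_of_le_of_ne hle (hs.ne_key hf).symm)
        omega
      have hsame : ∀ p q, Cov ρ F p → Cov ρ F q → r p = r q → ¬ Sep ρ F p q := by
        intro p q hp hq hpq hs
        rcases lt_or_gt_of_ne (hs.ne_key hf) with h | h
        · have := cell_key_lt hF hf hr hp hq hs h
          omega
        · have := cell_key_lt hF hf hr hq hp hs.symm h
          omega
      rcases h1 with h1 | ⟨h1, h1'⟩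
      · obtain ⟨hsab, hlab⟩ := hrab h1
        rcases h2 with h2 | ⟨h2, h2'⟩
        · obtain ⟨hsbc, hlbc⟩ := hrbc h2
          exact hb (hα a b c haU hbU hcU hlab hlbc hsab hsbc ha hc)
        · have hns := hsame b c hbU hcU h2
          split_ifs at h2' with hz
          · obtain ⟨z, hz, hcz, hlz⟩ := hz
            have hns' : ¬ Sep ρ F c b := fun h => hns h.symm
            exact hb (hα a b z haU hbU (hW z hz) hlab (cell_lt hF hf hcU hns' hcz hlz) hsab
              (sep_of_not_sep hns' hcz) ha hz)
          · omega
      · have hns := hsame a b haU hbU h1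
        split_ifs at h1' with hz
        · omega
        · rcases h2 with h2 | ⟨h2, h2'⟩
          · obtain ⟨hsbc, hlbc⟩ := hrbc h2
            have hns' : ¬ Sep ρ F b a := fun h => hns h.symm
            exact hz ⟨c, hc, sep_of_not_sep hns' hsbc, cell_lt hF hf hbU hns' hsbc hlbc⟩
          · split_ifs at h2' with hz'
            · obtain ⟨z, hz', hcz, hlz⟩ := hz'
              have hca : ¬ Sep ρ F c a := hsame c a hcU haU (by omega)
              exact hz ⟨z, hz', sep_of_not_sep hca hcz, cell_lt hF hf hcU hca hcz hlz⟩
            · omega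
    · refine good f r k hf hB hr hkU (fun c hc => ?_) i hi
      simp [k, hc]

/-! ### Circular obstructions -/

/-- For some base column, the normalized rows `r` have the columns of the 0-1 matrix `τ`. The base
column then adds a column of zeros to this pattern. -/
def HasPattern {ι β : Type*} (ρ : ι → Set β) {p q : ℕ} (r : Fin p → ι)
    (τ : Matrix (Fin p) (Fin q) Bool) : Prop :=
  ∃ (v : β) (g : Fin q → β), ∀ i j, g j ∈ flip ρ v (r i) ↔ τ i j = true

/-- Four rows that are pairwise overlapping; a column of ones is added to a cycle of length four. -/
def fullPattern : Matrix (Fin 4) (Fin 5) Bool :=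
  !![false, true, true, true, false;
     false, true, true, false, true;
     true, true, false, false, true;
     true, true, false, true, false]

/-- A row that overlaps three other rows; with the last row complemented it is `M_IV` without the
column of one of its rows of size two, whose place the base column takes. -/
def starPattern : Matrix (Fin 4) (Fin 5) Bool :=
  !![false, true, true, true, false;
     false, false, false, true, true;
     true, true, false, false, false;
     true, true, false, true, true]

/-- The rows `r` form a cycle in which `g i` is a common column of the rows `i - 1` and `i` and lies
in no other row, and rows that are not adjacent in the cycle are disjoint. Indices are cyclic. -/
def IsRowCycle {ι β : Type*} (σ : ι → Set β) {t : ℕ} (r : Fin (t + 4) → ι)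
    (g : Fin (t + 4) → β) : Prop :=
  (∀ i j, g j ∈ σ (r i) ↔ j = i ∨ j = i + 1) ∧
    ∀ i j, i ≠ j → j ≠ i + 1 → i ≠ j + 1 → Disjoint (σ (r i)) (σ (r j))

theorem eq_succ_iff {n : ℕ} (i j : Fin (n + 1)) :
    j = i + 1 ↔ (j : ℕ) = i + 1 ∨ ((i : ℕ) = n ∧ (j : ℕ) = 0) := by
  rw [Fin.ext_iff, Fin.val_add_one]
  have hi := i.isLt
  have hj := j.isLt
  split_ifs with h
  · have : (i : ℕ) = n := by simp [h]
    omega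
  · have : (i : ℕ) ≠ n := fun h' => h (Fin.ext h')
    omega

/-- A chordless path of rows between `Z` and `D` whose rows meet `Z` and `D` only at its ends closes
to a cycle, as `Z` and `D` have a common column `w` outside the path. -/
theorem exists_rowCycle {ι β : Type*} {σ : ι → Set β} {Z D : ι} {R : ℕ → ι} {p : ℕ} {w : β}
    (hp : 1 ≤ p) (hwZ : w ∈ σ Z) (hwD : w ∈ σ D)
    (hR : ∀ i < p, (σ (R i) ∩ σ (R (i + 1))).Nonempty)
    (hZ0 : (σ Z ∩ σ (R 0)).Nonempty) (hDp : (σ (R p) ∩ σ D).Nonempty)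
    (hZ : ∀ i, 1 ≤ i → i ≤ p → Disjoint (σ Z) (σ (R i)))
    (hD : ∀ i, i < p → Disjoint (σ (R i)) (σ D))
    (hch : ∀ i j, i + 1 < j → j ≤ p → ¬ Overlap (σ (R i)) (σ (R j)))
    (hw : ∀ i ≤ p, w ∉ σ (R i)) :
    ∃ (t : ℕ) (r : Fin (t + 4) → ι) (g : Fin (t + 4) → β), IsRowCycle σ r g ∧
      ∀ i, r i = Z ∨ r i = D ∨ ∃ k ≤ p, r i = R k := by
  -- rows of the path that are not adjacent cannot be nested either
  have hdis : ∀ i j, i + 1 < j → j ≤ p → Disjoint (σ (R i)) (σ (R j)) := by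
    intro i
    induction i with
    | zero =>
      intro j hj hjp
      obtain ⟨e, heZ, he⟩ := hZ0
      have hnot : ∀ k, 1 ≤ k → k ≤ p → ¬ σ (R 0) ⊆ σ (R k) := fun k hk hkp h =>
        Set.disjoint_left.1 (hZ k hk hkp) heZ (h he)
      by_contra hnd
      obtain ⟨d, hd, hd'⟩ := Set.not_disjoint_iff.1 hnd
      have hsub : ∀ k, j ≤ k → k ≤ p → σ (R k) ⊆ σ (R 0) := by
        intro k hk
        induction k, hk using Nat.le_induction with
        | base =>
          intro _
          exact (subset_or_subset_of_not_overlap (hch 0 j hj hjp) hd hd').resolve_left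
            (hnot j (by omega) hjp)
        | succ k hk ih =>
          intro hkp
          obtain ⟨a, ha, ha'⟩ := hR k (by omega)
          exact (subset_or_subset_of_not_overlap (hch 0 (k + 1) (by omega) hkp)
            (ih (by omega) ha) ha').resolve_left (hnot _ (by omega) hkp)
      obtain ⟨a, ha, haD⟩ := hDp
      exact Set.disjoint_left.1 (hD 0 (by omega)) (hsub p hjp le_rfl ha) haD
    | succ i ih =>
      intro j hj hjp
      obtain ⟨e, hei, he⟩ := hR i (by omega)
      have hnot : ∀ k, i + 2 ≤ k → k ≤ p → ¬ σ (R (i + 1)) ⊆ σ (R k) := fun k hk hkp h =>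
        Set.disjoint_left.1 (ih k (by omega) hkp) hei (h he)
      by_contra hnd
      obtain ⟨d, hd, hd'⟩ := Set.not_disjoint_iff.1 hnd
      have hsub : ∀ k, j ≤ k → k ≤ p → σ (R k) ⊆ σ (R (i + 1)) := by
        intro k hk
        induction k, hk using Nat.le_induction with
        | base =>
          intro _
          exact (subset_or_subset_of_not_overlap (hch _ j hj hjp) hd hd').resolve_left
            (hnot j (by omega) hjp)
        | succ k hk ih =>
          intro hkp
          obtain ⟨a, ha, ha'⟩ := hR k (by omega)
          exact (subset_or_subset_of_not_overlap (hch _ (k + 1) (by omega) hkp)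
            (ih (by omega) ha) ha').resolve_left (hnot _ (by omega) hkp)
      obtain ⟨a, ha, haD⟩ := hDp
      exact Set.disjoint_left.1 (hD (i + 1) (by omega)) (hsub p hjp le_rfl ha) haD
  obtain ⟨t, rfl⟩ : ∃ t, p = t + 1 := ⟨p - 1, by omega⟩
  obtain ⟨a, haZ, ha⟩ := hZ0
  obtain ⟨d, hd, hdD⟩ := hDp
  have : Nonempty β := ⟨w⟩
  choose! e he he' using hR
  let T : ℕ → ι := fun i => if i = 0 then Z else if i ≤ t + 2 then R (i - 1) else D
  let g : ℕ → β := fun j => if j = 0 then w else if j = 1 then a else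
    if j ≤ t + 2 then e (j - 2) else d
  have hT0 : T 0 = Z := by simp [T]
  have hTs : ∀ i, i ≤ t + 1 → T (i + 1) = R i := fun i hi => by simp [T, hi]
  have hTl : T (t + 3) = D := by simp [T]
  have hg0 : g 0 = w := by simp [g]
  have hg1 : g 1 = a := by simp [g]
  have hgs : ∀ i, i ≤ t → g (i + 2) = e i := fun i hi => by simp [g, hi]
  have hgl : g (t + 3) = d := by simp [g]
  have hin : ∀ j ≤ t + 3, g j ∈ σ (T j) := by
    intro j hj
    rcases (by omega : j = 0 ∨ j = 1 ∨ (2 ≤ j ∧ j ≤ t + 2) ∨ j = t + 3) with rfl | rfl | hj | rfl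
    · rwa [hg0, hT0]
    · rwa [hg1, hTs 0 (by omega)]
    · obtain ⟨k, rfl⟩ : ∃ k, j = k + 2 := ⟨j - 2, by omega⟩
      rw [hgs k (by omega), hTs (k + 1) (by omega)]
      exact he' k (by omega)
    · rwa [hgl, hTl]
  have hin' : ∀ j ≤ t + 2, g (j + 1) ∈ σ (T j) := by
    intro j hj
    rcases (by omega : j = 0 ∨ (1 ≤ j ∧ j ≤ t + 1) ∨ j = t + 2) with rfl | hj | rfl
    · rwa [hg1, hT0]
    · obtain ⟨k, rfl⟩ : ∃ k, j = k + 1 := ⟨j - 1, by omega⟩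
      rw [hgs k (by omega), hTs k (by omega)]
      exact he k (by omega)
    · rw [hgl, hTs (t + 1) (by omega)]
      exact hd
  have hTd : ∀ i k, k ≤ t + 3 → i + 1 < k → ¬ (i = 0 ∧ k = t + 3) →
      Disjoint (σ (T i)) (σ (T k)) := by
    intro i k hk hik hne
    rcases Nat.eq_zero_or_pos i with rfl | hi
    · obtain ⟨k, rfl⟩ : ∃ l, k = l + 1 := ⟨k - 1, by omega⟩
      rw [hT0, hTs k (by omega)]
      exact hZ k (by omega) (by omega)
    · obtain ⟨i, rfl⟩ : ∃ l, i = l + 1 := ⟨i - 1, by omega⟩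
      rcases (by omega : k ≤ t + 2 ∨ k = t + 3) with hk | rfl
      · obtain ⟨k, rfl⟩ : ∃ l, k = l + 1 := ⟨k - 1, by omega⟩
        rw [hTs i (by omega), hTs k (by omega)]
        exact hdis i k (by omega) (by omega)
      · rw [hTs i (by omega), hTl]
        exact hD i (by omega)
  have hout : ∀ i ≤ t + 3, ∀ j ≤ t + 3, g j ∈ σ (T i) → j = i ∨ j = i + 1 ∨ (i = t + 3 ∧ j = 0) := by
    intro i hi j hj hmem
    by_contra hne
    rcases Nat.eq_zero_or_pos j with rfl | hj0
    · rcases (by omega : i = 1 ∨ 2 ≤ i) with rfl | hi2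
      · exact Set.disjoint_left.1 (hTd 1 (t + 3) le_rfl (by omega) (by omega)) hmem
          (by rwa [hg0, hTl])
      · exact Set.disjoint_left.1 (hTd 0 i hi (by omega) (by omega)) (hin 0 (by omega)) hmem
    · have h1 := hin j hj
      have h2 := hin' (j - 1) (by omega)
      rw [show j - 1 + 1 = j by omega] at h2
      rcases (by omega : j < i ∨ i + 1 < j) with h | h
      · by_cases hc : j = 1 ∧ i = t + 3
        · exact Set.disjoint_left.1 (hTd j i hi (by omega) (by omega)) h1 hmem
        · exact Set.disjoint_left.1 (hTd (j - 1) i hi (by omega) (by omega)) h2 hmem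
      · by_cases hc : i = 0 ∧ j = t + 3
        · exact Set.disjoint_left.1 (hTd i (j - 1) (by omega) (by omega) (by omega)) hmem h2
        · exact Set.disjoint_left.1 (hTd i j hj h hc) hmem h1
  refine ⟨t, fun i => T i, fun j => g j, ⟨fun i j => ?_, fun i j h1 h2 h3 => ?_⟩, fun i => ?_⟩
  · have hi := i.isLt
    have hj := j.isLt
    rw [eq_succ_iff, Fin.ext_iff]
    constructor
    · intro h
      exact hout i (by omega) j (by omega) h
    · show _ → g j ∈ σ (T i)
      rintro (h | h | ⟨h, h'⟩)
      · rw [h]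
        exact hin i (by omega)
      · rw [h]
        exact hin' i (by omega)
      · rwa [h, h', hg0, hTl]
  · have hi := i.isLt
    have hj := j.isLt
    rw [Ne, eq_succ_iff] at h2 h3
    rw [Ne, Fin.ext_iff] at h1
    rcases lt_or_gt_of_ne h1 with h | h
    · exact hTd i j (by omega) (by omega) (by omega)
    · exact (hTd j i (by omega) (by omega) (by omega)).symm
  · have hi := i.isLt
    rcases (by omega : (i : ℕ) = 0 ∨ (1 ≤ (i : ℕ) ∧ (i : ℕ) ≤ t + 2) ∨ (i : ℕ) = t + 3)
      with h | h | h
    · left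
      simp only [h, hT0]
    · right; right
      refine ⟨i - 1, by omega, ?_⟩
      rw [← hTs _ (by omega), show (i : ℕ) - 1 + 1 = i by omega]
    · right; left
      simp only [h, hTl]

/-- A row `A` overlaps both `Z` and `D`, which contain the uncovered column `x`; in the order of the
family `Z` can only end towards the right and `D` only towards the left. If `D` contains all of
`A ∩ Z`, then `A`, a row `A'` that overlaps it, `Z` and `D` form one of the two small patterns. -/
theorem small_pattern {ι β : Type*} {σ : ι → Set β} {G : Set ι} {Z D A A' : ι} {x : β}
    {f : β → ℤ} (hf : ∀ i ∈ G, Cvx f (σ i)) (hxG : ∀ i ∈ G, x ∉ σ i) (hxZ : x ∈ σ Z)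
    (hxD : x ∈ σ D) (hA : A ∈ G) (hA' : A' ∈ G) (hAA : Ov σ A A') (hZA : Ov σ Z A)
    (hDA : Ov σ D A)
    (hZ : ∀ c u, Cov σ G c → Cov σ G u → Sep σ G c u → c ∈ σ Z → u ∉ σ Z → f u < f c)
    (hD : ∀ c u, Cov σ G c → Cov σ G u → Sep σ G c u → c ∈ σ D → u ∉ σ D → f c < f u)
    (hsub : ∀ c ∈ σ A, c ∈ σ Z → c ∈ σ D) :
    (∃ g : Fin 5 → β, ∀ i j, g j ∈ σ (![A, A', Z, D] i) ↔ fullPattern i j = true) ∨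
    (∃ g : Fin 5 → β, ∀ i j, g j ∈ σ (![A, A', Z, D] i) ↔ starPattern i j = true) := by
  obtain ⟨c, hcZ, hcA⟩ := hZA.1
  obtain ⟨u, huA, huD⟩ := Set.not_subset.1 hDA.2.2
  have huZ : u ∉ σ Z := fun h => huD (hsub u huA h)
  have hcD := hsub c hcA hcZ
  have hcov : ∀ d ∈ σ A, Cov σ G d := fun d hd => ⟨A, hA, hd⟩
  have hcov' : ∀ d ∈ σ A', Cov σ G d := fun d hd => ⟨A', hA', hd⟩
  have hcell : ∀ c' ∈ σ A, c' ∈ σ Z → ∀ u' ∈ σ A, u' ∉ σ D → ¬ Sep σ G c' u' :=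
    fun c' hc' hcZ' u' hu' huD' hs => lt_asymm
      (hZ c' u' (hcov _ hc') (hcov _ hu') hs hcZ' fun h => huD' (hsub u' hu' h))
      (hD c' u' (hcov _ hc') (hcov _ hu') hs (hsub c' hc' hcZ') huD')
  have hcu : c ∈ σ A' ↔ u ∈ σ A' := iff_of_not_sep (hcell c hcA hcZ u huA huD) hA'
  have hsA : ∀ d e, d ∈ σ A → e ∉ σ A → Sep σ G d e := fun d e hd he =>
    ⟨A, hA, fun h => he (h.1 hd)⟩
  have hsA' : ∀ d e, ¬ (d ∈ σ A' ↔ e ∈ σ A') → Sep σ G d e := fun d e h => ⟨A', hA', h⟩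
  obtain ⟨s, hsA'1, hsA1⟩ := Set.not_subset.1 hAA.2.2
  have hxA := hxG A hA
  have hxA' := hxG A' hA'
  by_cases hcA' : c ∈ σ A'
  · left
    have huA' := hcu.1 hcA'
    obtain ⟨t, htA, htA'⟩ := Set.not_subset.1 hAA.2.1
    have htZ : t ∉ σ Z := fun h =>
      hcell t htA h u huA huD (hsA' _ _ (by simp [htA', huA']))
    have htD : t ∈ σ D := by
      by_contra h
      exact hcell c hcA hcZ t htA h (hsA' _ _ (by simp [htA', hcA']))
    have h1 : f t < f c := hZ c t (hcov _ hcA) (hcov _ htA) (hsA' _ _ (by simp [htA', hcA'])) hcZ htZ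
    have h2 : f c < f s := by
      by_contra! h
      rcases le_total (f t) (f s) with h' | h'
      · exact hsA1 (hf A hA t htA c hcA s h' h)
      · exact htA' (hf A' hA' s hsA'1 c hcA' t h' h1.le)
    have hsD : s ∉ σ D := fun h => hsA1 (hf A hA c hcA u huA s h2.le
      (hD s u (hcov' _ hsA'1) (hcov _ huA) (hsA _ _ huA hsA1).symm h huD).le)
    have hsZ : s ∈ σ Z := by
      by_contra h
      exact lt_asymm h2 (hZ c s (hcov _ hcA) (hcov' _ hsA'1) (hsA _ _ hcA hsA1) hcZ h)
    refine ⟨![x, c, u, t, s], fun i j => ?_⟩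
    fin_cases i <;> fin_cases j <;> simp [fullPattern, *]
  · right
    have huA' : u ∉ σ A' := fun h => hcA' (hcu.2 h)
    obtain ⟨r, hrA, hrA'⟩ := hAA.1
    have hrZ : r ∉ σ Z := fun h =>
      hcell r hrA h u huA huD (hsA' _ _ (by simp [hrA', huA']))
    have hrD : r ∈ σ D := by
      by_contra h
      exact hcell c hcA hcZ r hrA h (hsA' _ _ (by simp [hrA', hcA']))
    have h1 : f r < f c := hZ c r (hcov _ hcA) (hcov _ hrA) (hsA' _ _ (by simp [hrA', hcA'])) hcZ hrZ
    have h2 : f s < f r := by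
      by_contra! h
      rcases le_total (f s) (f c) with h' | h'
      · exact hsA1 (hf A hA r hrA c hcA s h h')
      · exact hcA' (hf A' hA' r hrA' s hsA'1 c h1.le h')
    have hsZ : s ∉ σ Z := fun h => by
      have h3 := hZ s u (hcov' _ hsA'1) (hcov _ huA) (hsA _ _ huA hsA1).symm h huZ
      exact hsA1 (hf A hA u huA c hcA s h3.le (h2.trans h1).le)
    have hsD : s ∈ σ D := by
      by_contra h
      exact lt_asymm (h2.trans h1)
        (hD c s (hcov _ hcA) (hcov' _ hsA'1) (hsA _ _ hcA hsA1) hcD h)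
    refine ⟨![x, c, u, r, s], fun i j => ?_⟩
    fin_cases i <;> fin_cases j <;> simp [starPattern, *]

/-- The obstructions to a circular order that can occur in a family `S` of rows: a cycle of rows
with at least four members, or one of three small patterns. -/
def HasObstruction {ι β : Type*} (ρ : ι → Set β) (S : Set ι) : Prop :=
  (∃ r : Fin 3 → ι, (∀ i, r i ∈ S) ∧ HasPattern ρ r (tuckerI 0)) ∨
  (∃ r : Fin 4 → ι, (∀ i, r i ∈ S) ∧
    (HasPattern ρ r fullPattern ∨ HasPattern ρ r starPattern)) ∨
  ∃ (v : β) (t : ℕ) (r : Fin (t + 4) → ι) (g : Fin (t + 4) → β),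
    (∀ i, r i ∈ S) ∧ IsRowCycle (flip ρ v) r g

/-- Two rows `Z` and `D` that share the column `x` outside a linked family `G`, and that the order of
`G` forces to leave its union at opposite ends, obstruct a circular order: with a shortest path of
rows of `G` from a row that overlaps `Z` to one that overlaps `D` they form a cycle. -/
theorem obstruction_of_conflict {ι β : Type*} {ρ : ι → Set β} {v x : β} {G : Set ι} {Z D : ι}
    {f : β → ℤ} (hG : Linked (Ov (flip ρ v)) G) (hov : ∃ i ∈ G, ∃ j ∈ G, Ov (flip ρ v) i j)
    (hf : ∀ i ∈ G, Cvx f (flip ρ v i)) (hxG : ∀ i ∈ G, x ∉ flip ρ v i) (hxZ : x ∈ flip ρ v Z)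
    (hxD : x ∈ flip ρ v D) (hZG : ∃ i ∈ G, Ov (flip ρ v) Z i) (hDG : ∃ i ∈ G, Ov (flip ρ v) D i)
    (hZ : ∀ c u, Cov (flip ρ v) G c → Cov (flip ρ v) G u → Sep (flip ρ v) G c u →
      c ∈ flip ρ v Z → u ∉ flip ρ v Z → f u < f c)
    (hD : ∀ c u, Cov (flip ρ v) G c → Cov (flip ρ v) G u → Sep (flip ρ v) G c u →
      c ∈ flip ρ v D → u ∉ flip ρ v D → f c < f u) :
    HasObstruction ρ (insert Z (insert D G)) := by
  obtain ⟨p, R, hRG, hRo, hR0, hRp, hRZ, hRD, hch⟩ := hG.exists_path hZG hDG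
  have hGS : ∀ i ∈ G, i ∈ insert Z (insert D G) := fun i hi => .inr (.inr hi)
  have hZS : Z ∈ insert Z (insert D G) := .inl rfl
  have hDS : D ∈ insert Z (insert D G) := .inr (.inl rfl)
  set σ := flip ρ v with hσ
  rcases Nat.eq_zero_or_pos p with rfl | hp
  · -- a single row overlaps both `Z` and `D`
    have hA := hRG 0 le_rfl
    set A := R 0
    obtain ⟨A', hA', hAA⟩ : ∃ A' ∈ G, Ov σ A A' := by
      obtain ⟨i, hi, j, hj, hij⟩ := hov
      by_cases hne : ∃ k ∈ G, k ∉ ({A} : Set ι)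
      · obtain ⟨a, -, b, hb, haA, -, hab⟩ := hG.exists_rel (C := {A}) ⟨A, hA, rfl⟩ hne
        exact ⟨b, hb, Set.mem_singleton_iff.1 haA ▸ hab⟩
      · push Not at hne
        rw [Set.mem_singleton_iff.1 (hne i hi)] at hij
        exact ⟨j, hj, hij⟩
    have fin4 : ∀ a b c d : ι, a ∈ G → b ∈ G → c ∈ insert Z (insert D G) →
        d ∈ insert Z (insert D G) → ∀ i, ![a, b, c, d] i ∈ insert Z (insert D G) := by
      intro a b c d ha hb hc hd i
      fin_cases i
      exacts [hGS a ha, hGS b hb, hc, hd]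
    by_cases h1 : ∀ c ∈ σ A, c ∈ σ Z → c ∈ σ D
    · refine .inr (.inl ⟨![A, A', Z, D], fin4 _ _ _ _ hA hA' hZS hDS, ?_⟩)
      exact (small_pattern hf hxG hxZ hxD hA hA' hAA hR0 hRp hZ hD h1).imp
        (fun h => ⟨v, h⟩) fun h => ⟨v, h⟩
    by_cases h2 : ∀ c ∈ σ A, c ∈ σ D → c ∈ σ Z
    · refine .inr (.inl ⟨![A, A', D, Z], fin4 _ _ _ _ hA hA' hDS hZS, ?_⟩)
      exact (small_pattern (f := fun c => -f c) (fun i hi => (hf i hi).neg) hxG hxD hxZ hA hA' hAA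
        hRp hR0 (fun c u hc hu hs h h' => by simpa using hD c u hc hu hs h h')
        (fun c u hc hu hs h h' => by simpa using hZ c u hc hu hs h h') h2).imp
        (fun h => ⟨v, h⟩) fun h => ⟨v, h⟩
    push Not at h1 h2
    obtain ⟨q, hqA, hqZ, hqD⟩ := h1
    obtain ⟨s, hsA, hsD, hsZ⟩ := h2
    have hxA := hxG A hA
    refine .inl ⟨![Z, D, A], fun i => ?_, v, ![q, x, s], fun i j => ?_⟩
    · fin_cases i
      exacts [hZS, hDS, hGS A hA]
    · rw [← hσ]
      clear hσ
      fin_cases i <;> fin_cases j <;> simp [tuckerI, *]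
  · -- the other rows of the path lie inside `Z`, or all of them miss it; likewise for `D`
    have hZi : ∀ i, 1 ≤ i → i ≤ p → σ (R i) ⊆ σ Z ∨ Disjoint (σ Z) (σ (R i)) := by
      intro i hi hip
      by_contra! hc
      obtain ⟨a, ha, ha'⟩ := Set.not_disjoint_iff.1 hc.2
      refine absurd (hRZ i hip ⟨⟨a, ha, ha'⟩, fun h => ?_, hc.1⟩) (by omega)
      exact hxG _ (hRG i hip) (h hxZ)
    have hDi : ∀ i, i < p → σ (R i) ⊆ σ D ∨ Disjoint (σ (R i)) (σ D) := by
      intro i hip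
      by_contra! hc
      obtain ⟨a, ha, ha'⟩ := Set.not_disjoint_iff.1 hc.2
      refine absurd (hRD i hip.le ⟨⟨a, ha', ha⟩, fun h => ?_, hc.1⟩) (by omega)
      exact hxG _ (hRG i hip.le) (h hxD)
    have hZall : (∀ i, 1 ≤ i → i ≤ p → σ (R i) ⊆ σ Z) ∨
        ∀ i, 1 ≤ i → i ≤ p → Disjoint (σ Z) (σ (R i)) := by
      rcases hZi 1 le_rfl hp with h | h
      · left
        intro i hi
        induction i, hi using Nat.le_induction with
        | base => exact fun _ => h
        | succ k hk ih =>
          intro hkp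
          refine (hZi (k + 1) (by omega) hkp).resolve_right fun hd => ?_
          obtain ⟨a, ha, ha'⟩ := (hRo k (by omega)).1
          exact Set.disjoint_left.1 hd (ih (by omega) ha) ha'
      · right
        intro i hi
        induction i, hi using Nat.le_induction with
        | base => exact fun _ => h
        | succ k hk ih =>
          intro hkp
          refine (hZi (k + 1) (by omega) hkp).resolve_left fun hd => ?_
          obtain ⟨a, ha, ha'⟩ := (hRo k (by omega)).1
          exact Set.disjoint_left.1 (ih (by omega)) (hd ha') ha
    have hDall : (∀ i, i < p → σ (R i) ⊆ σ D) ∨ ∀ i, i < p → Disjoint (σ (R i)) (σ D) := by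
      rcases hDi 0 hp with h | h
      · left
        intro i
        induction i with
        | zero => exact fun _ => h
        | succ k ih =>
          intro hkp
          refine (hDi (k + 1) hkp).resolve_right fun hd => ?_
          obtain ⟨a, ha, ha'⟩ := (hRo k (by omega)).1
          exact Set.disjoint_left.1 hd ha' (ih (by omega) ha)
      · right
        intro i
        induction i with
        | zero => exact fun _ => h
        | succ k ih =>
          intro hkp
          refine (hDi (k + 1) hkp).resolve_left fun hd => ?_
          obtain ⟨a, ha, ha'⟩ := (hRo k (by omega)).1
          exact Set.disjoint_left.1 (ih (by omega)) ha (hd ha')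
    have hmem : ∀ {t : ℕ} {r : Fin (t + 4) → ι},
        (∀ i, r i = Z ∨ r i = D ∨ ∃ k ≤ p, r i = R k) → ∀ i, r i ∈ insert Z (insert D G) := by
      intro t r h i
      rcases h i with h | h | ⟨k, hk, h⟩
      · exact h ▸ hZS
      · exact h ▸ hDS
      · exact h ▸ hGS _ (hRG k hk)
    obtain ⟨c₀, hc₀Z, hc₀⟩ := hR0.1
    obtain ⟨u₀, hu₀, hu₀Z⟩ := Set.not_subset.1 hR0.2.2
    obtain ⟨c₁, hc₁D, hc₁⟩ := hRp.1
    obtain ⟨u₁, hu₁, hu₁D⟩ := Set.not_subset.1 hRp.2.2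
    have h0G := hRG 0 (by omega)
    have hpG := hRG p le_rfl
    rcases hZall with hZs | hZd <;> rcases hDall with hDs | hDd
    · -- the complements of `Z` and `D` share `v` instead of `x`
      have hx : ∀ i, x ∈ flip ρ v i → ∀ y, y ∈ flip ρ x i ↔ y ∉ flip ρ v i := by
        intro i hi y
        rw [mem_flip_flip ρ v]
        exact ⟨fun h h' => h (iff_of_true h' hi), fun h h' => h (h'.2 hi)⟩
      have hR : ∀ i ≤ p, flip ρ x (R i) = σ (R i) := by
        intro i hi
        ext y
        rw [mem_flip_flip ρ v]
        have := hxG _ (hRG i hi)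
        exact ⟨fun h => by_contra fun h' => h (iff_of_false h' this), fun h h' => this (h'.1 h)⟩
      have hv := base_notMem_flip ρ v
      obtain ⟨t, r, g, hcyc, hr⟩ := exists_rowCycle (σ := flip ρ x) (Z := Z) (D := D) (R := R)
        (p := p) (w := v) hp ((hx Z hxZ v).2 (hv Z)) ((hx D hxD v).2 (hv D))
        (fun i hi => by rw [hR i hi.le, hR (i + 1) hi]; exact (hRo i hi).1)
        ⟨u₀, (hx Z hxZ _).2 hu₀Z, by rwa [hR 0 (by omega)]⟩
        ⟨u₁, by rwa [hR p le_rfl], (hx D hxD _).2 hu₁D⟩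
        (fun i hi hip => Set.disjoint_left.2 fun a ha ha' => (hx Z hxZ a).1 ha
          (hZs i hi hip (by rwa [← hR i hip])))
        (fun i hip => Set.disjoint_left.2 fun a ha ha' => (hx D hxD a).1 ha'
          (hDs i hip (by rwa [← hR i hip.le])))
        (fun i j hij hj => by rw [hR i (by omega), hR j hj]; exact hch i j hij hj)
        (fun i hi => by rw [hR i hi]; exact hv _)
      exact .inr (.inr ⟨x, t, r, g, hmem hr, hcyc⟩)
    · exfalso
      have h1 : c₁ ∉ σ (R 0) := fun h => Set.disjoint_left.1 (hDd 0 hp) h hc₁D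
      have h2 : u₀ ∉ σ D := Set.disjoint_left.1 (hDd 0 hp) hu₀
      have hs : Sep σ G c₁ u₀ := ⟨R 0, h0G, fun h => h1 (h.2 hu₀)⟩
      exact lt_asymm (hZ c₁ u₀ ⟨_, hpG, hc₁⟩ ⟨_, h0G, hu₀⟩ hs (hZs p hp le_rfl hc₁) hu₀Z)
        (hD c₁ u₀ ⟨_, hpG, hc₁⟩ ⟨_, h0G, hu₀⟩ hs hc₁D h2)
    · exfalso
      have h1 : c₀ ∉ σ (R p) := Set.disjoint_left.1 (hZd p hp le_rfl) hc₀Z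
      have h2 : u₁ ∉ σ Z := fun h => Set.disjoint_left.1 (hZd p hp le_rfl) h hu₁
      have hs : Sep σ G c₀ u₁ := ⟨R p, hpG, fun h => h1 (h.2 hu₁)⟩
      exact lt_asymm (hZ c₀ u₁ ⟨_, h0G, hc₀⟩ ⟨_, hpG, hu₁⟩ hs hc₀Z h2)
        (hD c₀ u₁ ⟨_, h0G, hc₀⟩ ⟨_, hpG, hu₁⟩ hs (hDs 0 hp hc₀) hu₁D)
    · obtain ⟨t, r, g, hcyc, hr⟩ := exists_rowCycle (σ := σ) (Z := Z) (D := D) (R := R)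
        (p := p) (w := x) hp hxZ hxD (fun i hi => (hRo i hi).1) ⟨c₀, hc₀Z, hc₀⟩ ⟨c₁, hc₁, hc₁D⟩
        hZd hDd hch (fun i hi => hxG _ (hRG i hi))
      exact .inr (.inr ⟨v, t, r, g, hmem hr, hcyc⟩)

/-- The row `Z` alternates on the columns `v, x, y, z`, which the family `F` separates and which are
in this circular order: with respect to the base column `v`, the family has the order `f`, which
lists `x`, `y`, `z` in this order, and the row contains `x` and `z` but not `y`. -/
structure Alternation {ι β : Type*} (ρ : ι → Set β) (F : Set ι) (Z : ι) (f : β → ℤ)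
    (v x y z : β) : Prop where
  cvx : ∀ i ∈ F, Cvx f (flip ρ v i)
  covx : Sep ρ F x v
  covy : Sep ρ F y v
  covz : Sep ρ F z v
  xy : f x < f y
  yz : f y < f z
  sepxy : Sep ρ F x y
  sepyz : Sep ρ F y z
  xZ : x ∈ flip ρ v Z
  yZ : y ∉ flip ρ v Z
  zZ : z ∈ flip ρ v Z

theorem Alternation.mirror {ι β : Type*} {ρ : ι → Set β} {F : Set ι} {Z : ι} {f : β → ℤ}
    {v x y z : β} (h : Alternation ρ F Z f v x y z) :
    Alternation ρ F Z (fun c => -f c) v z y x where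
  cvx := fun i hi => (h.cvx i hi).neg
  covx := h.covz
  covy := h.covy
  covz := h.covx
  xy := by simpa using h.yz
  yz := by simpa using h.xy
  sepxy := h.sepyz.symm
  sepyz := h.sepxy.symm
  xZ := h.zZ
  yZ := h.yZ
  zZ := h.xZ

theorem Alternation.base_outside {ι β : Type*} {ρ : ι → Set β} {F : Set ι} {Z : ι} {f : β → ℤ}
    {v x y z : β} (h : Alternation ρ F Z f v x y z) {G : Set ι} (hGF : G ⊆ F)
    (hG : Linked (Ov (flip ρ v)) G) {a b : β} (ha : Sep ρ G a v) (hb : Sep ρ G b v) :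
    f v < f a ∧ f v < f b ∨ f a < f v ∧ f b < f v := by
  have hc := cov_cvx hG fun i hi => h.cvx i (hGF hi)
  have hv : v ∉ {c | Cov (flip ρ v) G c} := fun ⟨i, _, h⟩ => base_notMem_flip ρ v i h
  rcases le_total (f a) (f v) with h' | h'
  · exact .inr ⟨hc.lt_of_lt ha hv h' ha, hc.lt_of_lt ha hv h' hb⟩
  · exact .inl ⟨hc.gt_of_gt ha hv h' ha, hc.gt_of_gt ha hv h' hb⟩

/-- Cutting the circular order open at `y` instead of `v`. -/
theorem Alternation.rotate {ι β : Type*} [Finite β] {ρ : ι → Set β} {F : Set ι} {Z : ι}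
    {f : β → ℤ} {v x y z : β} (h : Alternation ρ F Z f v x y z)
    (hF : Linked (Ov (flip ρ v)) F) :
    ∃ (N : ℤ) (f' : β → ℤ), Alternation ρ F Z f' y z v x ∧ (∀ a b, f a < f b + N) ∧
      (∀ c, f y < f c → f' c = f c) ∧ (∀ c, f c ≤ f y → f' c = f c + N) := by
  obtain ⟨N, f', hN, h1, h2, hcvx⟩ := exists_rotation ρ v y f
  have hxy := h.xy
  have hyz := h.yz
  have hout := h.base_outside subset_rfl hF h.covx h.covz
  have hz := h1 z hyz
  have hx := h2 x hxy.le
  have hN1 := hN v x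
  have hN2 := hN z v
  have hN3 := hN z x
  refine ⟨N, f', ⟨fun i hi => hcvx i (h.cvx i hi), h.sepyz.symm, h.covy.symm, h.sepxy, ?_, ?_,
    h.covz, h.covx.symm, ?_, ?_, ?_⟩, hN, h1, h2⟩
  · rcases le_or_gt (f v) (f y) with hv | hv
    · have := h2 v hv
      omega
    · have := h1 v hv
      omega
  · rcases le_or_gt (f v) (f y) with hv | hv
    · have := h2 v hv
      omega
    · have := h1 v hv
      omega
  · rw [mem_flip_flip ρ v]
    exact fun h' => h.yZ (h'.1 h.zZ)
  · rw [mem_flip_flip ρ v]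
    exact fun h' => h' (iff_of_false (base_notMem_flip ρ v Z) h.yZ)
  · rw [mem_flip_flip ρ v]
    exact fun h' => h.yZ (h'.1 h.xZ)

section Conflict

variable {ι β : Type*} {ρ : ι → Set β} {G : Set ι} {Z D : ι}

theorem Alternation.facts {f : β → ℤ} {v x y z : β}
    (h : Alternation ρ (insert D G) Z f v x y z) (hG : ∀ w, Linked (Ov (flip ρ w)) G)
    (hDG : ∀ w, ∃ i ∈ G, Ov (flip ρ w) D i) (hx : ¬ Sep ρ G x v) :
    x ∈ flip ρ v D ∧ Sep ρ G y v ∧ Sep ρ G z v := by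
  have hcov := cov_cvx (hG v) fun i hi => h.cvx i (.inr hi)
  have hxD : x ∈ flip ρ v D := by
    obtain ⟨i, hi | hi, hs⟩ := h.covx
    · exact hi ▸ hs
    · exact absurd ⟨i, hi, hs⟩ hx
  have hy : Sep ρ G y v := by
    by_contra hy
    have h1 : y ∈ flip ρ v D := by
      obtain ⟨i, hi | hi, hs⟩ := h.covy
      · exact hi ▸ hs
      · exact absurd ⟨i, hi, hs⟩ hy
    obtain ⟨i, hi | hi, hs⟩ := sep_flip (v := v) |>.2 h.sepxy
    · rw [hi] at hs
      exact hs (iff_of_true hxD h1)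
    · exact hs (iff_of_false (fun h => hx ⟨i, hi, h⟩) fun h => hy ⟨i, hi, h⟩)
  refine ⟨hxD, hy, ?_⟩
  by_contra hz
  have h1 : z ∈ flip ρ v D := by
    obtain ⟨i, hi | hi, hs⟩ := h.covz
    · exact hi ▸ hs
    · exact absurd ⟨i, hi, hs⟩ hz
  -- all rows of `G` lie between `x` and `z`, hence inside `D`
  obtain ⟨i, hi, hDi⟩ := hDG v
  refine hDi.2.2 fun c hc => h.cvx D (.inl rfl) x hxD z h1 c ?_ ?_
  · exact (hcov.gt_of_gt hy hx h.xy.le ⟨i, hi, hc⟩).le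
  · exact (hcov.lt_of_lt hy hz h.yz.le ⟨i, hi, hc⟩).le

/-- If the columns `v` and `x` of an alternation are separated only by `D`, and the row `Z` is seen
to extend to the right in the order of `G`, then `Z` and `D` are in conflict. -/
theorem Alternation.obstruction {f : β → ℤ} {v x y z c u : β}
    (h : Alternation ρ (insert D G) Z f v x y z) (hG : ∀ w, Linked (Ov (flip ρ w)) G)
    (hov : ∀ w, ∃ i ∈ G, ∃ j ∈ G, Ov (flip ρ w) i j)
    (hDG : ∀ w, ∃ i ∈ G, Ov (flip ρ w) D i) (hZG : ∀ w, ∃ i ∈ G, Ov (flip ρ w) Z i)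
    (hC1 : ∀ w, C1 (flip ρ w) (insert Z G)) (hx : ¬ Sep ρ G x v)
    (hc : Sep ρ G c v) (hu : Sep ρ G u v) (hcu : Sep ρ G c u) (hcZ : c ∈ flip ρ v Z)
    (huZ : u ∉ flip ρ v Z) (huc : f u < f c) : HasObstruction ρ (insert Z (insert D G)) := by
  obtain ⟨hxD, hy, hz⟩ := h.facts hG hDG hx
  have hcvx : ∀ i ∈ G, Cvx f (flip ρ v i) := fun i hi => h.cvx i (.inr hi)
  have hcov := cov_cvx (hG v) hcvx
  have hxG : ∀ i ∈ G, x ∉ flip ρ v i := fun i hi h' => hx ⟨i, hi, h'⟩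
  refine obstruction_of_conflict (hG v) (hov v) hcvx hxG h.xZ hxD (hZG v) (hDG v) ?_ ?_
  · obtain ⟨g, hg⟩ := hC1 v
    obtain ⟨g', -, hcg, hor⟩ := exists_same_orientation (hG v) hcvx fun i hi => hg i (.inr hi)
    have hg' : ∀ i ∈ insert Z G, Cvx g' (flip ρ v i) := fun i hi => hcg _ (hg i hi)
    have hcov' := cov_cvx (hG v) fun i hi => hg' i (.inr hi)
    have h1 := hor u c hu hc (sep_flip.2 hcu.symm) huc
    -- in an order of `G` and `Z`, the column `x` lies to the right of the union of `G`
    have hxr : g' c < g' x := by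
      by_contra! hle
      have := hcov'.gt_of_gt hc hx hle hu
      exact huZ (hg' Z (.inl rfl) x h.xZ c hcZ u this.le h1.le)
    intro c' u' hc' hu' hs hcZ' huZ'
    by_contra! hle
    have hlt := hor c' u' hc' hu' hs (lt_of_le_of_ne hle (hs.ne_key hcvx))
    have := hcov'.lt_of_lt hc hx hxr.le hu'
    exact huZ' (hg' Z (.inl rfl) c' hcZ' x h.xZ u' hlt.le this.le)
  · intro c' u' hc' hu' hs hcD huD
    by_contra! hle
    have := hcov.gt_of_gt hy hx h.xy.le hu'
    exact huD (h.cvx D (.inl rfl) x hxD c' hcD u' this.le hle)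

theorem Alternation.obstruction_of_not_sep [Finite β] {f : β → ℤ} {v x y z : β}
    (h : Alternation ρ (insert D G) Z f v x y z) (hG : ∀ w, Linked (Ov (flip ρ w)) G)
    (hF : ∀ w, Linked (Ov (flip ρ w)) (insert D G))
    (hov : ∀ w, ∃ i ∈ G, ∃ j ∈ G, Ov (flip ρ w) i j)
    (hDG : ∀ w, ∃ i ∈ G, Ov (flip ρ w) D i) (hZG : ∀ w, ∃ i ∈ G, Ov (flip ρ w) Z i)
    (hC1 : ∀ w, C1 (flip ρ w) (insert Z G)) (hx : ¬ Sep ρ G x v) :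
    HasObstruction ρ (insert Z (insert D G)) := by
  obtain ⟨hxD, hy, hz⟩ := h.facts hG hDG hx
  have ob := fun {c u} => h.obstruction (c := c) (u := u) hG hov hDG hZG hC1 hx
  by_cases hyz : Sep ρ G y z
  · exact ob hz hy hyz.symm h.zZ h.yZ h.yz
  -- otherwise `D` also splits the cell of `y` and `z`, and a third cell decides which of the two
  -- split cells shows the conflict
  obtain ⟨s, hs, hsy, hsz⟩ := exists_third_cell (hov v) y z
  rw [cov_flip] at hs
  rw [sep_flip] at hsy hsz
  have hne : f s ≠ f y := (sep_flip (v := v) |>.2 hsy).ne_key fun i hi => h.cvx i (.inr hi)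
  have hcvx : ∀ i ∈ G, Cvx f (flip ρ v i) := fun i hi => h.cvx i (.inr hi)
  obtain ⟨N, f', h', hN, h1, h2⟩ := h.rotate (hF v)
  have hz' : ¬ Sep ρ G z y := fun h => hyz h.symm
  have ob' := fun {c u} => h'.obstruction (c := c) (u := u) hG hov hDG hZG hC1 hz'
  have mem : ∀ d, d ∈ flip ρ y Z ↔ d ∈ flip ρ v Z := by
    intro d
    rw [mem_flip_flip ρ v y]
    have := h.yZ
    exact ⟨fun h => by_contra fun h' => h (iff_of_false h' this), fun h h' => this (h'.1 h)⟩
  by_cases hsZ : s ∈ flip ρ v Z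
  · rcases lt_or_gt_of_ne hne with hlt | hlt
    · refine ob' (c := s) (u := v) hsy hy.symm hs ((mem s).2 hsZ)
        (fun h => base_notMem_flip ρ v Z ((mem v).1 h)) ?_
      rw [h2 s hlt.le]
      have := hN v s
      rcases h.base_outside (Set.subset_insert _ _) (hG v) hs hy with hv | hv
      · rw [h2 v (by omega)]
        omega
      · rw [h1 v (by omega)]
        omega
    · exact ob hs hy hsy hsZ h.yZ hlt
  · rcases lt_or_gt_of_ne hne with hlt | hlt
    · exact ob hz hs hsz.symm h.zZ hsZ (hlt.trans h.yz)
    · refine ob' (c := x) (u := s) (sep_of_not_sep (fun h => hx h.symm) hy.symm) hsy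
        (sep_of_not_sep (fun h => hx h.symm) hs.symm)
        ((mem x).2 h.xZ) (fun h => hsZ ((mem s).1 h)) ?_
      rw [h1 s hlt, h2 x h.xy.le]
      exact hN s x

theorem Alternation.obstruction_of_removable [Finite β] {f : β → ℤ} {v x y z : β}
    (h : Alternation ρ (insert D G) Z f v x y z) (hG : ∀ w, Linked (Ov (flip ρ w)) G)
    (hF : ∀ w, Linked (Ov (flip ρ w)) (insert D G))
    (hov : ∀ w, ∃ i ∈ G, ∃ j ∈ G, Ov (flip ρ w) i j)
    (hDG : ∀ w, ∃ i ∈ G, Ov (flip ρ w) D i) (hZG : ∀ w, ∃ i ∈ G, Ov (flip ρ w) Z i)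
    (hC1 : ∀ w, C1 (flip ρ w) (insert Z G)) : HasObstruction ρ (insert Z (insert D G)) := by
  have ob := fun {f v x y z} (h : Alternation ρ (insert D G) Z f v x y z) =>
    h.obstruction_of_not_sep hG hF hov hDG hZG hC1
  by_cases hx : Sep ρ G x v
  swap
  · exact ob h hx
  by_cases hz : Sep ρ G z v
  swap
  · exact ob h.mirror hz
  obtain ⟨N, f', h', -⟩ := h.rotate (hF v)
  by_cases hxy : Sep ρ G x y
  swap
  · exact ob h'.mirror hxy
  by_cases hyz : Sep ρ G z y
  swap
  · exact ob h' hyz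
  -- if `G` separates all neighbours, then `Z` violates its order
  exfalso
  have hcvx : ∀ i ∈ G, Cvx f (flip ρ v i) := fun i hi => h.cvx i (.inr hi)
  have hy : Sep ρ G y v := cov_cvx (hG v) hcvx x hx z hz y h.xy.le h.yz.le
  obtain ⟨g, hg⟩ := hC1 v
  obtain ⟨g', -, hcg, hor⟩ := exists_same_orientation (hG v) hcvx fun i hi => hg i (.inr hi)
  exact h.yZ (hcg _ (hg Z (.inl rfl)) x h.xZ z h.zZ y
    (hor x y hx hy (sep_flip.2 hxy) h.xy).le (hor y z hy hz (sep_flip.2 hyz.symm) h.yz).le)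

end Conflict

theorem C1_pair {ι β : Type*} (ρ : ι → Set β) (i j : ι) : C1 ρ {i, j} := by
  classical
  refine ⟨fun c => if c ∈ ρ i then (if c ∈ ρ j then 2 else 1) else (if c ∈ ρ j then 3 else 4), ?_⟩
  rintro k (rfl | rfl) a ha c hc b hab hbc
  · by_contra hb
    simp only [ha, hc, hb, if_true, if_false] at hab hbc
    split_ifs at hab hbc <;> omega
  · by_contra hb
    simp only [ha, hc, hb, if_true, if_false] at hab hbc
    split_ifs at hab hbc <;> omega

/-- A minimal family without the consecutive-ones property contains a circular obstruction. -/
theorem obstruction_of_minimal {ι β : Type*} [Finite β] {ρ : ι → Set β} {S : Set ι} {ω : β}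
    (hfin : S.Finite) (hω : ∀ i, ω ∉ ρ i) (hS : ¬ C1 ρ S) (hmin : ∀ S', S' ⊂ S → C1 ρ S') :
    HasObstruction ρ S := by
  have hρ : flip ρ ω = ρ := funext fun i => flip_of_notMem (hω i)
  have hl := linked_of_minimal hS hmin
  have hsymm := Ov.symm (ρ := ρ)
  have hpair : ∀ i j, ∃ k ∈ S, k ≠ i ∧ k ≠ j := by
    intro i j
    by_contra! hc
    refine hS ((C1_pair ρ i j).mono fun k hk => ?_)
    by_cases hki : k = i
    · exact .inl hki
    · exact .inr (hc k hk hki)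
  obtain ⟨a₀, ha₀⟩ : S.Nonempty := by
    rw [Set.nonempty_iff_ne_empty]
    rintro rfl
    exact hS ⟨fun _ => 0, by simp⟩
  obtain ⟨Z, hZ, hZa, hF⟩ := hl.exists_removable hsymm hfin ha₀
    (let ⟨k, hk, h, _⟩ := hpair a₀ a₀; ⟨k, hk, h⟩)
  have hZS : insert Z (S \ {Z}) = S := by simp [hZ]
  have hovF : ∃ i ∈ S \ {Z}, ∃ j ∈ S \ {Z}, Ov ρ i j := by
    obtain ⟨k, hk, hka, hkZ⟩ := hpair a₀ Z
    obtain ⟨i, hi, j, hj, -, -, hij⟩ := hF.exists_rel (C := {a₀}) ⟨a₀, ⟨ha₀, hZa.symm⟩, rfl⟩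
      ⟨k, ⟨hk, hkZ⟩, hka⟩
    exact ⟨i, hi, j, hj, hij⟩
  obtain ⟨f, hf⟩ := hmin (S \ {Z}) ⟨Set.sdiff_subset, fun h => (h hZ).2 rfl⟩
  obtain ⟨x, y, z, v, hx, hy, hz, hv, hxy, hyz, hsxy, hsyz, hxzZ, hyvZ, hne⟩ :=
    exists_alternation hF hovF hf (fun ⟨i, _, h⟩ => hω i h) (hω Z) (by rwa [hZS])
  have hvF : ∀ i ∈ S \ {Z}, flip ρ v i = ρ i := fun i hi =>
    flip_of_notMem fun h => hv ⟨i, hi, h⟩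
  have halt : Alternation ρ (S \ {Z}) Z f v x y z := by
    have sv : ∀ {c}, Cov ρ (S \ {Z}) c → Sep ρ (S \ {Z}) c v := fun hc => sep_of_cov hc hv
    refine ⟨fun i hi => by rw [hvF i hi]; exact hf i hi, sv hx, sv hy, sv hz, hxy, hyz, hsxy,
      hsyz, ?_, ?_, ?_⟩ <;> rw [mem_flip] <;> tauto
  have hLv : ∀ {C : Set ι}, Linked (Ov ρ) C → ∀ w, Linked (Ov (flip ρ w)) C := fun hC w => by
    rw [ov_flip_eq ρ w ω, hρ]
    exact hC
  have hOv : ∀ {i j}, Ov ρ i j → ∀ w, Ov (flip ρ w) i j := fun h w => by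
    rw [ov_flip_eq ρ w ω, hρ]
    exact h
  have hfinF : (S \ {Z}).Finite := hfin.subset Set.sdiff_subset
  by_cases htwo : ∃ A D, S \ {Z} = {A, D}
  · -- two overlapping rows have just four cells, on which `Z` alternates
    obtain ⟨A, D, hAD⟩ := htwo
    have hAF : A ∈ S \ {Z} := by rw [hAD]; exact .inl rfl
    have hDF : D ∈ S \ {Z} := by rw [hAD]; exact .inr rfl
    have hoAD : Ov ρ A D := by
      obtain ⟨i, hi, j, hj, hij⟩ := hovF
      rw [hAD] at hi hj
      rcases hi with rfl | rfl <;> rcases hj with rfl | rfl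
      · exact absurd subset_rfl hij.2.1
      · exact hij
      · exact hij.symm
      · exact absurd subset_rfl hij.2.1
    have cvA := hf A hAF
    have cvD := hf D hDF
    obtain ⟨-, hnAD, hnDA⟩ := hoAD
    obtain ⟨a, haA, haD⟩ := Set.not_subset.1 hnAD
    obtain ⟨d, hdD, hdA⟩ := Set.not_subset.1 hnDA
    have cov : ∀ c, Cov ρ (S \ {Z}) c → c ∈ ρ A ∨ c ∈ ρ D := by
      rintro c ⟨i, hi, hc⟩
      rw [hAD] at hi
      rcases hi with rfl | rfl
      exacts [.inl hc, .inr hc]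
    have sep : ∀ c e, Sep ρ (S \ {Z}) c e → ¬ ((c ∈ ρ A ↔ e ∈ ρ A) ∧ (c ∈ ρ D ↔ e ∈ ρ D)) := by
      rintro c e ⟨i, hi, hc⟩ ⟨h1, h2⟩
      rw [hAD] at hi
      rcases hi with rfl | rfl
      exacts [hc h1, hc h2]
    have hyAD : ∀ {A D : ι} {d : β}, Cvx f (ρ A) → Cvx f (ρ D) → d ∈ ρ D → d ∉ ρ A →
        (∀ c, Cov ρ (S \ {Z}) c → c ∈ ρ A ∨ c ∈ ρ D) →
        (∀ c e, Sep ρ (S \ {Z}) c e → ¬ ((c ∈ ρ A ↔ e ∈ ρ A) ∧ (c ∈ ρ D ↔ e ∈ ρ D))) →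
        y ∈ ρ A → y ∈ ρ D := by
      intro A D d cvA cvD hdD hdA cov sep hyA
      by_contra hyD
      have h1 : x ∈ ρ D := by
        by_contra h
        exact sep x y hsxy ⟨iff_of_true ((cov x hx).resolve_right h) hyA, iff_of_false h hyD⟩
      have h2 : z ∈ ρ D := by
        by_contra h
        exact sep y z hsyz ⟨iff_of_true hyA ((cov z hz).resolve_right h), iff_of_false hyD h⟩
      exact hyD (cvD x h1 z h2 y hxy.le hyz.le)
    have hyA : y ∈ ρ A := by
      rcases cov y hy with h | h
      · exact h
      · exact hyAD (d := a) cvD cvA haA haD (fun c hc => (cov c hc).symm)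
          (fun c e hs h => sep c e hs h.symm) h
    have hyD : y ∈ ρ D := hyAD (d := d) cvA cvD hdD hdA cov sep hyA
    have hx2 := sep x y hsxy
    have hz2 := sep y z hsyz
    simp only [hyA, hyD, iff_true, true_iff] at hx2 hz2
    -- if `x` and `z` had the same type, then one of the two rows would lie between them
    have hboth : ∀ {A D : ι} {d : β}, Cvx f (ρ A) → Cvx f (ρ D) → d ∈ ρ D → d ∉ ρ A → y ∈ ρ D →
        x ∈ ρ A → z ∈ ρ A → x ∉ ρ D → z ∉ ρ D → False := by
      intro A D d cvA cvD hdD hdA hyD hxA hzA hxD hzD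
      have h1 := cvD.gt_of_gt hyD hxD hxy.le hdD
      have h2 := cvD.lt_of_lt hyD hzD hyz.le hdD
      exact hdA (cvA x hxA z hzA d h1.le h2.le)
    have hxc := cov x hx
    have hzc := cov z hz
    have hFS : ∀ i ∈ S \ {Z}, i ∈ S := fun i hi => hi.1
    have hxZ := halt.xZ
    have hyZ := halt.yZ
    have hzZ := halt.zZ
    have eA := hvF A hAF
    have eD := hvF D hDF
    by_cases hxA : x ∈ ρ A
    · have hxD : x ∉ ρ D := fun h => hx2 ⟨hxA, h⟩
      by_cases hzA : z ∈ ρ A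
      · exact (hboth cvA cvD hdD hdA hyD hxA hzA hxD fun h => hz2 ⟨hzA, h⟩).elim
      · have hzD := hzc.resolve_left hzA
        refine .inl ⟨![Z, A, D], fun i => ?_, v, ![z, x, y], fun i j => ?_⟩
        · fin_cases i
          exacts [hZ, hAF.1, hDF.1]
        · fin_cases i <;> fin_cases j <;> simp [tuckerI, *]
    · have hxD := hxc.resolve_left hxA
      by_cases hzA : z ∈ ρ A
      · have hzD : z ∉ ρ D := fun h => hz2 ⟨hzA, h⟩
        refine .inl ⟨![Z, A, D], fun i => ?_, v, ![x, z, y], fun i j => ?_⟩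
        · fin_cases i
          exacts [hZ, hAF.1, hDF.1]
        · fin_cases i <;> fin_cases j <;> simp [tuckerI, *]
      · exact (hboth cvD cvA haA haD hyA hxD (hzc.resolve_left hzA) hxA hzA).elim
  -- choose a second removable row such that `Z` overlaps some of the remaining ones
  have hFne : ∀ i ∈ S \ {Z}, ∃ j ∈ S \ {Z}, j ≠ i := by
    intro i hi
    obtain ⟨k, hk, hki, hkZ⟩ := hpair i Z
    exact ⟨k, ⟨hk, hkZ⟩, hki⟩
  obtain ⟨A, hA, hZA⟩ : ∃ A ∈ S \ {Z}, Ov ρ Z A := by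
    obtain ⟨i, -, j, hj, hi, hjZ, hij⟩ := hl.exists_rel (C := {Z}) ⟨Z, hZ, rfl⟩
      ⟨a₀, ha₀, hZa.symm⟩
    exact ⟨j, ⟨hj, hjZ⟩, Set.mem_singleton_iff.1 hi ▸ hij⟩
  obtain ⟨D, hD, hDA, hG⟩ := hF.exists_removable hsymm hfinF hA (hFne A hA)
  set G := (S \ {Z}) \ {D} with hGdef
  have hDF : insert D G = S \ {Z} := by
    rw [hGdef, Set.insert_sdiff_singleton, Set.insert_eq_of_mem hD]
  have hAG : A ∈ G := ⟨hA, fun h => hDA (Set.mem_singleton_iff.1 h).symm⟩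
  have hovG : ∃ i ∈ G, ∃ j ∈ G, Ov ρ i j := by
    by_cases hk : ∃ k ∈ G, k ∉ ({A} : Set ι)
    · obtain ⟨i, hi, j, hj, -, -, hij⟩ := hG.exists_rel (C := {A}) ⟨A, hAG, rfl⟩ hk
      exact ⟨i, hi, j, hj, hij⟩
    · push Not at hk
      exfalso
      apply htwo
      refine ⟨A, D, ?_⟩
      rw [← hDF]
      ext i
      simp only [Set.mem_insert_iff, Set.mem_singleton_iff]
      constructor
      · rintro (h | h)
        exacts [.inr h, .inl (hk i h)]
      · rintro (h | h)
        exacts [.inr (h ▸ hAG), .inl h]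
  obtain ⟨E, hE, hDE⟩ : ∃ E ∈ G, Ov ρ D E := by
    obtain ⟨i, -, j, hj, hi, hjD, hij⟩ := hF.exists_rel (C := {D}) ⟨D, hD, rfl⟩
      ⟨A, hA, fun h => hDA (Set.mem_singleton_iff.1 h).symm⟩
    exact ⟨j, ⟨hj, hjD⟩, Set.mem_singleton_iff.1 hi ▸ hij⟩
  have hC1 : C1 ρ (insert Z G) := by
    apply hmin
    refine ⟨Set.insert_subset hZ fun i hi => hi.1.1, fun h => ?_⟩
    rcases h hD.1 with h' | h'
    · exact hD.2 h'
    · exact h'.2 rfl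
  rw [← hDF] at halt hF
  rw [← hZS, ← hDF]
  exact halt.obstruction_of_removable (hLv hG) (hLv hF)
    (fun w => let ⟨i, hi, j, hj, h⟩ := hovG; ⟨i, hi, j, hj, hOv h w⟩)
    (fun w => ⟨E, hE, hOv hDE w⟩) (fun w => ⟨A, hAG, hOv hZA w⟩)
    (fun w => (hρ.symm ▸ hC1 : C1 (flip ρ ω) _).change_base)

/-! ### Orders of the columns as lists and as keys -/

theorem triple_sublist_iff {α : Type*} {f : α → ℤ} {l : List α}
    (hl : l.Pairwise fun a b => f a < f b) {a b c : α} :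
    [a, b, c].Sublist l ↔ (a ∈ l ∧ b ∈ l ∧ c ∈ l) ∧ f a < f b ∧ f b < f c := by
  constructor
  · intro h
    have h' := hl.sublist h
    simp only [List.pairwise_cons, List.mem_cons, List.not_mem_nil, or_false] at h'
    exact ⟨⟨h.subset (by simp), h.subset (by simp), h.subset (by simp)⟩,
      h'.1 b (.inl rfl), h'.2.1 c rfl⟩
  · rintro ⟨⟨ha, hb, hc⟩, hab, hbc⟩
    have hp : [a, b, c].Pairwise fun a b => f a < f b := by
      simp only [List.pairwise_cons, List.mem_cons, List.not_mem_nil, or_false]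
      refine ⟨?_, ?_, by simp⟩
      · rintro x (rfl | rfl) <;> omega
      · rintro x rfl
        exact hbc
    have : Std.Antisymm fun a b : α => f a < f b := ⟨fun a b h h' => absurd h h'.asymm⟩
    refine List.sublist_of_subperm_of_pairwise ?_ hp hl
    refine List.subperm_of_subset (hp.imp fun {a b} h => ?_) ?_
    · rintro rfl
      exact absurd h (lt_irrefl _)
    · intro x hx
      simp only [List.mem_cons, List.not_mem_nil, or_false] at hx
      rcases hx with rfl | rfl | rfl <;> assumption

theorem exists_list_of_key {α : Type*} (C : Finset α) {f : α → ℤ} (hf : Set.InjOn f C) :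
    ∃ l : List α, (l.Pairwise fun a b => f a < f b) ∧ ∀ c, c ∈ l ↔ c ∈ C := by
  classical
  let l := C.toList.mergeSort fun a b => decide (f a ≤ f b)
  have hperm : l.Perm C.toList := List.mergeSort_perm _ _
  have hmem : ∀ c, c ∈ l ↔ c ∈ C := fun c => by rw [hperm.mem_iff, Finset.mem_toList]
  have hnd : l.Nodup := hperm.nodup_iff.2 C.nodup_toList
  have hle : l.Pairwise fun a b => decide (f a ≤ f b) = true :=
    List.pairwise_mergeSort (fun a b c h h' => by
      simp only [decide_eq_true_eq] at *
      omega) (fun a b => by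
      simp only [Bool.or_eq_true, decide_eq_true_eq]
      omega) _
  refine ⟨l, ?_, hmem⟩
  refine List.Pairwise.imp_of_mem ?_ (hle.and hnd)
  rintro a b ha hb ⟨h, hne⟩
  exact lt_of_le_of_ne (by simpa using h) fun h =>
    hne (hf ((hmem a).1 ha) ((hmem b).1 hb) h)

theorem pairwise_idxOf {α : Type*} [DecidableEq α] {l : List α} (h : l.Nodup) :
    l.Pairwise fun a b => (l.idxOf a : ℤ) < l.idxOf b := by
  rw [List.pairwise_iff_getElem]
  intro i j hi hj hij
  rw [h.idxOf_getElem, h.idxOf_getElem]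
  exact_mod_cast hij

/-- The rows as sets of columns, with a further column `none` that lies in no row. -/
def rowO {m n : ℕ} (M : Matrix (Fin m) (Fin n) Bool) (i : Fin m) : Set (Option (Fin n)) :=
  some '' rowSet M i

theorem none_notMem_rowO {m n : ℕ} {M : Matrix (Fin m) (Fin n) Bool} (i : Fin m) :
    none ∉ rowO M i := by
  simp [rowO]

theorem some_mem_rowO {m n : ℕ} {M : Matrix (Fin m) (Fin n) Bool} {i : Fin m} {c : Fin n} :
    some c ∈ rowO M i ↔ c ∈ rowSet M i := by
  simp [rowO]

/-- A key of the columns extends to the additional column, placed last. -/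
theorem exists_option_key {n : ℕ} (f : Fin n → ℤ) :
    ∃ f' : Option (Fin n) → ℤ, (∀ c, f' (some c) = f c) ∧ (∀ c, f c < f' none) ∧
      ∀ R, Cvx f R → Cvx f' (some '' R) := by
  obtain ⟨B, hB⟩ := (Set.finite_range f).bddAbove
  have hB' : ∀ c, f c < B + 1 := fun c => by
    have := hB ⟨c, rfl⟩
    omega
  refine ⟨fun c => c.elim (B + 1) f, fun c => rfl, hB', fun R hR => ?_⟩
  rintro _ ⟨a, ha, rfl⟩ _ ⟨c, hc, rfl⟩ b hab hbc
  rcases b with _ | b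
  · exact absurd hbc (not_le.2 (hB' c))
  · exact ⟨b, hR a ha c hc b hab hbc, rfl⟩

theorem isConsecutiveOrdering_iff {m n : ℕ} {M : Matrix (Fin m) (Fin n) Bool} {S : Set (Fin m)}
    {f : Fin n → ℤ} {l : List (Fin n)} (hl : l.Pairwise fun a b => f a < f b)
    (hmem : ∀ c, c ∈ l) :
    IsConsecutiveOrdering M S l ↔ ∀ i ∈ S, Cvx f (rowSet M i) := by
  have hinj : ∀ a b, f a = f b → a = b := by
    intro a b h
    by_contra hne
    rcases List.mem_iff_getElem.1 (hmem a) with ⟨i, hi, rfl⟩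
    rcases List.mem_iff_getElem.1 (hmem b) with ⟨j, hj, rfl⟩
    rw [List.pairwise_iff_getElem] at hl
    rcases lt_trichotomy i j with hij | rfl | hij
    · exact absurd (hl i j hi hj hij) (by omega)
    · exact hne rfl
    · exact absurd (hl j i hj hi hij) (by omega)
  constructor
  · rintro ⟨-, -, h⟩ i hi a ha c hc b hab hbc
    rcases hab.eq_or_lt with h1 | h1
    · exact hinj a b h1 ▸ ha
    rcases hbc.eq_or_lt with h2 | h2
    · exact hinj b c h2 ▸ hc
    exact h i hi a b c ((triple_sublist_iff hl).2 ⟨⟨hmem _, hmem _, hmem _⟩, h1, h2⟩) ha hc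
  · intro h
    refine ⟨hl.imp fun {a b} h => ?_, hmem, fun i hi a b c habc ha hc => ?_⟩
    · rintro rfl
      exact absurd h (lt_irrefl _)
    · obtain ⟨-, h1, h2⟩ := (triple_sublist_iff hl).1 habc
      exact h i hi a ha c hc b h1.le h2.le

theorem IsConsecutiveOrdering.exists_key {m n : ℕ} {M : Matrix (Fin m) (Fin n) Bool}
    {S : Set (Fin m)} {l : List (Fin n)} (h : IsConsecutiveOrdering M S l) :
    ∃ f : Fin n → ℤ, Function.Injective f ∧ (l.Pairwise fun a b => f a < f b) ∧
      ∀ i ∈ S, Cvx f (rowSet M i) := by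
  have hp := pairwise_idxOf h.1
  refine ⟨_, fun a b hab => ?_, hp, (isConsecutiveOrdering_iff hp h.2.1).1 h⟩
  exact (List.idxOf_inj (h.2.1 a)).1 (by exact_mod_cast hab)

theorem hasConsecutiveOnes_of_key {m n : ℕ} {M : Matrix (Fin m) (Fin n) Bool}
    {S : Set (Fin m)} {f : Fin n → ℤ} (hf : Function.Injective f)
    (h : ∀ i ∈ S, Cvx f (rowSet M i)) : HasConsecutiveOnes M S := by
  obtain ⟨l, hl, hmem⟩ := exists_list_of_key (f := f) Finset.univ hf.injOn
  exact ⟨l, (isConsecutiveOrdering_iff hl fun c => (hmem c).2 (Finset.mem_univ c)).2 h⟩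

theorem exists_injective_key {n : ℕ} (f : Fin n → ℤ) :
    ∃ f' : Fin n → ℤ, Function.Injective f' ∧ ∀ R, Cvx f R → Cvx f' R := by
  obtain ⟨f', hf'⟩ := exists_int_key fun c => toLex (f c, c)
  refine ⟨f', fun a b hab => ?_, fun R hR a ha c hc b hab hbc => ?_⟩
  · have h1 := (hf' a b).1 hab.le
    have h2 := (hf' b a).1 hab.ge
    exact (Prod.ext_iff.1 (toLex.injective (le_antisymm h1 h2))).2
  · have h1 := Prod.Lex.toLex_le_toLex.1 ((hf' a b).1 hab)
    have h2 := Prod.Lex.toLex_le_toLex.1 ((hf' b c).1 hbc)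
    exact hR a ha c hc b (by omega) (by omega)

theorem hasConsecutiveOnes_iff {m n : ℕ} {M : Matrix (Fin m) (Fin n) Bool} {S : Set (Fin m)} :
    HasConsecutiveOnes M S ↔ C1 (rowO M) S := by
  constructor
  · rintro ⟨l, hl⟩
    obtain ⟨f, -, -, hf⟩ := hl.exists_key
    obtain ⟨f', -, -, hf'⟩ := exists_option_key f
    exact ⟨f', fun i hi => hf' _ (hf i hi)⟩
  · rintro ⟨f, hf⟩
    obtain ⟨f', hinj, hf'⟩ := exists_injective_key fun c => f (some c)
    refine hasConsecutiveOnes_of_key hinj fun i hi => hf' _ fun a ha c hc b hab hbc => ?_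
    exact some_mem_rowO.1 (hf i hi _ (some_mem_rowO.2 ha) _ (some_mem_rowO.2 hc) (some b) hab hbc)

/-! ### Small Tucker submatrices -/

/-- However the rows of the pattern `τ`, extended by a column of zeros, are complemented (`o` tells
which rows are), the result contains a Tucker matrix with at most four rows. The index `none` stands
for the additional column. -/
def YieldsTucker {p q : ℕ} (τ : Matrix (Fin p) (Fin q) Bool) : Prop :=
  ∀ o : Fin p → Bool, ∃ (r c : ℕ) (T : Matrix (Fin r) (Fin c) Bool), IsTucker T ∧ r ≤ 4 ∧
    (∀ i i', (∀ j, (T i j == T i' j) = true) → i = i') ∧ (∀ j j', (∀ i, T i j = T i j') → j = j') ∧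
      (∀ j, ∃ i, T i j = true) ∧
      ∃ (f : Fin r → Fin p) (g : Fin c → Option (Fin q)),
        ∀ j i, T i j = xor ((g j).elim false (τ (f i))) (o (f i))

theorem yieldsTucker_tuckerI : YieldsTucker (p := 3) (q := 3) (tuckerI 0) := by
  intro o
  obtain ⟨a, b, c, rfl⟩ : ∃ a b c, o = ![a, b, c] :=
    ⟨o 0, o 1, o 2, by ext i; fin_cases i <;> rfl⟩
  cases a <;> cases b <;> cases c
  · exact ⟨3, 3, tuckerI 0, .I 0, by decide, by decide, by decide, by decide,
      ![0, 1, 2], ![some 0, some 1, some 2], by decide⟩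
  · exact ⟨3, 4, tuckerIII 0, .III 0, by decide, by decide, by decide, by decide,
      ![0, 1, 2], ![some 0, some 1, some 2, none], by decide⟩
  · exact ⟨3, 4, tuckerIII 0, .III 0, by decide, by decide, by decide, by decide,
      ![0, 1, 2], ![some 1, some 0, none, some 2], by decide⟩
  · exact ⟨3, 3, tuckerI 0, .I 0, by decide, by decide, by decide, by decide,
      ![0, 1, 2], ![some 1, some 0, none], by decide⟩
  · exact ⟨3, 4, tuckerIII 0, .III 0, by decide, by decide, by decide, by decide,
      ![0, 1, 2], ![none, some 2, some 1, some 0], by decide⟩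
  · exact ⟨3, 3, tuckerI 0, .I 0, by decide, by decide, by decide, by decide,
      ![0, 1, 2], ![none, some 2, some 1], by decide⟩
  · exact ⟨3, 3, tuckerI 0, .I 0, by decide, by decide, by decide, by decide,
      ![0, 1, 2], ![some 2, none, some 0], by decide⟩
  · exact ⟨3, 4, tuckerIII 0, .III 0, by decide, by decide, by decide, by decide,
      ![0, 1, 2], ![some 2, none, some 0, some 1], by decide⟩

theorem yieldsTucker_fullPattern : YieldsTucker fullPattern := by
  intro o
  obtain ⟨a, b, c, d, rfl⟩ : ∃ a b c d, o = ![a, b, c, d] :=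
    ⟨o 0, o 1, o 2, o 3, by ext i; fin_cases i <;> rfl⟩
  cases a <;> cases b <;> cases c <;> cases d
  · exact ⟨4, 4, tuckerI 1, .I 1, by decide, by decide, by decide, by decide,
      ![0, 1, 2, 3], ![some 3, some 2, some 4, some 0], by decide⟩
  · exact ⟨3, 3, tuckerI 0, .I 0, by decide, by decide, by decide, by decide,
      ![0, 2, 3], ![some 2, some 1, some 4], by decide⟩
  · exact ⟨3, 3, tuckerI 0, .I 0, by decide, by decide, by decide, by decide,
      ![1, 2, 3], ![some 1, some 2, some 3], by decide⟩
  · exact ⟨4, 4, tuckerI 1, .I 1, by decide, by decide, by decide, by decide,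
      ![0, 1, 3, 2], ![some 3, some 1, some 4, none], by decide⟩
  · exact ⟨3, 3, tuckerI 0, .I 0, by decide, by decide, by decide, by decide,
      ![0, 1, 2], ![some 1, some 3, some 0], by decide⟩
  · exact ⟨3, 3, tuckerI 0, .I 0, by decide, by decide, by decide, by decide,
      ![0, 1, 2], ![some 1, some 3, some 0], by decide⟩
  · exact ⟨4, 4, tuckerI 1, .I 1, by decide, by decide, by decide, by decide,
      ![0, 2, 1, 3], ![some 1, some 2, none, some 0], by decide⟩
  · exact ⟨3, 3, tuckerI 0, .I 0, by decide, by decide, by decide, by decide,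
      ![0, 1, 3], ![some 2, some 3, none], by decide⟩
  · exact ⟨3, 3, tuckerI 0, .I 0, by decide, by decide, by decide, by decide,
      ![0, 1, 3], ![some 0, some 4, some 1], by decide⟩
  · exact ⟨4, 4, tuckerI 1, .I 1, by decide, by decide, by decide, by decide,
      ![0, 2, 1, 3], ![none, some 0, some 1, some 2], by decide⟩
  · exact ⟨3, 3, tuckerI 0, .I 0, by decide, by decide, by decide, by decide,
      ![0, 1, 2], ![none, some 4, some 2], by decide⟩
  · exact ⟨3, 3, tuckerI 0, .I 0, by decide, by decide, by decide, by decide,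
      ![0, 1, 2], ![none, some 4, some 2], by decide⟩
  · exact ⟨4, 4, tuckerI 1, .I 1, by decide, by decide, by decide, by decide,
      ![0, 1, 3, 2], ![some 4, none, some 3, some 1], by decide⟩
  · exact ⟨3, 3, tuckerI 0, .I 0, by decide, by decide, by decide, by decide,
      ![1, 2, 3], ![none, some 0, some 4], by decide⟩
  · exact ⟨3, 3, tuckerI 0, .I 0, by decide, by decide, by decide, by decide,
      ![0, 2, 3], ![some 0, none, some 3], by decide⟩
  · exact ⟨4, 4, tuckerI 1, .I 1, by decide, by decide, by decide, by decide,
      ![0, 1, 2, 3], ![some 4, some 0, some 3, some 2], by decide⟩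

theorem yieldsTucker_starPattern : YieldsTucker starPattern := by
  intro o
  obtain ⟨a, b, c, d, rfl⟩ : ∃ a b c d, o = ![a, b, c, d] :=
    ⟨o 0, o 1, o 2, o 3, by ext i; fin_cases i <;> rfl⟩
  cases a <;> cases b <;> cases c <;> cases d
  · exact ⟨4, 5, tuckerV, .V, by decide, by decide, by decide, by decide,
      ![1, 2, 3, 0], ![some 4, some 3, some 1, some 0, some 2], by decide⟩
  · exact ⟨4, 6, tuckerIV, .IV, by decide, by decide, by decide, by decide,
      ![1, 2, 3, 0], ![some 4, some 3, some 0, some 1, none, some 2], by decide⟩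
  · exact ⟨3, 3, tuckerI 0, .I 0, by decide, by decide, by decide, by decide,
      ![0, 2, 3], ![some 1, some 2, some 4], by decide⟩
  · exact ⟨4, 5, tuckerV, .V, by decide, by decide, by decide, by decide,
      ![1, 3, 2, 0], ![some 4, some 3, some 2, none, some 1], by decide⟩
  · exact ⟨3, 3, tuckerI 0, .I 0, by decide, by decide, by decide, by decide,
      ![0, 1, 3], ![some 3, some 2, some 0], by decide⟩
  · exact ⟨4, 5, tuckerV, .V, by decide, by decide, by decide, by decide,
      ![2, 3, 1, 0], ![some 0, some 1, some 2, none, some 3], by decide⟩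
  · exact ⟨3, 3, tuckerI 0, .I 0, by decide, by decide, by decide, by decide,
      ![0, 1, 2], ![some 3, some 1, none], by decide⟩
  · exact ⟨3, 3, tuckerI 0, .I 0, by decide, by decide, by decide, by decide,
      ![0, 1, 2], ![some 3, some 1, none], by decide⟩
  · exact ⟨4, 5, tuckerV, .V, by decide, by decide, by decide, by decide,
      ![1, 2, 3, 0], ![some 3, some 4, some 0, some 1, none], by decide⟩
  · exact ⟨4, 6, tuckerIV, .IV, by decide, by decide, by decide, by decide,
      ![1, 2, 3, 0], ![some 3, some 4, some 1, some 0, some 2, none], by decide⟩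
  · exact ⟨3, 3, tuckerI 0, .I 0, by decide, by decide, by decide, by decide,
      ![0, 2, 3], ![some 0, none, some 3], by decide⟩
  · exact ⟨4, 5, tuckerV, .V, by decide, by decide, by decide, by decide,
      ![1, 3, 2, 0], ![some 3, some 4, none, some 2, some 0], by decide⟩
  · exact ⟨3, 3, tuckerI 0, .I 0, by decide, by decide, by decide, by decide,
      ![0, 1, 3], ![some 4, none, some 1], by decide⟩
  · exact ⟨4, 5, tuckerV, .V, by decide, by decide, by decide, by decide,
      ![2, 3, 1, 0], ![some 1, some 0, none, some 2, some 4], by decide⟩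
  · exact ⟨3, 3, tuckerI 0, .I 0, by decide, by decide, by decide, by decide,
      ![0, 1, 2], ![some 4, some 0, some 2], by decide⟩
  · exact ⟨3, 3, tuckerI 0, .I 0, by decide, by decide, by decide, by decide,
      ![0, 1, 2], ![some 4, some 0, some 2], by decide⟩

/-- Columns `g` of the rows `f` that form a Tucker matrix none of whose columns is zero avoid the
additional column. -/
theorem isTuckerRowSet_of_rowO {m n : ℕ} {M : Matrix (Fin m) (Fin n) Bool} {r c : ℕ}
    {T : Matrix (Fin r) (Fin c) Bool} (hT : IsTucker T) {f : Fin r → Fin m}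
    {g : Fin c → Option (Fin n)} (hf : Function.Injective f) (hg : Function.Injective g)
    (hz : ∀ j, ∃ i, T i j = true) (h : ∀ i j, g j ∈ rowO M (f i) ↔ T i j = true) :
    IsTuckerRowSet M (Set.range f) := by
  have hsome : ∀ j, ∃ k, g j = some k := by
    intro j
    obtain ⟨i, hi⟩ := hz j
    obtain ⟨k, -, hk⟩ := (h i j).2 hi
    exact ⟨k, hk.symm⟩
  choose g' hg' using hsome
  refine ⟨r, c, T, ⟨f, hf⟩, ⟨g', fun a b hab => hg (by rw [hg', hg', hab])⟩, hT,
    fun i j => ?_, rfl⟩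
  have := h i j
  rw [hg', some_mem_rowO] at this
  exact Bool.eq_iff_iff.2 this

theorem YieldsTucker.exists_isTuckerRowSet {m n : ℕ} {M : Matrix (Fin m) (Fin n) Bool} {p q : ℕ}
    {τ : Matrix (Fin p) (Fin q) Bool} (hτ : YieldsTucker τ) {r : Fin p → Fin m}
    (h : HasPattern (rowO M) r τ) : ∃ X, IsTuckerRowSet M X ∧ X.ncard ≤ 4 := by
  classical
  obtain ⟨v, g, hg⟩ := h
  obtain ⟨a, b, T, hT, ha, hrow, hcol, hz, f, k, hTo⟩ :=
    hτ fun i => decide (none ∈ flip (rowO M) v (r i))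
  have key : ∀ i j, (k j).elim v g ∈ rowO M (r (f i)) ↔ T i j = true := by
    intro i j
    rw [← flip_of_notMem (none_notMem_rowO (M := M) (r (f i))), mem_flip_flip _ v, hTo]
    rcases hk : k j with _ | l
    · simp [base_notMem_flip]
    · simp only [Option.elim_some, hg]
      cases τ (f i) l <;> simp
  refine ⟨_, isTuckerRowSet_of_rowO hT (f := fun i => r (f i)) (g := fun j => (k j).elim v g)
    (fun x y hxy => hrow x y fun j => ?_) (fun x y hxy => hcol x y fun i => ?_) hz key, ?_⟩
  · have hxy : r (f x) = r (f y) := hxy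
    exact beq_iff_eq.2 (Bool.eq_iff_iff.2 (by rw [← key, ← key, hxy]))
  · have hxy : (k x).elim v g = (k y).elim v g := hxy
    exact Bool.eq_iff_iff.2 (by rw [← key, ← key, hxy])
  · rw [← Set.image_univ]
    refine (Set.ncard_image_le Set.finite_univ).trans ?_
    rw [Set.ncard_univ, Nat.card_eq_fintype_card, Fintype.card_fin]
    exact ha

/-! ### Cycles of rows -/

theorem IsRowCycle.rotate {ι β : Type*} {σ : ι → Set β} {t : ℕ} {r : Fin (t + 4) → ι}
    {g : Fin (t + 4) → β} (h : IsRowCycle σ r g) (s : Fin (t + 4)) :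
    IsRowCycle σ (fun i => r (i + s)) fun i => g (i + s) := by
  have key : ∀ i j : Fin (t + 4), j + s = i + s + 1 ↔ j = i + 1 := fun i j => by
    rw [add_right_comm, add_left_inj]
  refine ⟨fun i j => ?_, fun i j h1 h2 h3 => ?_⟩
  · rw [h.1, key, add_left_inj]
  · refine h.2 _ _ ?_ ?_ ?_
    · rwa [Ne, add_left_inj]
    · rwa [Ne, key]
    · rwa [Ne, key]

theorem IsRowCycle.column_injective {ι β : Type*} {σ : ι → Set β} {t : ℕ} {r : Fin (t + 4) → ι}
    {g : Fin (t + 4) → β} (h : IsRowCycle σ r g) : Function.Injective g := by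
  intro i j hij
  have h1 : j = i ∨ j = i + 1 := by
    rw [← h.1 i j, ← hij, h.1]
    exact .inl rfl
  have h2 : i = j ∨ i = j + 1 := by
    rw [← h.1 j i, hij, h.1]
    exact .inl rfl
  have hi := i.isLt
  have hj := j.isLt
  rw [eq_succ_iff, Fin.ext_iff] at h1 h2
  apply Fin.ext
  omega

theorem IsRowCycle.row_injective {ι β : Type*} {σ : ι → Set β} {t : ℕ} {r : Fin (t + 4) → ι}
    {g : Fin (t + 4) → β} (h : IsRowCycle σ r g) : Function.Injective r := by
  intro i j hij
  have h1 : i = j ∨ i = j + 1 := by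
    rw [← h.1 j i, ← hij, h.1]
    exact .inl rfl
  have h2 : j = i ∨ j = i + 1 := by
    rw [← h.1 i j, hij, h.1]
    exact .inl rfl
  have hi := i.isLt
  have hj := j.isLt
  rw [eq_succ_iff, Fin.ext_iff] at h1 h2
  apply Fin.ext
  omega

theorem chain_increasing {β : Type*} {f : β → ℤ} {u : ℕ → β} {T : ℕ → Set β} {n : ℕ}
    (hf : ∀ k < n, Cvx f (T k)) (h0 : ∀ k < n, u k ∈ T k) (h1 : ∀ k < n, u (k + 1) ∈ T k)
    (hn : ∀ k < n, ∀ j ≤ n, j ≠ k → j ≠ k + 1 → u j ∉ T k) (h01 : f (u 0) < f (u 1)) :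
    ∀ k < n, f (u k) < f (u (k + 1)) := by
  intro k
  induction k with
  | zero => exact fun _ => h01
  | succ k ih =>
    intro hk
    have hlt := ih (by omega)
    by_contra hge
    rcases le_total (f (u k)) (f (u (k + 1 + 1))) with h | h
    · exact hn k (by omega) _ (by omega) (by omega) (by omega)
        (hf k (by omega) _ (h0 k (by omega)) _ (h1 k (by omega)) _ h (by omega))
    · exact hn (k + 1) hk k (by omega) (by omega) (by omega)
        (hf _ hk _ (h1 _ hk) _ (h0 _ hk) _ h hlt.le)

/-- Common columns of consecutive sets of a chordless chain appear in the order of the chain, or in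
the reverse order, in each order for which the sets are convex. -/
theorem chain_monotone {β : Type*} {f : β → ℤ} {u : ℕ → β} {T : ℕ → Set β} {n : ℕ} (h2 : 2 ≤ n)
    (hf : ∀ k < n, Cvx f (T k)) (h0 : ∀ k < n, u k ∈ T k) (h1 : ∀ k < n, u (k + 1) ∈ T k)
    (hn : ∀ k < n, ∀ j ≤ n, j ≠ k → j ≠ k + 1 → u j ∉ T k) :
    (∀ i j, i < j → j ≤ n → f (u i) < f (u j)) ∨ ∀ i j, i < j → j ≤ n → f (u j) < f (u i) := by
  have mono : ∀ f' : β → ℤ, (∀ k < n, f' (u k) < f' (u (k + 1))) →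
      ∀ i j, i < j → j ≤ n → f' (u i) < f' (u j) := by
    intro f' h i j hij
    induction j, hij using Nat.le_induction with
    | base => exact fun hj => h i hj
    | succ j hj ih => exact fun hj' => (ih (by omega)).trans (h j (by omega))
  rcases lt_trichotomy (f (u 0)) (f (u 1)) with h | h | h
  · exact .inl (mono f (chain_increasing hf h0 h1 hn h))
  · exact absurd (hf 1 (by omega) _ (h0 1 (by omega)) _ (h0 1 (by omega)) (u 0) h.ge h.le)
      (hn 1 (by omega) 0 (by omega) (by omega) (by omega))
  · right
    intro i j hij hj
    have := mono (fun c => -f c) (chain_increasing (f := fun c => -f c)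
      (fun k hk => (hf k hk).neg) h0 h1 hn (by omega)) i j hij hj
    omega

theorem IsRowCycle.monotone {ι β : Type*} {σ : ι → Set β} {t : ℕ} {r : Fin (t + 4) → ι}
    {g : Fin (t + 4) → β} (h : IsRowCycle σ r g) {f : β → ℤ}
    (hf : ∀ i : Fin (t + 4), (i : ℕ) ≠ t + 3 → Cvx f (σ (r i))) :
    (∀ i j, i < j → f (g i) < f (g j)) ∨ ∀ i j, i < j → f (g j) < f (g i) := by
  have key := chain_monotone (f := f) (u := fun k => g (Fin.ofNat (t + 4) k))
    (T := fun k => σ (r (Fin.ofNat (t + 4) k))) (n := t + 3) (by omega)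
    (fun k hk => hf _ (by simpa [Nat.mod_eq_of_lt (show k < t + 4 by omega)] using hk.ne))
    (fun k hk => (h.1 _ _).2 (.inl rfl)) (fun k hk => (h.1 _ _).2 (.inr ?_))
    (fun k hk j hj h1 h2 hmem => ?_)
  · have hof : ∀ i : Fin (t + 4), Fin.ofNat (t + 4) i = i := fun i => by
      apply Fin.ext
      simp
    refine key.imp (fun h i j hij => ?_) fun h i j hij => ?_
    · simpa only [hof] using h i j hij (by omega)
    · simpa only [hof] using h i j hij (by omega)
  · rw [eq_succ_iff]
    left
    simp [Nat.mod_eq_of_lt (show k < t + 4 by omega), Nat.mod_eq_of_lt (show k + 1 < t + 4 by omega)]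
  · have := (h.1 _ _).1 hmem
    rw [eq_succ_iff, Fin.ext_iff] at this
    simp [Nat.mod_eq_of_lt (show k < t + 4 by omega), Nat.mod_eq_of_lt (show j < t + 4 by omega)]
      at this
    omega

theorem IsRowCycle.not_C1 {ι β : Type*} {σ : ι → Set β} {t : ℕ} {r : Fin (t + 4) → ι}
    {g : Fin (t + 4) → β} (h : IsRowCycle σ r g) : ¬ C1 σ (Set.range r) := by
  rintro ⟨f, hf⟩
  have hmono := h.monotone fun i _ => hf _ ⟨i, rfl⟩
  have hlast := hf _ ⟨Fin.last (t + 3), rfl⟩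
  have h1 : g (Fin.last (t + 3)) ∈ σ (r (Fin.last (t + 3))) := (h.1 _ _).2 (.inl rfl)
  have h0 : g 0 ∈ σ (r (Fin.last (t + 3))) := (h.1 _ _).2 (.inr (by simp))
  have h01 : (0 : Fin (t + 4)) < 1 := by simp
  have h1l : (1 : Fin (t + 4)) < Fin.last (t + 3) := by
    rw [Fin.lt_def]
    simp
  have hnot : g 1 ∉ σ (r (Fin.last (t + 3))) := by
    rw [h.1]
    rintro (h | h)
    · exact h1l.ne h
    · rw [Fin.last_add_one] at h
      exact h01.ne' h
  rcases hmono with hm | hm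
  · exact hnot (hlast _ h0 _ h1 _ (hm _ _ h01).le (hm _ _ h1l).le)
  · exact hnot (hlast _ h1 _ h0 _ (hm _ _ h1l).le (hm _ _ h01).le)

/-! ### Cycles of rows as Tucker submatrices -/

/-- The rows of a cycle that contain a given column are adjacent, so that by a rotation they become
none, the last, or the last two. -/
theorem IsRowCycle.exists_rotate {ι β : Type*} {σ : ι → Set β} {t : ℕ} {r : Fin (t + 4) → ι}
    {g : Fin (t + 4) → β} (h : IsRowCycle σ r g) (ω : β) :
    ∃ s, (∀ i, ω ∉ σ (r (i + s))) ∨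
      (∀ i : Fin (t + 4), ω ∈ σ (r (i + s)) ↔ (i : ℕ) = t + 3) ∨
      ∀ i : Fin (t + 4), ω ∈ σ (r (i + s)) ↔ (i : ℕ) = t + 2 ∨ (i : ℕ) = t + 3 := by
  have hadj : ∀ i j, ω ∈ σ (r i) → ω ∈ σ (r j) → i = j ∨ j = i + 1 ∨ i = j + 1 := by
    intro i j hi hj
    by_contra hne
    push Not at hne
    exact Set.disjoint_left.1 (h.2 i j hne.1 hne.2.1 hne.2.2) hi hj
  have last : ∀ i k : Fin (t + 4), k + (i + 1 + 1) = i + 1 ↔ (k : ℕ) = t + 3 := by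
    intro i k
    rw [show k + (i + 1 + 1) = (i + 1) + (k + 1) by abel, add_eq_left, eq_comm, eq_succ_iff]
    simp
  have prev : ∀ i k : Fin (t + 4), k + (i + 1 + 1) = i ↔ (k : ℕ) = t + 2 := by
    intro i k
    rw [show k + (i + 1 + 1) = i + (k + 1 + 1) by abel, add_eq_left, eq_comm, eq_succ_iff]
    have h1 := (eq_succ_iff k (k + 1)).1 rfl
    have hk := k.isLt
    generalize k + 1 = k' at *
    rw [Fin.val_zero]
    omega
  by_cases h0 : ∃ i, ω ∈ σ (r i)
  · by_cases h2 : ∃ i, ω ∈ σ (r i) ∧ ω ∈ σ (r (i + 1))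
    · obtain ⟨i, hi, hi'⟩ := h2
      refine ⟨i + 1 + 1, .inr (.inr fun k => ⟨fun hk => ?_, ?_⟩)⟩
      · have h1 := hadj _ _ hi hk
        have h2 := hadj _ _ hi' hk
        rw [← last i, ← prev i]
        generalize k + (i + 1 + 1) = l at *
        have h3 := (eq_succ_iff i (i + 1)).1 rfl
        have hi := i.isLt
        have hl := l.isLt
        have hi1 := (i + 1).isLt
        generalize i + 1 = i' at *
        rw [eq_succ_iff] at h1
        rw [eq_succ_iff, eq_succ_iff] at h2
        simp only [Fin.ext_iff] at h1 h2
        omega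
      · rintro (hk | hk)
        · rwa [(prev i k).2 hk]
        · rwa [(last i k).2 hk]
    · obtain ⟨i, hi⟩ := h0
      obtain ⟨i, rfl⟩ : ∃ i', i = i' + 1 := ⟨i - 1, by abel⟩
      refine ⟨i + 1 + 1, .inr (.inl fun k => ⟨fun hk => ?_, fun hk => ?_⟩)⟩
      · rcases hadj _ _ hi hk with h1 | h1 | h1
        · exact (last i k).1 h1.symm
        · exact absurd ⟨_, hi, h1 ▸ hk⟩ h2
        · exact absurd ⟨_, hk, h1 ▸ hi⟩ h2
      · rwa [(last i k).2 hk]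
  · exact ⟨0, .inl fun i hi => h0 ⟨_, hi⟩⟩

theorem mem_rowO_iff {m n : ℕ} {M : Matrix (Fin m) (Fin n) Bool} (v x : Option (Fin n))
    (i : Fin m) :
    x ∈ rowO M i ↔ ¬ (x ∈ flip (rowO M) v i ↔ none ∈ flip (rowO M) v i) := by
  rw [← mem_flip_flip, flip_of_notMem (none_notMem_rowO i)]

section

variable {m n : ℕ} {M : Matrix (Fin m) (Fin n) Bool} {v : Option (Fin n)} {t : ℕ}
  {r : Fin (t + 4) → Fin m} {g : Fin (t + 4) → Option (Fin n)}

theorem IsRowCycle.isTuckerRowSet_I (h : IsRowCycle (flip (rowO M) v) r g)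
    (h0 : ∀ i, none ∉ flip (rowO M) v (r i)) : IsTuckerRowSet M (Set.range r) := by
  have key : ∀ (i j : Fin (t + 4)), tuckerI (t + 1) i j = true ↔ j = i ∨ j = i + 1 := by
    intro i j
    have hi := i.isLt
    have hj := j.isLt
    rw [eq_succ_iff, Fin.ext_iff]
    unfold tuckerI
    split_ifs <;> simp only [decide_eq_true_eq] <;> omega
  refine isTuckerRowSet_of_rowO (.I (t + 1)) h.row_injective h.column_injective
    (fun j => ⟨j, (key _ _).2 (.inl rfl)⟩) fun i j => ?_
  refine Iff.trans ?_ (key i j).symm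
  rw [mem_rowO_iff v, ← h.1]
  exact ⟨fun hx => by_contra fun hn => hx ⟨fun h => absurd h hn, fun h => absurd h (h0 i)⟩,
    fun hx hc => h0 i (hc.1 hx)⟩

theorem IsRowCycle.isTuckerRowSet_III (h : IsRowCycle (flip (rowO M) v) r g)
    (h1 : ∀ i : Fin (t + 4), none ∈ flip (rowO M) v (r i) ↔ (i : ℕ) = t + 3) :
    IsTuckerRowSet M (Set.range r) := by
  let g' : Fin (t + 5) → Option (Fin n) := Fin.snoc g v
  have hg' : ∀ j : Fin (t + 4), g' j.castSucc = g j := fun j => Fin.snoc_castSucc ..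
  have hl : g' (Fin.last _) = v := Fin.snoc_last ..
  have hv : ∀ j, g j ≠ v := fun j hj =>
    base_notMem_flip (rowO M) v (r j) (hj ▸ (h.1 j j).2 (.inl rfl))
  have hinj : Function.Injective g' := by
    intro a b
    refine Fin.lastCases ?_ (fun a => ?_) a <;> refine Fin.lastCases ?_ (fun b => ?_) b
    · exact fun _ => rfl
    · rw [hg', hl]
      exact fun h => absurd h.symm (hv b)
    · rw [hg', hl]
      exact fun h => absurd h (hv a)
    · rw [hg', hg']
      exact fun hab => congrArg _ (h.column_injective hab)
  have key : ∀ (i : Fin (t + 4)) (j : Fin (t + 5)), g' j ∈ rowO M (r i) ↔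
      tuckerIII (t + 1) i j = true := by
    intro i j
    have hi := i.isLt
    rw [mem_rowO_iff v, h1]
    refine Fin.lastCases ?_ (fun j => ?_) j
    · rw [hl]
      have := base_notMem_flip (rowO M) v (r i)
      unfold tuckerIII
      split_ifs <;> simp only [decide_eq_true_eq, this, Fin.val_last, false_iff, not_not] <;> omega
    · have hj := j.isLt
      rw [hg', h.1, eq_succ_iff, Fin.ext_iff]
      unfold tuckerIII
      split_ifs <;> simp only [decide_eq_true_eq, Fin.val_castSucc] <;> omega
  refine isTuckerRowSet_of_rowO (.III (t + 1)) h.row_injective hinj (fun j => ?_) key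
  by_cases hj : j.val < t + 3
  · refine ⟨⟨j, by omega⟩, ?_⟩
    simp [tuckerIII, hj]
  by_cases hj : j.val = t + 3
  · refine ⟨⟨t + 2, by omega⟩, ?_⟩
    simp [tuckerIII, hj]
  · refine ⟨⟨t + 3, by omega⟩, ?_⟩
    have := j.isLt
    simp only [tuckerIII]
    rw [if_neg (by omega), decide_eq_true_eq]
    omega

theorem IsRowCycle.isTuckerRowSet_II (h : IsRowCycle (flip (rowO M) v) r g)
    (h2 : ∀ i : Fin (t + 4),
      none ∈ flip (rowO M) v (r i) ↔ (i : ℕ) = t + 2 ∨ (i : ℕ) = t + 3) :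
    IsTuckerRowSet M (Set.range r) := by
  let g' : Fin (t + 4) → Option (Fin n) := fun j => if (j : ℕ) = t + 3 then v else g j
  have hv : ∀ j, g j ≠ v := fun j hj =>
    base_notMem_flip (rowO M) v (r j) (hj ▸ (h.1 j j).2 (.inl rfl))
  have hinj : Function.Injective g' := by
    intro a b hab
    simp only [g'] at hab
    split_ifs at hab with ha hb hb
    · exact Fin.ext (by omega)
    · exact absurd hab.symm (hv b)
    · exact absurd hab (hv a)
    · exact h.column_injective hab
  refine isTuckerRowSet_of_rowO (.II t) h.row_injective hinj (fun j => ?_) fun i j => ?_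
  · have := j.isLt
    by_cases hj : j.val < t + 2
    · refine ⟨⟨j, by omega⟩, ?_⟩
      simp [tuckerII, hj]
    · refine ⟨⟨t + 3, by omega⟩, ?_⟩
      simp only [tuckerII]
      rw [if_neg (by omega), if_neg (by omega), decide_eq_true_eq]
      omega
  · have hi := i.isLt
    have hj := j.isLt
    rw [mem_rowO_iff v, h2]
    by_cases hjl : (j : ℕ) = t + 3
    · have := base_notMem_flip (rowO M) v (r i)
      unfold tuckerII
      simp only [g', hjl, if_true, this]
      split_ifs <;> simp only [decide_eq_true_eq, false_iff, not_not] <;> omega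
    · simp only [g', hjl, if_false]
      rw [h.1, eq_succ_iff, Fin.ext_iff]
      unfold tuckerII
      split_ifs <;> simp only [decide_eq_true_eq] <;> omega

/-- The complement of each row that contains the base column of the cycle is taken; depending on
whether there are none, one or two such rows, the matrix is `M_I`, `M_III` or `M_II`. -/
theorem IsRowCycle.isTuckerRowSet (h : IsRowCycle (flip (rowO M) v) r g) :
    IsTuckerRowSet M (Set.range r) := by
  obtain ⟨s, hs⟩ := h.exists_rotate none
  have hr : Set.range r = Set.range fun i => r (i + s) :=
    ((Equiv.addRight s).surjective.range_comp r).symm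
  rw [hr]
  rcases hs with hs | hs | hs
  · exact (h.rotate s).isTuckerRowSet_I hs
  · exact (h.rotate s).isTuckerRowSet_III hs
  · exact (h.rotate s).isTuckerRowSet_II hs

end

/-! ### Minimal families without the consecutive-ones property -/

/-- The row `Z` of `S` is straddled by two other rows `A` and `B` of `S`: some column `a` of `A` and
`Z` and some column `b` of `B` and `Z` are separated by a column `x` outside the three rows, in each
order of the columns for which the rows other than `Z` are consecutive. -/
def IsStraddled {m n : ℕ} (M : Matrix (Fin m) (Fin n) Bool) (S : Set (Fin m)) (Z : Fin m) : Prop :=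
  ∃ A ∈ S \ {Z}, ∃ B ∈ S \ {Z}, ∃ a x b : Fin n,
    (a ∈ rowSet M A ∧ a ∈ rowSet M Z ∧ a ∉ rowSet M B) ∧
    (b ∈ rowSet M B ∧ b ∈ rowSet M Z ∧ b ∉ rowSet M A) ∧
    (x ∉ rowSet M A ∧ x ∉ rowSet M B ∧ x ∉ rowSet M Z) ∧
    ∀ f : Fin n → ℤ, Function.Injective f → (∀ i ∈ S \ {Z}, Cvx f (rowSet M i)) →
      (f a < f x ∧ f x < f b) ∨ (f b < f x ∧ f x < f a)

/-- Without one of its rows a cycle is a path of overlapping rows. -/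
theorem IsRowCycle.linked {ι β : Type*} {σ : ι → Set β} {t : ℕ} {r : Fin (t + 4) → ι}
    {g : Fin (t + 4) → β} (h : IsRowCycle σ r g) :
    Linked (Ov σ) (Set.range r \ {r (Fin.last (t + 3))}) := by
  have hmem : ∀ k (hk : k < t + 3),
      r ⟨k, by omega⟩ ∈ Set.range r \ {r (Fin.last (t + 3))} := fun k hk =>
    ⟨⟨_, rfl⟩, fun hl => by
      have := congrArg Fin.val (h.row_injective hl)
      simp at this
      omega⟩
  have hov : ∀ k (hk : k + 1 < t + 3), Ov σ (r ⟨k, by omega⟩) (r ⟨k + 1, by omega⟩) := by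
    intro k hk
    refine ⟨⟨g ⟨k + 1, by omega⟩, ?_, ?_⟩,
      Set.not_subset.2 ⟨g ⟨k, by omega⟩, ?_, ?_⟩, Set.not_subset.2 ⟨g ⟨k + 2, by omega⟩, ?_, ?_⟩⟩ <;>
    · rw [h.1, eq_succ_iff, Fin.ext_iff]
      dsimp only
      omega
  rintro P ⟨i, ⟨⟨i, rfl⟩, hil⟩, hPi⟩ hP j ⟨⟨j, rfl⟩, hjl⟩
  have hlt : ∀ i : Fin (t + 4), r i ∉ ({r (Fin.last (t + 3))} : Set ι) → (i : ℕ) < t + 3 := by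
    intro i hi
    have := i.isLt
    by_contra hge
    exact hi (congrArg r (Fin.ext (by simp; omega)))
  have hi := hlt i hil
  have hj := hlt j hjl
  have up : ∀ k (hk : k < t + 3), (i : ℕ) ≤ k → P (r ⟨k, by omega⟩) := by
    intro k hk hik
    induction k, hik using Nat.le_induction with
    | base => exact hPi
    | succ k hik ih => exact hP _ (hmem k (by omega)) _ (hmem _ hk) (ih (by omega)) (hov k hk)
  have down : ∀ d (hd : d ≤ (i : ℕ)), P (r ⟨i - d, by omega⟩) := by
    intro d
    induction d with
    | zero => exact fun _ => hPi
    | succ d ih =>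
      intro hd
      have h1 := hov (i - (d + 1)) (by omega)
      have h2 : (⟨i - (d + 1) + 1, by omega⟩ : Fin (t + 4)) = ⟨i - d, by omega⟩ :=
        Fin.ext (by dsimp only; omega)
      rw [h2] at h1
      exact hP _ (hmem (i - d) (by omega)) _ (hmem _ (by omega)) (ih (by omega)) (Ov.symm _ _ h1)
  rcases le_total (i : ℕ) j with hij | hij
  · exact up j hj hij
  · have := down (i - j) (by omega)
    rwa [show (⟨i - (i - j), by omega⟩ : Fin (t + 4)) = j from Fin.ext (by dsimp only; omega)]
      at this

section

variable {m n : ℕ} {M : Matrix (Fin m) (Fin n) Bool} {v : Option (Fin n)} {t : ℕ}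
  {r : Fin (t + 4) → Fin m} {g : Fin (t + 4) → Option (Fin n)}

theorem ov_rowSet_of_flip {i j : Fin m} (h : Ov (flip (rowO M) v) i j) : Ov (rowSet M) i j := by
  have h' := ov_flip (w := none) h
  unfold Ov at h' ⊢
  rw [flip_of_notMem (none_notMem_rowO i), flip_of_notMem (none_notMem_rowO j)] at h'
  obtain ⟨⟨x, ⟨c, hc, rfl⟩, hx⟩, h1, h2⟩ := h'
  exact ⟨⟨c, hc, some_mem_rowO.1 hx⟩, fun h => h1 (Set.image_mono h),
    fun h => h2 (Set.image_mono h)⟩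

/-- In the cycle the neighbours of a row are on opposite sides of a column outside the three: of the
base column if some other row contains the additional column `none`, and of any column
that belongs to the rest of the cycle otherwise. -/
theorem IsRowCycle.isStraddled (h : IsRowCycle (flip (rowO M) v) r g) (ht : 1 ≤ t)
    (h0 : none ∉ flip (rowO M) v (r 0))
    (h2 : none ∉ flip (rowO M) v (r ⟨t + 2, by omega⟩))
    (h3 : none ∉ flip (rowO M) v (r (Fin.last (t + 3)))) :
    IsStraddled M (Set.range r) (r (Fin.last (t + 3))) := by
  have hrow : ∀ {i}, none ∉ flip (rowO M) v (r i) → ∀ c : Fin n,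
      c ∈ rowSet M (r i) ↔ some c ∈ flip (rowO M) v (r i) := by
    intro i hi c
    rw [← some_mem_rowO, mem_rowO_iff v]
    simp only [hi, iff_false, not_not]
  have hgmem : ∀ i j : Fin (t + 4), g j ∈ flip (rowO M) v (r i) ↔
      (j : ℕ) = i ∨ (j : ℕ) = i + 1 ∨ ((i : ℕ) = t + 3 ∧ (j : ℕ) = 0) := by
    intro i j
    rw [h.1, eq_succ_iff, Fin.ext_iff]
  have hreal : ∀ {i j : Fin (t + 4)}, none ∉ flip (rowO M) v (r i) →
      g j ∈ flip (rowO M) v (r i) → ∃ c, g j = some c := by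
    intro i j hi hj
    rcases hg : g j with _ | c
    · exact absurd (hg ▸ hj) hi
    · exact ⟨c, rfl⟩
  have hmem : ∀ k (hk : k < t + 3), r ⟨k, by omega⟩ ∈ Set.range r \ {r (Fin.last (t + 3))} :=
    fun k hk => ⟨⟨_, rfl⟩, fun hl => by
      have := congrArg Fin.val (h.row_injective hl)
      simp at this
      omega⟩
  have hl : (Fin.last (t + 3) : Fin (t + 4)) = ⟨t + 3, by omega⟩ := rfl
  have hz : (0 : Fin (t + 4)) = ⟨0, by omega⟩ := rfl
  rw [hl] at h3 hmem ⊢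
  rw [hz] at h0
  obtain ⟨a, ha⟩ := hreal (j := ⟨t + 3, by omega⟩) h3 (by rw [hgmem]; simp)
  obtain ⟨b, hb⟩ := hreal (j := ⟨0, by omega⟩) h0 (by rw [hgmem]; simp)
  have key : ∀ x : Fin n, (some x ∉ flip (rowO M) v (r ⟨0, by omega⟩)) →
      (some x ∉ flip (rowO M) v (r ⟨t + 2, by omega⟩)) →
      (some x ∉ flip (rowO M) v (r ⟨t + 3, by omega⟩)) →
      (∀ f : Fin n → ℤ, Function.Injective f →
        (∀ i ∈ Set.range r \ {r ⟨t + 3, by omega⟩}, Cvx f (rowSet M i)) →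
        (f a < f x ∧ f x < f b) ∨ (f b < f x ∧ f x < f a)) →
      IsStraddled M (Set.range r) (r ⟨t + 3, by omega⟩) := by
    intro x hx0 hx2 hx3 hx
    refine ⟨_, hmem (t + 2) (by omega), _, hmem 0 (by omega), a, x, b, ?_, ?_, ?_, hx⟩
    · rw [hrow h2, hrow h3, hrow h0, ← ha, hgmem, hgmem, hgmem]
      simp
    · rw [hrow h2, hrow h3, hrow h0, ← hb, hgmem, hgmem, hgmem]
      simp
    · rw [hrow h2, hrow h3, hrow h0]
      exact ⟨hx2, hx0, hx3⟩
  by_cases hflip : ∃ j, none ∈ flip (rowO M) v (r j)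
  · obtain ⟨j, hj⟩ := hflip
    have hj0 : (j : ℕ) ≠ 0 := fun h' => h0 (by rwa [← show j = ⟨0, by omega⟩ from Fin.ext h'])
    have hj2 : (j : ℕ) ≠ t + 2 := fun h' =>
      h2 (by rwa [← show j = ⟨t + 2, by omega⟩ from Fin.ext h'])
    have hj3 : (j : ℕ) ≠ t + 3 := fun h' =>
      h3 (by rwa [← show j = ⟨t + 3, by omega⟩ from Fin.ext h'])
    have hjlt := j.isLt
    obtain ⟨x, rfl⟩ : ∃ x, v = some x := by
      rcases v with _ | x
      · exact absurd hj (base_notMem_flip _ _ _)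
      · exact ⟨x, rfl⟩
    refine key x (base_notMem_flip _ _ _) (base_notMem_flip _ _ _) (base_notMem_flip _ _ _)
      fun f hinj hf => ?_
    obtain ⟨fo, hfo, htop, hcvx⟩ := exists_option_key f
    obtain ⟨N, f', hN, hf1, hf2, hf'⟩ := exists_rotation (rowO M) none (some x) fo
    have hnone : f' none = fo none := hf1 none (by rw [hfo]; exact htop x)
    have hcv : ∀ i : Fin (t + 4), (i : ℕ) ≠ t + 3 → Cvx f' (flip (rowO M) (some x) (r i)) := by
      intro i hi
      apply hf'
      rw [flip_of_notMem (none_notMem_rowO _)]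
      refine hcvx _ (hf _ ⟨⟨i, rfl⟩, fun h' => hi ?_⟩)
      exact congrArg Fin.val (h.row_injective h')
    have hgj : g j ∈ flip (rowO M) (some x) (r j) := (h.1 j j).2 (.inl rfl)
    have hg0 : g ⟨0, by omega⟩ ∉ flip (rowO M) (some x) (r j) := by
      rw [hgmem]
      dsimp only
      omega
    have hg3 : g ⟨t + 3, by omega⟩ ∉ flip (rowO M) (some x) (r j) := by
      rw [hgmem]
      dsimp only
      omega
    have ha3 : some a ∈ flip (rowO M) (some x) (r ⟨t + 3, by omega⟩) := by
      rw [← ha, hgmem]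
      simp
    have hb0 : some b ∈ flip (rowO M) (some x) (r ⟨0, by omega⟩) := by
      rw [← hb, hgmem]
      simp
    have hax : f a ≠ f x := fun h' => base_notMem_flip _ _ _ (hinj h' ▸ ha3)
    have hbx : f b ≠ f x := fun h' => base_notMem_flip _ _ _ (hinj h' ▸ hb0)
    have hab := htop a
    have hbb := htop b
    have hNa := hN none (some a)
    have hNb := hN none (some b)
    have h1a := hf1 (some a)
    have h1b := hf1 (some b)
    have h2a := hf2 (some a)
    have h2b := hf2 (some b)
    rw [hb] at hg0
    rw [ha] at hg3
    simp only [hfo] at *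
    -- the column `none` lies between the two ends of the chain, as it lies in its row `r j`
    have ord : (f' (some b) < f' none ∧ f' none < f' (some a)) ∨
        (f' (some a) < f' none ∧ f' none < f' (some b)) := by
      have hj0' : (⟨0, by omega⟩ : Fin (t + 4)) < j := by
        rw [Fin.lt_def]
        dsimp only
        omega
      have hj3' : j < (⟨t + 3, by omega⟩ : Fin (t + 4)) := by
        rw [Fin.lt_def]
        dsimp only
        omega
      rcases h.monotone hcv with hm | hm
      · have hm0 := hm _ _ hj0'
        have hm3 := hm _ _ hj3'
        rw [hb] at hm0
        rw [ha] at hm3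
        exact .inl ⟨(hcv j hj3).gt_of_gt hgj hg0 hm0.le hj, (hcv j hj3).lt_of_lt hgj hg3 hm3.le hj⟩
      · have hm0 := hm _ _ hj0'
        have hm3 := hm _ _ hj3'
        rw [hb] at hm0
        rw [ha] at hm3
        exact .inr ⟨(hcv j hj3).gt_of_gt hgj hg3 hm3.le hj, (hcv j hj3).lt_of_lt hgj hg0 hm0.le hj⟩
    by_cases ca : f x < f a <;> by_cases cb : f x < f b
    · have := h1a ca
      have := h1b cb
      omega
    · omega
    · omega
    · have := h2a (by omega)
      have := h2b (by omega)
      omega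
  · push Not at hflip
    obtain ⟨x, hx⟩ := hreal (hflip ⟨2, by omega⟩) ((hgmem ⟨2, by omega⟩ ⟨2, by omega⟩).2 (.inl rfl))
    refine key x ?_ ?_ ?_ fun f hinj hf => ?_
    · rw [← hx, hgmem]
      dsimp only
      omega
    · rw [← hx, hgmem]
      dsimp only
      omega
    · rw [← hx, hgmem]
      dsimp only
      omega
    obtain ⟨fo, hfo, -, hcvx⟩ := exists_option_key f
    have hcv : ∀ i : Fin (t + 4), (i : ℕ) ≠ t + 3 → Cvx fo (flip (rowO M) v (r i)) := by
      intro i hi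
      have heq : flip (rowO M) v (r i) = rowO M (r i) := by
        ext c
        rw [mem_rowO_iff v]
        simp only [hflip i, iff_false, not_not]
      rw [heq]
      refine hcvx _ (hf _ ⟨⟨i, rfl⟩, fun h' => hi ?_⟩)
      exact congrArg Fin.val (h.row_injective h')
    have hlt1 : (⟨0, by omega⟩ : Fin (t + 4)) < ⟨2, by omega⟩ := by
      rw [Fin.lt_def]
      dsimp only
      omega
    have hlt2 : (⟨2, by omega⟩ : Fin (t + 4)) < ⟨t + 3, by omega⟩ := by
      rw [Fin.lt_def]
      dsimp only
      omega
    rcases h.monotone hcv with hm | hm <;>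
    · have h1 := hm _ _ hlt1
      have h2 := hm _ _ hlt2
      rw [hb, hx, hfo, hfo] at h1
      rw [ha, hx, hfo, hfo] at h2
      omega

end

theorem exists_minimal_not_C1 {ι β : Type*} [Finite ι] {ρ : ι → Set β} {S : Set ι}
    (h : ¬ C1 ρ S) : ∃ S' ⊆ S, ¬ C1 ρ S' ∧ ∀ S'', S'' ⊂ S' → C1 ρ S'' := by
  obtain ⟨S', hS', hmin⟩ := exists_minimal_le_of_wellFoundedLT (fun S => ¬ C1 ρ S) S h
  refine ⟨S', hS', hmin.prop, fun S'' hS'' => ?_⟩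
  by_contra hn
  exact hS''.2 (hmin.le_of_le hn hS''.1)

/-- If all Tucker submatrices have at least five rows, a minimal family of rows without the
consecutive-ones property is a cycle up to complements. All but four of its rows
are straddled by their neighbours. -/
theorem structure_of_minimal {m n : ℕ} {M : Matrix (Fin m) (Fin n) Bool}
    (hT : ∀ X, IsTuckerRowSet M X → 5 ≤ X.ncard) {S : Set (Fin m)} (hS : ¬ C1 (rowO M) S)
    (hmin : ∀ S', S' ⊂ S → C1 (rowO M) S') :
    IsTuckerRowSet M S ∧ (∀ Z ∈ S, Linked (Ov (rowSet M)) (S \ {Z})) ∧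
      ∃ bad : Finset (Fin m), bad.card ≤ 4 ∧ ∀ Z ∈ S, Z ∉ bad → IsStraddled M S Z := by
  have hsmall : ∀ {p q : ℕ} {τ : Matrix (Fin p) (Fin q) Bool}, YieldsTucker τ → ∀ r : Fin p → Fin m,
      ¬ HasPattern (rowO M) r τ := by
    intro p q τ hτ r h
    obtain ⟨X, hX, hX'⟩ := hτ.exists_isTuckerRowSet h
    have := hT X hX
    omega
  have hflip : flip (rowO M) none = rowO M := funext fun i => flip_of_notMem (none_notMem_rowO i)
  rcases obstruction_of_minimal S.toFinite (fun i => none_notMem_rowO (M := M) i) hS hmin with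
    ⟨r, -, h⟩ | ⟨r, -, h | h⟩ | ⟨v, t, r, g, hrS, h⟩
  · exact absurd h (hsmall yieldsTucker_tuckerI r)
  · exact absurd h (hsmall yieldsTucker_fullPattern r)
  · exact absurd h (hsmall yieldsTucker_starPattern r)
  obtain rfl : Set.range r = S := by
    by_contra hne
    have h1 := hmin _ (lt_of_le_of_ne (Set.range_subset_iff.2 hrS) hne)
    rw [← hflip] at h1
    exact h.not_C1 h1.change_base
  have ht : 1 ≤ t := by
    have h5 := hT _ h.isTuckerRowSet
    rw [← Set.image_univ, Set.ncard_image_of_injective _ h.row_injective, Set.ncard_univ,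
      Nat.card_eq_fintype_card, Fintype.card_fin] at h5
    omega
  have hrange : ∀ s, Set.range (fun i => r (i + s)) = Set.range r := fun s =>
    (Equiv.addRight s).surjective.range_comp r
  have hlast : ∀ s : Fin (t + 4), Fin.last (t + 3) + (s + 1) = s := fun s => by
    rw [show Fin.last (t + 3) + (s + 1) = s + (Fin.last (t + 3) + 1) by abel, Fin.last_add_one,
      add_zero]
  refine ⟨h.isTuckerRowSet, ?_, ?_⟩
  · rintro _ ⟨s, rfl⟩ P hi hP
    have := (h.rotate (s + 1)).linked
    rw [hrange, hlast] at this
    exact this P hi fun i hi j hj hPi hij => hP i hi j hj hPi (ov_rowSet_of_flip hij)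
  · obtain ⟨s₀, hs₀⟩ := h.exists_rotate none
    have h' := h.rotate s₀
    rw [← hrange s₀]
    have hf : ∀ i : Fin (t + 4), none ∈ flip (rowO M) v (r (i + s₀)) →
        (i : ℕ) = t + 2 ∨ (i : ℕ) = t + 3 := by
      intro i hi
      rcases hs₀ with hs | hs | hs
      · exact absurd hi (hs i)
      · exact .inr ((hs i).1 hi)
      · exact (hs i).1 hi
    have hrange' : ∀ s, Set.range (fun i => r (i + s + s₀)) = Set.range fun i => r (i + s₀) :=
      fun s => (Equiv.addRight s).surjective.range_comp fun i => r (i + s₀)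
    refine ⟨{r (⟨t + 1, by omega⟩ + s₀), r (⟨t + 2, by omega⟩ + s₀), r (⟨t + 3, by omega⟩ + s₀),
      r (⟨0, by omega⟩ + s₀)}, Finset.card_le_four, ?_⟩
    rintro _ ⟨s, rfl⟩ hbad
    have hne : ∀ k (hk : k < t + 4), r (⟨k, hk⟩ + s₀) ≠ r (s + s₀) → (s : ℕ) ≠ k := by
      rintro k hk h1 rfl
      exact h1 rfl
    simp only [Finset.mem_insert, Finset.mem_singleton, not_or] at hbad
    have hs1 := hne _ _ (Ne.symm hbad.1)
    have hs2 := hne _ _ (Ne.symm hbad.2.1)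
    have hs3 := hne _ _ (Ne.symm hbad.2.2.1)
    have hs4 := hne _ _ (Ne.symm hbad.2.2.2)
    have hslt := s.isLt
    have key := (h'.rotate (s + 1)).isStraddled ht ?_ ?_ ?_
    · rwa [hrange', hlast] at key
    · intro hn
      have h1 := hf _ hn
      have h2 := (eq_succ_iff s (0 + (s + 1))).1 (by abel)
      generalize 0 + (s + 1) = i at h1 h2
      omega
    · intro hn
      have h1 := hf _ hn
      have h2 := (eq_succ_iff (⟨t + 2, by omega⟩ + (s + 1)) s).1 (by
        have h3 : (⟨t + 2, by omega⟩ : Fin (t + 4)) + 1 = Fin.last (t + 3) := by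
          rw [eq_comm, eq_succ_iff]
          simp
        rw [show (⟨t + 2, by omega⟩ : Fin (t + 4)) + (s + 1) + 1 =
          (⟨t + 2, by omega⟩ + 1) + (s + 1) by abel, h3, hlast])
      generalize ⟨t + 2, _⟩ + (s + 1) = i at h1 h2
      omega
    · intro hn
      have h1 := hf _ hn
      rw [hlast] at h1
      omega

/-! ### Orders of a set of columns that is divided into blocks -/

/-- `l` lists the columns in `C`, each once, so that the rows in `F` are consecutive. -/
def IsOrder {ι α : Type*} (ρ : ι → Set α) (C : Finset α) (F : Set ι) (l : List α) : Prop :=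
  l.Nodup ∧ (∀ c, c ∈ l ↔ c ∈ C) ∧
    ∀ i ∈ F, ∀ a b c, [a, b, c].Sublist l → a ∈ ρ i → c ∈ ρ i → b ∈ ρ i

theorem isOrder_of_key {ι α : Type*} {ρ : ι → Set α} {C : Finset α} {F : Set ι} {l : List α}
    {f : α → ℤ} (hl : l.Pairwise fun a b => f a < f b) (hmem : ∀ c, c ∈ l ↔ c ∈ C)
    (h : ∀ i ∈ F, ∀ a ∈ ρ i, ∀ c ∈ ρ i, ∀ b, a ∈ C → b ∈ C → c ∈ C → f a < f b → f b < f c →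
      b ∈ ρ i) : IsOrder ρ C F l := by
  refine ⟨hl.imp fun {a b} h => ?_, hmem, fun i hi a b c habc ha hc => ?_⟩
  · rintro rfl
    exact absurd h (lt_irrefl _)
  · obtain ⟨⟨h1, h2, h3⟩, h4, h5⟩ := (triple_sublist_iff hl).1 habc
    exact h i hi a ha c hc b ((hmem _).1 h1) ((hmem _).1 h2) ((hmem _).1 h3) h4 h5

/-- The rows in `F` are convex for the position in the list, as the columns outside the list count
as positioned after its end. -/
theorem IsOrder.exists_key {ι α : Type*} {ρ : ι → Set α} {C : Finset α} {F : Set ι} {l : List α}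
    (h : IsOrder ρ C F l) (hF : ∀ i ∈ F, ρ i ⊆ C) :
    ∃ f : α → ℤ, (∀ a b, a ∈ C → b ∈ C → f a = f b → a = b) ∧
      (l.Pairwise fun a b => f a < f b) ∧ ∀ i ∈ F, Cvx f (ρ i) := by
  classical
  have hp := pairwise_idxOf h.1
  have hinj : ∀ a b, a ∈ C → b ∈ C → (l.idxOf a : ℤ) = l.idxOf b → a = b := fun a b ha _ hab =>
    (List.idxOf_inj ((h.2.1 a).2 ha)).1 (by exact_mod_cast hab)
  refine ⟨_, hinj, hp, fun i hi a ha c hc b hab hbc => ?_⟩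
  have hal := (h.2.1 a).2 (hF i hi ha)
  have hcl := (h.2.1 c).2 (hF i hi hc)
  have hbc' : (l.idxOf b : ℤ) ≤ l.idxOf c := hbc
  have hbl : b ∈ l := by
    rw [← List.idxOf_lt_length_iff] at hcl ⊢
    omega
  rcases hab.eq_or_lt with h1 | h1
  · exact hinj a b (hF i hi ha) ((h.2.1 b).1 hbl) h1 ▸ ha
  rcases hbc.eq_or_lt with h2 | h2
  · exact (hinj b c ((h.2.1 b).1 hbl) (hF i hi hc) h2).symm ▸ hc
  exact h.2.2 i hi a b c ((triple_sublist_iff hp).2 ⟨⟨hal, hbl, hcl⟩, h1, h2⟩) ha hc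

theorem eq_of_pairwise_of_mem_iff {α : Type*} {f : α → ℤ} {l l' : List α}
    (hl : l.Pairwise fun a b => f a < f b) (hl' : l'.Pairwise fun a b => f a < f b)
    (h : ∀ c, c ∈ l ↔ c ∈ l') : l = l' := by
  have nd : ∀ {l : List α}, (l.Pairwise fun a b => f a < f b) → l.Nodup := fun hl =>
    hl.imp fun {a b} h => by
      rintro rfl
      exact absurd h (lt_irrefl _)
  exact List.Perm.eq_of_pairwise (fun a b _ _ h h' => absurd h h'.asymm) hl hl'
    ((List.perm_ext_iff_of_nodup (nd hl) (nd hl')).2 h)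

/-- The sets `B p` are the blocks of a partition of `C`. -/
structure IsPartition {α : Type*} (C : Finset α) {k : ℕ} (B : Fin k → Finset α) : Prop where
  nonempty : ∀ p, (B p).Nonempty
  mem_iff : ∀ a, a ∈ C ↔ ∃ p, a ∈ B p
  eq_of_mem : ∀ {p q a}, a ∈ B p → a ∈ B q → p = q

/-- The classes of an equivalence relation that are convex for the key `f`, in the order of `f`. -/
theorem exists_blocks {α : Type*} (C : Finset α) (s : Setoid α) (f : α → ℤ)
    (hconv : ∀ a ∈ C, ∀ b ∈ C, ∀ c ∈ C, s a c → f a ≤ f b → f b ≤ f c → s a b) :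
    ∃ (k : ℕ) (B : Fin k → Finset α), IsPartition C B ∧
      (∀ p q, ∀ a ∈ B p, ∀ b ∈ B q, s a b ↔ p = q) ∧
      ∀ p q, p < q → ∀ a ∈ B p, ∀ b ∈ B q, f a < f b := by
  classical
  let key : α → ℤ := fun a => sInf (f '' {c | c ∈ C ∧ s a c})
  have hfin : ∀ a, (f '' {c | c ∈ C ∧ s a c}).Finite := fun a =>
    (C.finite_toSet.subset fun c hc => hc.1).image f
  have hkey : ∀ a ∈ C, ∃ a' ∈ C, s a a' ∧ key a = f a' := by
    intro a ha
    obtain ⟨a', h, h'⟩ : key a ∈ f '' {c | c ∈ C ∧ s a c} :=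
      Int.csInf_mem ⟨f a, a, ⟨ha, s.refl a⟩, rfl⟩ (hfin a).bddBelow
    exact ⟨a', h.1, h.2, h'.symm⟩
  have hle : ∀ a ∈ C, ∀ b ∈ C, s a b → key a ≤ f b := fun a _ b hb hab =>
    csInf_le (hfin a).bddBelow ⟨b, ⟨hb, hab⟩, rfl⟩
  have heq : ∀ a b, s a b → key a = key b := by
    intro a b hab
    have : {c | c ∈ C ∧ s a c} = {c | c ∈ C ∧ s b c} := by
      ext c
      exact and_congr_right fun _ => ⟨s.trans (s.symm hab), s.trans hab⟩
    simp only [key, this]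
  -- the key of the class of `a` is smaller if the class comes first
  have hlt : ∀ a ∈ C, ∀ b ∈ C, key a < key b → f a < f b := by
    intro a ha b hb hab
    by_contra! h
    obtain ⟨a', ha', h1, h2⟩ := hkey a ha
    have h3 := hle b hb b hb (s.refl b)
    have := hconv a' ha' b hb a ha (s.symm h1) (by omega) h
    exact hab.ne (heq a b (s.trans h1 this))
  have hkeq : ∀ a ∈ C, ∀ b ∈ C, key a = key b → s a b := by
    intro a ha b hb hab
    obtain ⟨a', ha', h1, h2⟩ := hkey a ha
    obtain ⟨b', hb', h3, h4⟩ := hkey b hb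
    exact s.trans h1 (s.trans (hconv a' ha' b' hb' a' ha' (s.refl _) (by omega) (by omega))
      (s.symm h3))
  let I := C.image key
  let e := I.orderEmbOfFin rfl
  have he : ∀ p, e p ∈ I := fun p => Finset.orderEmbOfFin_mem I rfl p
  refine ⟨I.card, fun p => C.filter fun a => key a = e p, ⟨fun p => ?_, fun a => ⟨fun ha => ?_, ?_⟩,
    ?_⟩, fun p q a ha b hb => ?_, fun p q hpq a ha b hb => ?_⟩
  · obtain ⟨a, ha, hap⟩ := Finset.mem_image.1 (he p)
    exact ⟨a, Finset.mem_filter.2 ⟨ha, hap⟩⟩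
  · have h1 : key a ∈ Set.range e := by
      rw [Finset.range_orderEmbOfFin]
      exact Finset.mem_coe.2 (Finset.mem_image_of_mem _ ha)
    obtain ⟨p, hp⟩ := h1
    exact ⟨p, Finset.mem_filter.2 ⟨ha, hp.symm⟩⟩
  · rintro ⟨p, hp⟩
    exact (Finset.mem_filter.1 hp).1
  · intro p q a ha hb
    exact e.injective ((Finset.mem_filter.1 ha).2.symm.trans (Finset.mem_filter.1 hb).2)
  · obtain ⟨haC, hap⟩ := Finset.mem_filter.1 ha
    obtain ⟨hbC, hbq⟩ := Finset.mem_filter.1 hb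
    refine ⟨fun h => e.injective ?_, ?_⟩
    · rw [← hap, ← hbq, heq a b h]
    · rintro rfl
      exact hkeq a haC b hbC (hap.trans hbq.symm)
  · obtain ⟨ha, hap⟩ := Finset.mem_filter.1 ha
    obtain ⟨hb, hbq⟩ := Finset.mem_filter.1 hb
    exact hlt a ha b hb (by rw [hap, hbq]; exact e.strictMono hpq)

/-- Orders of the blocks are combined to an order of all columns. -/
theorem IsPartition.isOrder_flatten {ι α : Type*} {ρ : ι → Set α} {C : Finset α} {F : Set ι}
    {k : ℕ} {B : Fin k → Finset α} (hB : IsPartition C B) {g : Fin k → List α}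
    (hg : ∀ p, IsOrder ρ (B p) {i ∈ F | ρ i ⊆ B p} (g p)) (τ : Equiv.Perm (Fin k))
    (hrow : ∀ i ∈ F, (∃ p, ρ i ⊆ B p) ∨ ∀ p q q', p ≤ q → q ≤ q' → ∀ a ∈ B (τ p), ∀ b ∈ B (τ q),
      ∀ c ∈ B (τ q'), a ∈ ρ i → c ∈ ρ i → b ∈ ρ i) :
    IsOrder ρ C F (List.ofFn fun i => g (τ i)).flatten := by
  classical
  set l := (List.ofFn fun i => g (τ i)).flatten with hl
  have hmem : ∀ c, c ∈ l ↔ c ∈ C := by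
    intro c
    rw [hB.mem_iff, hl, List.mem_flatten]
    simp only [List.mem_ofFn]
    constructor
    · rintro ⟨_, ⟨p, rfl⟩, hc⟩
      exact ⟨_, ((hg _).2.1 c).1 hc⟩
    · rintro ⟨p, hp⟩
      exact ⟨_, ⟨τ.symm p, rfl⟩, by rw [τ.apply_symm_apply]; exact ((hg _).2.1 c).2 hp⟩
  have hnd : l.Nodup := by
    rw [hl, List.nodup_flatten, List.pairwise_ofFn]
    refine ⟨?_, fun i j hij c hc hc' => ?_⟩
    · intro l' hl'
      obtain ⟨p, rfl⟩ := List.mem_ofFn.1 hl'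
      exact (hg _).1
    · exact hij.ne (τ.injective (hB.eq_of_mem (((hg _).2.1 c).1 hc) (((hg _).2.1 c).1 hc')))
  have hord : ∀ p q a b, a ∈ B (τ p) → b ∈ B (τ q) → l.idxOf a < l.idxOf b → p ≤ q := by
    intro p q a b ha hb hab
    by_contra! hqp
    have h1 : l.Pairwise fun x y => ∀ p q, x ∈ B (τ p) → y ∈ B (τ q) → p ≤ q := by
      rw [hl, List.pairwise_flatten, List.pairwise_ofFn]
      constructor
      · intro l' hl'
        obtain ⟨r, rfl⟩ := List.mem_ofFn.1 hl'
        refine List.pairwise_of_forall_mem_list fun x hx y hy p q hp hq => ?_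
        have h1 := τ.injective (hB.eq_of_mem (((hg _).2.1 x).1 hx) hp)
        have h2 := τ.injective (hB.eq_of_mem (((hg _).2.1 y).1 hy) hq)
        exact (h1.symm.trans h2).le
      · intro i j hij x hx y hy p q hp hq
        have h1 := τ.injective (hB.eq_of_mem (((hg _).2.1 x).1 hx) hp)
        have h2 := τ.injective (hB.eq_of_mem (((hg _).2.1 y).1 hy) hq)
        rw [← h1, ← h2]
        exact hij.le
    have hbl := (hmem b).2 ((hB.mem_iff b).2 ⟨_, hb⟩)
    have hlb := List.idxOf_lt_length_iff.2 hbl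
    have h2 := List.pairwise_iff_getElem.1 h1 _ _ (hab.trans hlb) hlb hab p q
      (by rwa [List.getElem_idxOf]) (by rwa [List.getElem_idxOf])
    omega
  have hp := pairwise_idxOf hnd
  refine isOrder_of_key hp hmem fun i hi a ha c hc b haC hbC hcC hab hbc => ?_
  obtain ⟨pa, hpa⟩ := (hB.mem_iff a).1 haC
  obtain ⟨pb, hpb⟩ := (hB.mem_iff b).1 hbC
  obtain ⟨pc, hpc⟩ := (hB.mem_iff c).1 hcC
  obtain ⟨pa, rfl⟩ := τ.surjective pa
  obtain ⟨pb, rfl⟩ := τ.surjective pb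
  obtain ⟨pc, rfl⟩ := τ.surjective pc
  have h1 := hord _ _ a b hpa hpb (by exact_mod_cast hab)
  have h2 := hord _ _ b c hpb hpc (by exact_mod_cast hbc)
  rcases hrow i hi with ⟨p, hp'⟩ | h
  · obtain rfl := hB.eq_of_mem hpa (hp' ha)
    have h3 := τ.injective (hB.eq_of_mem hpc (hp' hc))
    obtain rfl : pa = pb := by omega
    have hsub : (g (τ pa)).Sublist l :=
      List.sublist_flatten_of_mem (List.mem_ofFn.2 ⟨pa, rfl⟩)
    refine (hg (τ pa)).2.2 i ⟨hi, hp'⟩ a b c ?_ ha hc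
    rw [triple_sublist_iff (hp.sublist hsub)]
    exact ⟨⟨((hg _).2.1 _).2 hpa, ((hg _).2.1 _).2 hpb, ((hg _).2.1 _).2 (h3 ▸ hpc)⟩, hab, hbc⟩
  · exact h _ _ _ h1 h2 a hpa b hpb c hpc ha hc

theorem IsOrder.filter {ι α : Type*} {ρ : ι → Set α} {C : Finset α} {F F' : Set ι} {l : List α}
    [DecidableEq α] (h : IsOrder ρ C F l) {B : Finset α} (hB : B ⊆ C) (hF : F' ⊆ F) :
    IsOrder ρ B F' (l.filter (· ∈ B)) := by
  refine ⟨h.1.filter _, fun c => ?_, fun i hi a b c habc =>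
    h.2.2 i (hF hi) a b c (habc.trans List.filter_sublist)⟩
  rw [List.mem_filter, h.2.1]
  simpa using fun hc => hB hc

/-- An order in which the blocks come one after the other is composed of orders of the blocks. -/
theorem IsPartition.exists_eq_flatten {ι α : Type*} {ρ : ι → Set α} {C : Finset α} {F : Set ι}
    {k : ℕ} {B : Fin k → Finset α} (hB : IsPartition C B) {l : List α} (hl : IsOrder ρ C F l)
    {f : α → ℤ} (hf : l.Pairwise fun a b => f a < f b) (τ : Equiv.Perm (Fin k))
    (hτ : ∀ p q, p < q → ∀ a ∈ B (τ p), ∀ b ∈ B (τ q), f a < f b) :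
    ∃ g : Fin k → List α, (∀ p, IsOrder ρ (B p) {i ∈ F | ρ i ⊆ B p} (g p)) ∧
      l = (List.ofFn fun i => g (τ i)).flatten := by
  classical
  have hsub : ∀ p, B p ⊆ C := fun p a ha => (hB.mem_iff a).2 ⟨p, ha⟩
  refine ⟨fun p => l.filter (· ∈ B p), fun p => hl.filter (hsub p) fun i hi => hi.1,
    eq_of_pairwise_of_mem_iff hf ?_ fun c => ?_⟩
  · rw [List.pairwise_flatten, List.pairwise_ofFn]
    constructor
    · intro l' hl'
      obtain ⟨p, rfl⟩ := List.mem_ofFn.1 hl'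
      exact hf.sublist List.filter_sublist
    · intro p q hpq a ha b hb
      simp only [List.mem_filter, decide_eq_true_eq] at ha hb
      exact hτ p q hpq a ha.2 b hb.2
  · rw [hl.2.1, hB.mem_iff, List.mem_flatten]
    simp only [List.mem_ofFn]
    constructor
    · rintro ⟨p, hp⟩
      refine ⟨_, ⟨τ.symm p, rfl⟩, ?_⟩
      rw [τ.apply_symm_apply, List.mem_filter, hl.2.1]
      exact ⟨hsub p hp, by simpa using hp⟩
    · rintro ⟨_, ⟨p, rfl⟩, hc⟩
      exact ⟨τ p, by simpa using (List.mem_filter.1 hc).2⟩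

/-! ### Components of the overlap relation -/

/-- The rows in `F` that are reached from `i` by steps between overlapping rows of `F`. -/
def Comp {ι α : Type*} (ρ : ι → Set α) (F : Set ι) (i : ι) : Set ι :=
  {j | Relation.ReflTransGen (fun a b => b ∈ F ∧ Ov ρ a b) i j}

section

variable {ι α : Type*} {ρ : ι → Set α} {F : Set ι} {i j k : ι}

theorem mem_comp_self : i ∈ Comp ρ F i := Relation.ReflTransGen.refl

theorem mem_comp_of_ov (hj : j ∈ Comp ρ F i) (hk : k ∈ F) (h : Ov ρ j k) : k ∈ Comp ρ F i :=
  hj.tail ⟨hk, h⟩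

theorem comp_subset (hi : i ∈ F) : Comp ρ F i ⊆ F := by
  intro j hj
  induction hj with
  | refl => exact hi
  | tail _ h _ => exact h.1

theorem comp_eq_of_closed {F' : Set ι} (hF : F' ⊆ F) (hi : i ∈ F')
    (hF' : ∀ a ∈ F', ∀ b ∈ F, Ov ρ a b → b ∈ F') : Comp ρ F' i = Comp ρ F i := by
  refine subset_antisymm (fun j hj =>
    Relation.ReflTransGen.mono (fun a b h => ⟨hF h.1, h.2⟩) i j hj) fun j hj => ?_
  have : j ∈ Comp ρ F' i ∧ j ∈ F' := by
    induction hj with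
    | refl => exact ⟨mem_comp_self, hi⟩
    | tail _ h ih =>
      have := hF' _ ih.2 _ h.1 h.2
      exact ⟨mem_comp_of_ov ih.1 this h.2, this⟩
  exact this.1

theorem mem_comp_symm (hi : i ∈ F) (hj : j ∈ Comp ρ F i) : i ∈ Comp ρ F j := by
  induction hj with
  | refl => exact mem_comp_self
  | @tail b c hb h ih =>
    have hbF := comp_subset hi hb
    exact Relation.ReflTransGen.head ⟨hbF, Ov.symm _ _ h.2⟩ ih

theorem comp_linked (hi : i ∈ F) : Linked (Ov ρ) (Comp ρ F i) := by
  rintro P ⟨j, hj, hPj⟩ hP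
  -- the property is first carried back to `i`
  have back : ∀ a b, a ∈ Comp ρ F i → b ∈ Comp ρ F a → P a → P b := by
    intro a b ha hb hPa
    induction hb with
    | refl => exact hPa
    | @tail c d hc h ih => exact hP c (ha.trans hc) d ((ha.trans hc).tail h) ih h.2
  have hji := mem_comp_symm hi hj
  exact fun k hk => back j k hj (hji.trans hk) hPj

/-- A row that contains another row `j`, and is not reached from `j`, contains the rows of the
component of `j`. -/
theorem comp_subset_of_subset (hj : j ∈ F) (hk : k ∈ F) (hjk : ρ j ⊆ ρ k)
    (hn : k ∉ Comp ρ F j) : ∀ i ∈ Comp ρ F j, ρ i ⊆ ρ k := by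
  refine comp_linked hj _ ⟨j, mem_comp_self, hjk⟩ fun a ha b hb hak hab => ?_
  have hno : ¬ Overlap (ρ b) (ρ k) := fun h => hn (mem_comp_of_ov hb hk h)
  obtain ⟨⟨x, hxa, hxb⟩, hab', -⟩ := hab
  rcases subset_or_subset_of_not_overlap hno hxb (hak hxa) with h | h
  · exact h
  · exact absurd (hak.trans h) hab'

theorem comp_laminar (hi : i ∈ F) (hj : j ∈ F) {x : α} (hxi : Cov ρ (Comp ρ F i) x)
    (hxj : Cov ρ (Comp ρ F j) x) :
    (∀ y, Cov ρ (Comp ρ F i) y → Cov ρ (Comp ρ F j) y) ∨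
      ∀ y, Cov ρ (Comp ρ F j) y → Cov ρ (Comp ρ F i) y := by
  obtain ⟨a, ha, hxa⟩ := hxi
  obtain ⟨b, hb, hxb⟩ := hxj
  have haF := comp_subset hi ha
  have hbF := comp_subset hj hb
  have hia := mem_comp_symm hi ha
  have hjb := mem_comp_symm hj hb
  by_cases hab : b ∈ Comp ρ F a
  · exact .inl fun y ⟨c, hc, hy⟩ =>
      ⟨c, hb.trans ((mem_comp_symm haF hab).trans (hia.trans hc)), hy⟩
  have hba : a ∉ Comp ρ F b := fun h => hab (mem_comp_symm hbF h)
  have hno : ¬ Overlap (ρ a) (ρ b) := fun h => hab (mem_comp_of_ov mem_comp_self hbF h)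
  rcases subset_or_subset_of_not_overlap hno hxa hxb with h | h
  · exact .inl fun y ⟨c, hc, hy⟩ =>
      ⟨b, hb, comp_subset_of_subset haF hbF h hab c (hia.trans hc) hy⟩
  · exact .inr fun y ⟨c, hc, hy⟩ =>
      ⟨a, ha, comp_subset_of_subset hbF haF h hba c (hjb.trans hc) hy⟩

/-- A row outside a component contains all of its rows, or is contained in one of its cells, if it
meets the component at all. -/
theorem subset_cell_or_superset (hi : i ∈ F) (hk : k ∈ F) (hn : k ∉ Comp ρ F i) {a b : α}
    (ha : a ∈ ρ k) (hb : b ∈ ρ k) (hab : Sep ρ (Comp ρ F i) a b) :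
    ∀ y, Cov ρ (Comp ρ F i) y → y ∈ ρ k := by
  obtain ⟨j, hj, hsep⟩ := hab
  have hno : ¬ Overlap (ρ j) (ρ k) := fun h => hn (mem_comp_of_ov hj hk h)
  have hjF := comp_subset hi hj
  have hij := mem_comp_symm hi hj
  have hsub : ρ j ⊆ ρ k := by
    by_cases haj : a ∈ ρ j
    · exact (subset_or_subset_of_not_overlap hno haj ha).resolve_right fun h =>
        hsep (iff_of_true haj (h hb))
    · have hbj : b ∈ ρ j := by tauto
      exact (subset_or_subset_of_not_overlap hno hbj hb).resolve_right fun h => haj (h ha)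
  rintro y ⟨c, hc, hy⟩
  exact comp_subset_of_subset hjF hk hsub (fun h => hn (hj.trans h)) c (hij.trans hc) hy

end

/-! ### Existence of PQ trees -/

theorem leafOrders_nonempty {α : Type} (T : PQTree α) : T.leafOrders.Nonempty := by
  induction T with
  | leaf c => exact ⟨[c], rfl⟩
  | pnode k f ih =>
    choose g hg using ih
    exact ⟨_, Equiv.refl _, g, hg, rfl⟩
  | qnode k f ih =>
    choose g hg using ih
    exact ⟨_, g, hg, .inl rfl⟩

theorem mem_iff_of_mem_leafOrders {α : Type} {T : PQTree α} {l : List α} (hl : l ∈ T.leafOrders)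
    (c : α) : c ∈ l ↔ c ∈ T.leafSet := by
  induction T generalizing l with
  | leaf c' =>
    obtain rfl : l = [c'] := hl
    simp [PQTree.leafSet]
  | pnode k f ih =>
    obtain ⟨τ, g, hg, rfl⟩ := hl
    simp only [List.mem_flatten, List.mem_ofFn, PQTree.leafSet, Set.mem_iUnion]
    constructor
    · rintro ⟨_, ⟨p, rfl⟩, hc⟩
      exact ⟨_, (ih _ (hg _)).1 hc⟩
    · rintro ⟨p, hp⟩
      exact ⟨_, ⟨τ.symm p, rfl⟩, by rw [τ.apply_symm_apply]; exact (ih _ (hg _)).2 hp⟩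
  | qnode k f ih =>
    obtain ⟨g, hg, rfl | rfl⟩ := hl
    all_goals
      simp only [List.mem_flatten, List.mem_ofFn, PQTree.leafSet, Set.mem_iUnion]
      constructor
    · rintro ⟨_, ⟨p, rfl⟩, hc⟩
      exact ⟨_, (ih _ (hg _)).1 hc⟩
    · rintro ⟨p, hp⟩
      exact ⟨_, ⟨p, rfl⟩, (ih _ (hg _)).2 hp⟩
    · rintro ⟨_, ⟨p, rfl⟩, hc⟩
      exact ⟨_, (ih _ (hg _)).1 hc⟩
    · rintro ⟨p, hp⟩
      exact ⟨_, ⟨p.rev, rfl⟩, by rw [Fin.rev_rev]; exact (ih _ (hg _)).2 hp⟩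

/-- The children of a Q node appear in their order in some leaf order of the whole tree. -/
theorem exists_leafOrder_of_qnode {α : Type} {T : PQTree α} {k : ℕ} {child : Fin k → PQTree α}
    (h : PQTree.qnode k child ∈ T.nodes) :
    ∃ l ∈ T.leafOrders, ∀ p q, p < q → ∀ a ∈ (child p).leafSet, ∀ b ∈ (child q).leafSet,
      [a, b].Sublist l := by
  induction T with
  | leaf c => simp [PQTree.nodes] at h
  | pnode k' f ih =>
    simp only [PQTree.nodes, Set.singleton_union, Set.mem_insert_iff, reduceCtorEq, Set.mem_iUnion,
      false_or] at h
    obtain ⟨p, hp⟩ := h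
    obtain ⟨l, hl, hl'⟩ := ih p hp
    choose g hg using fun q => leafOrders_nonempty (f q)
    refine ⟨_, ⟨Equiv.refl _, Function.update g p l, fun q => ?_, rfl⟩, fun q q' hq a ha b hb =>
      (hl' q q' hq a ha b hb).trans (List.sublist_flatten_of_mem (List.mem_ofFn.2 ⟨p, ?_⟩))⟩
    · by_cases hqp : q = p
      · subst hqp
        simpa using hl
      · simpa [hqp] using hg q
    · simp
  | qnode k' f ih =>
    simp only [PQTree.nodes, Set.singleton_union, Set.mem_insert_iff, Set.mem_iUnion] at h
    choose g hg using fun q => leafOrders_nonempty (f q)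
    rcases h with h | ⟨p, hp⟩
    · rw [PQTree.qnode.injEq] at h
      obtain ⟨rfl, h⟩ := h
      obtain rfl := eq_of_heq h
      refine ⟨_, ⟨g, hg, .inl rfl⟩, fun p q hpq a ha b hb => ?_⟩
      have h1 := (mem_iff_of_mem_leafOrders (hg p) a).2 ha
      have h2 := (mem_iff_of_mem_leafOrders (hg q) b).2 hb
      have h3 : [g p, g q].Sublist (List.ofFn g) := by
        rw [List.sublist_iff_exists_fin_orderEmbedding_get_eq]
        refine ⟨OrderEmbedding.ofStrictMono (fun i => Fin.cast (by simp) (if (i : ℕ) = 0 then p else q))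
          ?_, ?_⟩
        · intro i j hij
          have hi := i.isLt
          have hj := j.isLt
          simp only [List.length_cons, List.length_nil] at hi hj
          have h0 : (i : ℕ) = 0 := by
            have : (i : ℕ) < j := hij
            omega
          have h1 : (j : ℕ) ≠ 0 := by
            have : (i : ℕ) < j := hij
            omega
          simpa [h0, h1] using hpq
        · intro i
          fin_cases i <;> simp
      have h4 : [g p, g q].flatten.Sublist (List.ofFn g).flatten := h3.flatten
      refine List.Sublist.trans ?_ h4
      simpa using (List.singleton_sublist.2 h1).append (List.singleton_sublist.2 h2)
    · obtain ⟨l, hl, hl'⟩ := ih p hp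
      refine ⟨_, ⟨Function.update g p l, fun q => ?_, .inl rfl⟩, fun q q' hq a ha b hb =>
        (hl' q q' hq a ha b hb).trans (List.sublist_flatten_of_mem (List.mem_ofFn.2 ⟨p, ?_⟩))⟩
      · by_cases hqp : q = p
        · subst hqp
          simpa using hl
        · simpa [hqp] using hg q
      · simp

/-- `T` is a PQ tree of the rows `F` on the columns `C`, and each component of overlapping rows has a
Q node that is its union and whose children are its cells. -/
structure IsTreeOf {ι : Type*} {α : Type} (ρ : ι → Set α) (C : Finset α) (F : Set ι)
    (T : PQTree α) : Prop where
  proper : T.Proper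
  mem_leafOrders : ∀ l, l ∈ T.leafOrders ↔ IsOrder ρ C F l
  exists_qnode : ∀ i ∈ F, ∀ j ∈ F, Ov ρ i j → ∃ (k : ℕ) (child : Fin k → PQTree α),
    PQTree.qnode k child ∈ T.nodes ∧
    (∀ c, c ∈ (PQTree.qnode k child).leafSet ↔ Cov ρ (Comp ρ F i) c) ∧
    ∀ a ∈ Comp ρ F i, ∀ p, (child p).leafSet ⊆ ρ a ∨ Disjoint (ρ a) (child p).leafSet

section

variable {ι : Type*} {α : Type} {ρ : ι → Set α} {C : Finset α} {F : Set ι}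

theorem IsTreeOf.mem_leafSet {T : PQTree α} (h : IsTreeOf ρ C F T) (c : α) :
    c ∈ T.leafSet ↔ c ∈ C := by
  obtain ⟨l, hl⟩ := leafOrders_nonempty T
  rw [← mem_iff_of_mem_leafOrders hl, ((h.mem_leafOrders l).1 hl).2.1]

/-- The Q nodes of the components inside a block, where no row divides another block without being
contained in it. -/
theorem IsTreeOf.exists_qnode_block {k : ℕ} {B : Fin k → Finset α} (hB : IsPartition C B)
    (hH : ∀ i ∈ F, (∃ p, ρ i ⊆ B p) ∨ ∀ p, (B p : Set α) ⊆ ρ i ∨ Disjoint (ρ i) (B p))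
    {T : PQTree α} {p : Fin k} (hT : IsTreeOf ρ (B p) {i ∈ F | ρ i ⊆ B p} T) {i j : ι}
    (hi : i ∈ F) (hip : ρ i ⊆ B p) (hj : j ∈ F) (hij : Ov ρ i j) :
    ∃ (k : ℕ) (child : Fin k → PQTree α), PQTree.qnode k child ∈ T.nodes ∧
    (∀ c, c ∈ (PQTree.qnode k child).leafSet ↔ Cov ρ (Comp ρ F i) c) ∧
    ∀ a ∈ Comp ρ F i, ∀ p, (child p).leafSet ⊆ ρ a ∨ Disjoint (ρ a) (child p).leafSet := by
  have hcl : ∀ a ∈ {i ∈ F | ρ i ⊆ B p}, ∀ b ∈ F, Ov ρ a b → b ∈ {i ∈ F | ρ i ⊆ B p} := by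
    rintro a ⟨ha, hap⟩ b hb ⟨⟨x, hxa, hxb⟩, hab, -⟩
    refine ⟨hb, ?_⟩
    rcases hH b hb with ⟨q, hq⟩ | h
    · obtain rfl := hB.eq_of_mem (Finset.mem_coe.1 (hap hxa)) (Finset.mem_coe.1 (hq hxb))
      exact hq
    · rcases h p with h | h
      · exact absurd (hap.trans h) hab
      · exact absurd (hap hxa) (Set.disjoint_left.1 h hxb)
  rw [← comp_eq_of_closed (fun i hi => hi.1) (show i ∈ {i ∈ F | ρ i ⊆ B p} from ⟨hi, hip⟩) hcl]
  exact hT.exists_qnode i ⟨hi, hip⟩ j (hcl i ⟨hi, hip⟩ j hj hij) hij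

theorem isTreeOf_leaf (c : α) (hF : ∀ i ∈ F, ρ i ⊆ {c}) : IsTreeOf ρ {c} F (.leaf c) := by
  refine ⟨trivial, fun l => ⟨?_, fun h => ?_⟩, fun i hi j hj hij => ?_⟩
  · rintro rfl
    refine ⟨List.nodup_singleton c, by simp, fun i hi a b d h => ?_⟩
    have := h.length_le
    simp at this
  · exact List.perm_singleton.1 ((List.perm_ext_iff_of_nodup h.1 (List.nodup_singleton c)).2
      fun d => by simp [h.2.1])
  · obtain ⟨⟨x, hxi, hxj⟩, h1, -⟩ := hij
    refine absurd (fun y hy => ?_) h1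
    rw [hF i hi hy, ← show x = c from hF i hi hxi]
    exact hxj

/-- Trees for the blocks of a partition, if smaller sets of columns have trees. -/
theorem IsPartition.exists_trees {k : ℕ} {B : Fin k → Finset α} (hB : IsPartition C B) (hk : 2 ≤ k)
    {l : List α} (hl : IsOrder ρ C F l)
    (ih : ∀ (C' : Finset α) (F' : Set ι), C'.card < C.card → C'.Nonempty → (∀ i ∈ F', ρ i ⊆ C') →
      (∃ l, IsOrder ρ C' F' l) → ∃ T, IsTreeOf ρ C' F' T) :
    ∃ T : Fin k → PQTree α, ∀ p, IsTreeOf ρ (B p) {i ∈ F | ρ i ⊆ B p} (T p) := by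
  classical
  have hsub : ∀ p, B p ⊆ C := fun p a ha => (hB.mem_iff a).2 ⟨p, ha⟩
  refine Classical.skolem.1 fun p => ih _ _ (Finset.card_lt_card ⟨hsub p, fun h => ?_⟩)
    (hB.nonempty p) (fun i hi => hi.2) ⟨_, hl.filter (hsub p) fun i hi => hi.1⟩
  obtain ⟨q, hq⟩ : ∃ q, q ≠ p := by
    by_cases h0 : (p : ℕ) = 0
    · exact ⟨⟨1, by omega⟩, fun h => by simp [← h] at h0⟩
    · exact ⟨⟨0, by omega⟩, fun h => h0 (by simp [← h])⟩
  obtain ⟨a, ha⟩ := hB.nonempty q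
  exact hq (hB.eq_of_mem ha (h (hsub q ha)))

/-- The blocks of an equivalence relation with convex classes appear one after the other. -/
theorem exists_block_perm {k : ℕ} {B : Fin k → Finset α} (hB : IsPartition C B) {s : Setoid α}
    (hs : ∀ p q, ∀ a ∈ B p, ∀ b ∈ B q, s a b ↔ p = q) {f : α → ℤ}
    (hinj : ∀ a b, a ∈ C → b ∈ C → f a = f b → a = b)
    (hconv : ∀ a ∈ C, ∀ b ∈ C, ∀ c ∈ C, s a c → f a ≤ f b → f b ≤ f c → s a b) :
    ∃ τ : Equiv.Perm (Fin k), ∀ p q, p < q → ∀ a ∈ B (τ p), ∀ b ∈ B (τ q), f a < f b := by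
  have hsub : ∀ p, B p ⊆ C := fun p a ha => (hB.mem_iff a).2 ⟨p, ha⟩
  choose x hx using hB.nonempty
  refine ⟨Tuple.sort fun p => f (x p), fun p q hpq a ha b hb => ?_⟩
  have hle : f (x (Tuple.sort (fun p => f (x p)) p)) ≤ f (x (Tuple.sort (fun p => f (x p)) q)) :=
    Tuple.monotone_sort (fun p => f (x p)) hpq.le
  generalize hτ : Tuple.sort (fun p => f (x p)) = τ at *
  have hne : τ p ≠ τ q := fun h => hpq.ne (τ.injective h)
  have hlt : f (x (τ p)) < f (x (τ q)) := lt_of_le_of_ne hle fun h => hne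
    (hB.eq_of_mem (hx _) (hinj _ _ (hsub _ (hx _)) (hsub _ (hx _)) h ▸ hx (τ q)))
  by_contra! h
  rcases le_total (f (x (τ p))) (f b) with h1 | h1
  · exact hne ((hs _ _ _ (hx _) _ hb).1 (hconv _ (hsub _ (hx _)) _ (hsub _ hb) _ (hsub _ ha)
      ((hs _ _ _ (hx _) _ ha).2 rfl) h1 h))
  · exact hne.symm ((hs _ _ _ hb _ (hx _)).1 (hconv _ (hsub _ hb) _ (hsub _ (hx _)) _
      (hsub _ (hx _)) ((hs _ _ _ hb _ (hx (τ q))).2 rfl) h1 hlt.le))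

theorem exists_two_le_of_partition {k : ℕ} {B : Fin k → Finset α} (hB : IsPartition C B)
    {s : Setoid α} (hs : ∀ p q, ∀ a ∈ B p, ∀ b ∈ B q, s a b ↔ p = q) {a b : α} (ha : a ∈ C)
    (hb : b ∈ C) (hab : ¬ s a b) : 2 ≤ k := by
  obtain ⟨p, hp⟩ := (hB.mem_iff a).1 ha
  obtain ⟨q, hq⟩ := (hB.mem_iff b).1 hb
  have hne : (p : ℕ) ≠ q := fun h => hab ((hs p q a hp b hq).2 (Fin.ext h))
  omega

/-- A P node, for columns that are not the union of a component of overlapping rows. The children are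
the maximal unions of components, and the columns outside of these. -/
theorem exists_tree_pnode [Finite α] (hC : 2 ≤ C.card) (hF : ∀ i ∈ F, ρ i ⊆ C) {l : List α}
    (hl : IsOrder ρ C F l)
    (hP : ∀ i ∈ F, ∀ j ∈ F, Ov ρ i j → ∃ c ∈ C, ¬ Cov ρ (Comp ρ F i) c)
    (ih : ∀ (C' : Finset α) (F' : Set ι), C'.card < C.card → C'.Nonempty → (∀ i ∈ F', ρ i ⊆ C') →
      (∃ l, IsOrder ρ C' F' l) → ∃ T, IsTreeOf ρ C' F' T) :
    ∃ T, IsTreeOf ρ C F T := by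
  let W : ι → Prop := fun i => i ∈ F ∧ ∃ c ∈ C, ¬ Cov ρ (Comp ρ F i) c
  let s : Setoid α := ⟨fun a b => a = b ∨ ∃ i, W i ∧ Cov ρ (Comp ρ F i) a ∧ Cov ρ (Comp ρ F i) b, by
    refine ⟨fun a => .inl rfl, ?_, ?_⟩
    · rintro a b (rfl | ⟨i, hi, ha, hb⟩)
      · exact .inl rfl
      · exact .inr ⟨i, hi, hb, ha⟩
    · rintro a b c (rfl | ⟨i, hi, ha, hb⟩) (rfl | ⟨j, hj, hb', hc⟩)
      · exact .inl rfl
      · exact .inr ⟨j, hj, hb', hc⟩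
      · exact .inr ⟨i, hi, ha, hb⟩
      · rcases comp_laminar hi.1 hj.1 hb hb' with h | h
        · exact .inr ⟨j, hj, h a ha, hc⟩
        · exact .inr ⟨i, hi, ha, h c hc⟩⟩
  have hconv : ∀ f : α → ℤ, (∀ a b, a ∈ C → b ∈ C → f a = f b → a = b) →
      (∀ i ∈ F, Cvx f (ρ i)) →
      ∀ a ∈ C, ∀ b ∈ C, ∀ c ∈ C, s a c → f a ≤ f b → f b ≤ f c → s a b := by
    rintro f hinj hf a ha b hb c hc (rfl | ⟨i, hi, hai, hci⟩) hab hbc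
    · exact .inl (hinj a b ha hb (le_antisymm hab hbc))
    · exact .inr ⟨i, hi, hai, cov_cvx (comp_linked hi.1)
        (fun j hj => hf j (comp_subset hi.1 hj)) a hai c hci b hab hbc⟩
  obtain ⟨f₀, hinj₀, -, hf₀⟩ := hl.exists_key hF
  obtain ⟨k, B, hB, hs, -⟩ := exists_blocks C s f₀ (hconv f₀ hinj₀ hf₀)
  have hsub : ∀ p, B p ⊆ C := fun p a ha => (hB.mem_iff a).2 ⟨p, ha⟩
  -- a maximal union of components that contains a given column is not all of `C`
  have hk : 2 ≤ k := by
    obtain ⟨a, ha, b, hb, hab⟩ := Finset.one_lt_card.1 (show 1 < C.card by omega)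
    by_cases hW : ∃ i, W i ∧ Cov ρ (Comp ρ F i) a
    · obtain ⟨i, hi, hai⟩ := hW
      obtain ⟨U, -, ⟨⟨j, ⟨hj, c, hc, hcj⟩, haj, rfl⟩, hmax⟩⟩ :=
        exists_maximal_ge_of_wellFoundedGT
          (fun U => ∃ j, W j ∧ Cov ρ (Comp ρ F j) a ∧ U = {c | Cov ρ (Comp ρ F j) c}) _
          ⟨i, hi, hai, rfl⟩
      refine exists_two_le_of_partition hB hs ha hc fun h => ?_
      rcases h with rfl | ⟨i', hi', hai', hci'⟩
      · exact hcj haj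
      · rcases comp_laminar hj hi'.1 haj hai' with h | h
        · exact hcj (hmax ⟨i', hi', hai', rfl⟩ h hci')
        · exact hcj (h c hci')
    · refine exists_two_le_of_partition hB hs ha hb fun h => ?_
      rcases h with rfl | ⟨i, hi, hai, -⟩
      · exact hab rfl
      · exact hW ⟨i, hi, hai⟩
  have hrow : ∀ i ∈ F, (∃ p, ρ i ⊆ B p) ∨ (∀ c ∈ C, c ∈ ρ i) := by
    intro i hi
    by_cases hW : ∃ c ∈ C, ¬ Cov ρ (Comp ρ F i) c
    · left
      rcases (ρ i).eq_empty_or_nonempty with h | ⟨x, hx⟩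
      · exact ⟨⟨0, by omega⟩, by simp [h]⟩
      obtain ⟨p, hp⟩ := (hB.mem_iff x).1 (hF i hi hx)
      refine ⟨p, fun y hy => ?_⟩
      obtain ⟨q, hq⟩ := (hB.mem_iff y).1 (hF i hi hy)
      obtain rfl := (hs p q x hp y hq).1
        (.inr ⟨i, ⟨hi, hW⟩, ⟨i, mem_comp_self, hx⟩, ⟨i, mem_comp_self, hy⟩⟩)
      exact hq
    · right
      push Not at hW
      intro c hc
      obtain ⟨j, hj, hcj⟩ := hW c hc
      rcases hj.cases_head with rfl | ⟨j', h, -⟩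
      · exact hcj
      · obtain ⟨d, hd, hd'⟩ := hP i hi j' h.1 h.2
        exact absurd (hW d hd) hd'
  obtain ⟨T, hT⟩ := hB.exists_trees hk hl ih
  refine ⟨.pnode k T, ⟨hk, fun p => (hT p).proper⟩, fun l' => ⟨?_, fun h => ?_⟩,
    fun i hi j hj hij => ?_⟩
  · rintro ⟨τ, g, hg, rfl⟩
    refine hB.isOrder_flatten (fun p => ((hT p).mem_leafOrders _).1 (hg p)) τ fun i hi => ?_
    exact (hrow i hi).imp_right fun h p q q' _ _ a _ b hb c _ _ _ => h b (hsub _ hb)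
  · obtain ⟨f, hinj, hp, hf⟩ := h.exists_key hF
    obtain ⟨τ, hτ⟩ := exists_block_perm hB hs hinj (hconv f hinj hf)
    obtain ⟨g, hg, hl'⟩ := hB.exists_eq_flatten h hp τ hτ
    exact ⟨τ, g, fun p => ((hT p).mem_leafOrders _).2 (hg p), hl'⟩
  · have hip : ∃ p, ρ i ⊆ B p := (hrow i hi).resolve_right fun h =>
      hij.2.2 fun c hc => h c (hF j hj hc)
    obtain ⟨p, hp⟩ := hip
    obtain ⟨k', child, h1, h2⟩ := (hT p).exists_qnode_block hB (fun i hi =>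
      (hrow i hi).imp_right fun h q => .inl fun c hc => h c (hsub q hc)) hi hp hj hij
    exact ⟨k', child, .inr (Set.mem_iUnion.2 ⟨p, h1⟩), h2⟩

/-- A Q node, for columns that are the union of a component of overlapping rows. The children are its
cells; their order is unique up to reversal. -/
theorem exists_tree_qnode (hF : ∀ i ∈ F, ρ i ⊆ C) {l : List α} (hl : IsOrder ρ C F l) {i₀ j₀ : ι}
    (hi₀ : i₀ ∈ F) (hj₀ : j₀ ∈ F) (hij₀ : Ov ρ i₀ j₀) (hQ : ∀ c ∈ C, Cov ρ (Comp ρ F i₀) c)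
    (ih : ∀ (C' : Finset α) (F' : Set ι), C'.card < C.card → C'.Nonempty → (∀ i ∈ F', ρ i ⊆ C') →
      (∃ l, IsOrder ρ C' F' l) → ∃ T, IsTreeOf ρ C' F' T) :
    ∃ T, IsTreeOf ρ C F T := by
  set K := Comp ρ F i₀ with hK
  have hKF : K ⊆ F := comp_subset hi₀
  have hlink : Linked (Ov ρ) K := comp_linked hi₀
  let s : Setoid α := ⟨fun a b => ¬ Sep ρ K a b, fun a ⟨i, _, h⟩ => h Iff.rfl,
    fun h h' => h h'.symm, fun h h' h'' => h' (sep_of_not_sep h h'')⟩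
  have hCK : ∀ c, Cov ρ K c → c ∈ C := fun c ⟨i, hi, hc⟩ => hF i (hKF hi) hc
  obtain ⟨f₀, hinj₀, -, hf₀⟩ := hl.exists_key hF
  obtain ⟨k, B, hB, hs, hlt₀⟩ := exists_blocks C s f₀ fun a ha b hb c hc hac hab hbc =>
    cell_contiguous hlink (fun i hi => hf₀ i (hKF hi)) (hQ a ha) hac hab hbc
  have hsub : ∀ p, B p ⊆ C := fun p a ha => (hB.mem_iff a).2 ⟨p, ha⟩
  have hk : 3 ≤ k := by
    have hov : ∃ i ∈ K, ∃ j ∈ K, Ov ρ i j :=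
      ⟨i₀, mem_comp_self, j₀, mem_comp_of_ov mem_comp_self hj₀ hij₀, hij₀⟩
    obtain ⟨⟨a, ha, -⟩, -⟩ := hij₀
    obtain ⟨b, hb, hba, -⟩ := exists_third_cell hov a a
    obtain ⟨c, hc, hca, hcb⟩ := exists_third_cell hov a b
    obtain ⟨p, hp⟩ := (hB.mem_iff a).1 (hF i₀ hi₀ ha)
    obtain ⟨q, hq⟩ := (hB.mem_iff b).1 (hCK b hb)
    obtain ⟨r, hr⟩ := (hB.mem_iff c).1 (hCK c hc)
    have h1 : (q : ℕ) ≠ p := fun h => (hs q p b hq a hp).2 (Fin.ext h) hba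
    have h2 : (r : ℕ) ≠ p := fun h => (hs r p c hr a hp).2 (Fin.ext h) hca
    have h3 : (r : ℕ) ≠ q := fun h => (hs r q c hr b hq).2 (Fin.ext h) hcb
    omega
  have hrow : ∀ i ∈ F, i ∉ K → (∃ p, ρ i ⊆ B p) ∨ (∀ c ∈ C, c ∈ ρ i) := by
    intro i hi hiK
    by_cases hsep : ∃ a ∈ ρ i, ∃ b ∈ ρ i, Sep ρ K a b
    · obtain ⟨a, ha, b, hb, hab⟩ := hsep
      exact .inr fun c hc => subset_cell_or_superset hi₀ hi hiK ha hb hab c (hQ c hc)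
    · push Not at hsep
      left
      rcases (ρ i).eq_empty_or_nonempty with h | ⟨x, hx⟩
      · exact ⟨⟨0, by omega⟩, by simp [h]⟩
      obtain ⟨p, hp⟩ := (hB.mem_iff x).1 (hF i hi hx)
      refine ⟨p, fun y hy => ?_⟩
      obtain ⟨q, hq⟩ := (hB.mem_iff y).1 (hF i hi hy)
      obtain rfl := (hs p q x hp y hq).1 (hsep x hx y hy)
      exact hq
  have hsame : ∀ i ∈ K, ∀ p, ∀ a ∈ B p, ∀ b ∈ B p, a ∈ ρ i → b ∈ ρ i :=
    fun i hi p a ha b hb h => (iff_of_not_sep ((hs p p a ha b hb).2 rfl) hi).1 h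
  have hcell : ∀ i ∈ K, ∀ p, (B p : Set α) ⊆ ρ i ∨ Disjoint (ρ i) (B p) := by
    intro i hi p
    by_cases h : ∃ a ∈ B p, a ∈ ρ i
    · obtain ⟨a, ha, hai⟩ := h
      exact .inl fun b hb => hsame i hi p a ha b hb hai
    · push Not at h
      exact .inr (Set.disjoint_left.2 fun a hai ha => h a ha hai)
  have hbetween : ∀ i ∈ K, ∀ p q q', p ≤ q → q ≤ q' → ∀ a ∈ B p, ∀ b ∈ B q, ∀ c ∈ B q',
      a ∈ ρ i → c ∈ ρ i → b ∈ ρ i := by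
    intro i hi p q q' hpq hqq a ha b hb c hc hai hci
    rcases hpq.eq_or_lt with rfl | h1
    · exact hsame i hi p a ha b hb hai
    rcases hqq.eq_or_lt with rfl | h2
    · exact hsame i hi q c hc b hb hci
    exact hf₀ i (hKF hi) a hai c hci b (hlt₀ _ _ h1 a ha b hb).le (hlt₀ _ _ h2 b hb c hc).le
  obtain ⟨T, hT⟩ := hB.exists_trees (by omega) hl ih
  have hTB : ∀ p, (T p).leafSet = B p := fun p => Set.ext fun c => (hT p).mem_leafSet c
  refine ⟨.qnode k T, ⟨hk, fun p => (hT p).proper⟩, fun l' => ⟨?_, fun h => ?_⟩,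
    fun i hi j hj hij => ?_⟩
  · rintro ⟨g, hg, hl'⟩
    have hg' := fun p => ((hT p).mem_leafOrders _).1 (hg p)
    rcases hl' with rfl | rfl
    · refine hB.isOrder_flatten hg' (Equiv.refl _) fun i hi => ?_
      by_cases hiK : i ∈ K
      · exact .inr fun p q q' h h' a ha b hb c hc => hbetween i hiK p q q' h h' a ha b hb c hc
      · exact (hrow i hi hiK).imp_right fun h p q q' _ _ a _ b hb c _ _ _ => h b (hsub _ hb)
    · refine hB.isOrder_flatten hg' Fin.revPerm fun i hi => ?_
      by_cases hiK : i ∈ K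
      · exact .inr fun p q q' h h' a ha b hb c hc hai hci => hbetween i hiK q'.rev q.rev p.rev
          (Fin.rev_le_rev.2 h') (Fin.rev_le_rev.2 h) c hc b hb a ha hci hai
      · exact (hrow i hi hiK).imp_right fun h p q q' _ _ a _ b hb c _ _ _ => h b (hsub _ hb)
  · obtain ⟨f, hinj, hp, hf⟩ := h.exists_key hF
    obtain ⟨f', hf', -, hlt⟩ := exists_same_orientation hlink (fun i hi => hf₀ i (hKF hi))
      fun i hi => hf i (hKF hi)
    have hlt' : ∀ p q, p < q → ∀ a ∈ B p, ∀ b ∈ B q, f' a < f' b := fun p q hpq a ha b hb =>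
      hlt a b (hQ a (hsub p ha)) (hQ b (hsub q hb))
        (not_not.1 fun h => hpq.ne ((hs p q a ha b hb).1 h)) (hlt₀ p q hpq a ha b hb)
    rcases hf' with rfl | rfl
    · obtain ⟨g, hg, hl'⟩ := hB.exists_eq_flatten h hp (Equiv.refl _) hlt'
      exact ⟨g, fun p => ((hT p).mem_leafOrders _).2 (hg p), .inl hl'⟩
    · obtain ⟨g, hg, hl'⟩ := hB.exists_eq_flatten h hp Fin.revPerm fun p q hpq a ha b hb => by
        exact neg_lt_neg_iff.1 (hlt' _ _ (Fin.rev_lt_rev.2 hpq) b hb a ha)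
      exact ⟨g, fun p => ((hT p).mem_leafOrders _).2 (hg p), .inr hl'⟩
  · by_cases hiK : i ∈ K
    · have heq : Comp ρ F i = K := subset_antisymm (fun a ha => hiK.trans ha)
        fun a ha => (mem_comp_symm hi₀ hiK).trans ha
      refine ⟨k, T, .inl rfl, fun c => ?_, fun a ha p => ?_⟩
      · rw [heq, PQTree.leafSet, Set.mem_iUnion]
        simp only [hTB, Finset.mem_coe]
        rw [← hB.mem_iff]
        exact ⟨hQ c, hCK c⟩
      · rw [hTB]
        exact hcell a (heq ▸ ha) p
    · have hip : ∃ p, ρ i ⊆ B p := (hrow i hi hiK).resolve_right fun h =>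
        hij.2.2 fun c hc => h c (hF j hj hc)
      obtain ⟨p, hp⟩ := hip
      obtain ⟨k', child, h1, h2⟩ := (hT p).exists_qnode_block hB (fun i hi => by
        by_cases hiK : i ∈ K
        · exact .inr (hcell i hiK)
        · exact (hrow i hi hiK).imp_right fun h q => .inl fun c hc => h c (hsub q hc)) hi hp hj hij
      exact ⟨k', child, .inr (Set.mem_iUnion.2 ⟨p, h1⟩), h2⟩

/-- Rows with the consecutive-ones property have a PQ tree. -/
theorem exists_tree [Finite α] (hC : C.Nonempty) (hF : ∀ i ∈ F, ρ i ⊆ C)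
    (h : ∃ l, IsOrder ρ C F l) : ∃ T, IsTreeOf ρ C F T := by
  induction hN : C.card using Nat.strong_induction_on generalizing C F with
  | _ N ih =>
    have ih' : ∀ (C' : Finset α) (F' : Set ι), C'.card < C.card → C'.Nonempty → (∀ i ∈ F', ρ i ⊆ C') →
        (∃ l, IsOrder ρ C' F' l) → ∃ T, IsTreeOf ρ C' F' T := fun C' F' hlt hC' hF' h' =>
      ih C'.card (hN ▸ hlt) hC' hF' h' rfl
    obtain ⟨l, hl⟩ := h
    by_cases h1 : C.card = 1
    · obtain ⟨c, rfl⟩ := Finset.card_eq_one.1 h1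
      exact ⟨_, isTreeOf_leaf c (by simpa using hF)⟩
    by_cases hQ : ∃ i ∈ F, ∃ j ∈ F, Ov ρ i j ∧ ∀ c ∈ C, Cov ρ (Comp ρ F i) c
    · obtain ⟨i, hi, j, hj, hij, hc⟩ := hQ
      exact exists_tree_qnode hF hl hi hj hij hc ih'
    · push Not at hQ
      have := hC.card_pos
      exact exists_tree_pnode (by omega) hF hl hQ ih'

end

/-! ### Straddled rows and Q nodes -/

section

variable {m n : ℕ} {M : Matrix (Fin m) (Fin n) Bool} {R : List (Fin m)} {Z : Fin m}

theorem mem_comp_iff_reachable (i : {i // i ∈ R}) (j : Fin m) :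
    j ∈ Comp (rowSet M) {i | i ∈ R} i ↔ ∃ hj : j ∈ R, (overlapGraph M R).Reachable i ⟨j, hj⟩ := by
  constructor
  · intro h
    induction h with
    | refl => exact ⟨i.2, .rfl⟩
    | tail _ h ih =>
      obtain ⟨hb, hr⟩ := ih
      have hadj : (overlapGraph M R).Adj ⟨_, hb⟩ ⟨_, h.1⟩ := h.2
      exact ⟨h.1, hr.trans hadj.reachable⟩
  · rintro ⟨hj, ⟨w⟩⟩
    have key : ∀ (u v : {i // i ∈ R}) (w : (overlapGraph M R).Walk u v),
        (v : Fin m) ∈ Comp (rowSet M) {i | i ∈ R} u := by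
      intro u v w
      induction w with
      | nil => exact mem_comp_self
      | @cons u v' w hadj p ih => exact Relation.ReflTransGen.head ⟨v'.2, hadj⟩ ih
    exact key i ⟨j, hj⟩ w

theorem exists_pqTree (hn : 0 < n) (hR : HasConsecutiveOnes M {i | i ∈ R}) :
    ∃ T, IsPQTree M R T ∧ IsTreeOf (rowSet M) Finset.univ {i | i ∈ R} T := by
  have hiff : ∀ l, IsOrder (rowSet M) Finset.univ {i | i ∈ R} l ↔
      IsConsecutiveOrdering M {i | i ∈ R} l := fun l => by
    simp [IsOrder, IsConsecutiveOrdering]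
  have : Nonempty (Fin n) := ⟨⟨0, hn⟩⟩
  obtain ⟨l, hl⟩ := hR
  obtain ⟨T, hT⟩ := exists_tree (ρ := rowSet M) (F := {i | i ∈ R}) Finset.univ_nonempty
    (fun i _ c _ => by simp) ⟨l, (hiff l).2 hl⟩
  exact ⟨T, ⟨hT.proper, fun l => (hT.mem_leafOrders l).trans (hiff l)⟩, hT⟩

/-- An order of the columns, as a key, in which the children of a Q node appear in their order. -/
theorem IsPQTree.exists_key {T : PQTree (Fin n)} (hT : IsPQTree M R T) {k : ℕ}
    {child : Fin k → PQTree (Fin n)} (h : PQTree.qnode k child ∈ T.nodes) :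
    ∃ f : Fin n → ℤ, Function.Injective f ∧ (∀ i ∈ R, Cvx f (rowSet M i)) ∧
      ∀ p q, p < q → ∀ a ∈ (child p).leafSet, ∀ b ∈ (child q).leafSet, f a < f b := by
  obtain ⟨l, hl, hord⟩ := exists_leafOrder_of_qnode h
  obtain ⟨f, hinj, hp, hf⟩ := ((hT.2 l).1 hl).exists_key
  refine ⟨f, hinj, hf, fun p q hpq a ha b hb => ?_⟩
  have := hp.sublist (hord p q hpq a ha b hb)
  simpa using this

/-- If a row `Z` is straddled in a family whose other rows are in `R`, its neighbours witness this at
the Q node of their component. -/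
theorem exists_isCorral {S : Set (Fin m)} (hn : 0 < n) (hR : HasConsecutiveOnes M {i | i ∈ R})
    (hSR : S \ {Z} ⊆ {i | i ∈ R}) (hlink : Linked (Ov (rowSet M)) (S \ {Z}))
    (hZ : IsStraddled M S Z) : ∃ A B, IsCorral M R Z A B := by
  obtain ⟨A, hA, B, hB, a, x, b, ⟨haA, haZ, haB⟩, ⟨hbB, hbZ, hbA⟩, ⟨hxA, hxB, hxZ⟩, hord⟩ := hZ
  obtain ⟨T, hT, hTo⟩ := exists_pqTree hn hR
  have hAR : A ∈ R := hSR hA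
  have hBR : B ∈ R := hSR hB
  have hcomp : ∀ j ∈ S \ {Z}, j ∈ Comp (rowSet M) {i | i ∈ R} A :=
    hlink _ ⟨A, hA, mem_comp_self⟩ fun i hi j hj h hij => mem_comp_of_ov h (hSR hj) hij
  obtain ⟨A', hA', j, hj, rfl, -, hAj⟩ := hlink.exists_rel (C := {A}) ⟨A, hA, rfl⟩
    ⟨B, hB, fun h => haB (Set.mem_singleton_iff.1 h ▸ haA)⟩
  obtain ⟨k, child, hnode, hleaf, hcell⟩ := hTo.exists_qnode A' hAR j (hSR hj) hAj
  obtain ⟨f, hinj, hf, hfc⟩ := hT.exists_key hnode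
  have hA0 := hcell A' mem_comp_self
  have hB0 := hcell B (hcomp B hB)
  have hxcov : Cov (rowSet M) (Comp (rowSet M) {i | i ∈ R} A') x := by
    have hcvx := cov_cvx (comp_linked (ρ := rowSet M) (F := {i | i ∈ R}) hAR) (f := f)
      fun i hi => hf i (comp_subset (F := {i | i ∈ R}) hAR hi)
    rcases hord f hinj fun i hi => hf i (hSR hi) with h | h
    · exact hcvx a ⟨A', mem_comp_self, haA⟩ b ⟨B, hcomp B hB, hbB⟩ x h.1.le h.2.le
    · exact hcvx b ⟨B, hcomp B hB, hbB⟩ a ⟨A', mem_comp_self, haA⟩ x h.1.le h.2.le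
  have hchild : ∀ c, Cov (rowSet M) (Comp (rowSet M) {i | i ∈ R} A') c →
      ∃ p, c ∈ (child p).leafSet := fun c hc => Set.mem_iUnion.1 ((hleaf c).2 hc)
  obtain ⟨h, hah⟩ := hchild a ⟨A', mem_comp_self, haA⟩
  obtain ⟨i, hxi⟩ := hchild x hxcov
  obtain ⟨j', hbj⟩ := hchild b ⟨B, hcomp B hB, hbB⟩
  have hin : ∀ {E : Fin m} {p c}, (∀ p, (child p).leafSet ⊆ rowSet M E ∨
      Disjoint (rowSet M E) (child p).leafSet) → c ∈ (child p).leafSet → c ∈ rowSet M E →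
      (child p).leafSet ⊆ rowSet M E := fun h hc hE =>
    (h _).resolve_right fun hd => Set.disjoint_left.1 hd hE hc
  have hout : ∀ {E : Fin m} {p c}, (∀ p, (child p).leafSet ⊆ rowSet M E ∨
      Disjoint (rowSet M E) (child p).leafSet) → c ∈ (child p).leafSet → c ∉ rowSet M E →
      Disjoint (rowSet M E) (child p).leafSet := fun h hc hE =>
    (h _).resolve_left fun hd => hE (hd hc)
  have hlt : ∀ {p q c d}, c ∈ (child p).leafSet → d ∈ (child q).leafSet → p ≠ q → f c < f d →
      p < q := by
    intro p q c d hc hd hne hcd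
    by_contra hle
    exact absurd (hfc q p (lt_of_le_of_ne (not_lt.1 hle) hne.symm) d hd c hc) hcd.asymm
  have hhi : h ≠ i := by
    rintro rfl
    exact hxA (hin hA0 hah haA hxi)
  have hij : i ≠ j' := by
    rintro rfl
    exact hxB (hin hB0 hbj hbB hxi)
  have hK : ∃ K : (overlapGraph M R).ConnectedComponent, ⟨A', hAR⟩ ∈ K.supp ∧ ⟨B, hBR⟩ ∈ K.supp ∧
      ⋃ r ∈ K.supp, rowSet M r = (PQTree.qnode k child).leafSet := by
    refine ⟨(overlapGraph M R).connectedComponentMk ⟨A', hAR⟩, rfl, ?_, ?_⟩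
    · obtain ⟨hB', hr⟩ := (mem_comp_iff_reachable ⟨A', hAR⟩ B).1 (hcomp B hB)
      exact (SimpleGraph.ConnectedComponent.sound hr).symm
    · ext c
      rw [hleaf, Set.mem_iUnion₂]
      constructor
      · rintro ⟨r, hr, hc⟩
        exact ⟨r, (mem_comp_iff_reachable ⟨A', hAR⟩ r).2
          ⟨r.2, (SimpleGraph.ConnectedComponent.exact hr).symm⟩, hc⟩
      · rintro ⟨r, hr, hc⟩
        obtain ⟨hrR, hr⟩ := (mem_comp_iff_reachable ⟨A', hAR⟩ r).1 hr
        exact ⟨⟨r, hrR⟩, (SimpleGraph.ConnectedComponent.sound hr).symm, hc⟩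
  rcases hord f hinj fun i hi => hf i (hSR hi) with h' | h'
  · exact ⟨⟨A', hAR⟩, ⟨B, hBR⟩, T, hT, k, child, hnode, h, i, j',
      ⟨hlt hah hxi hhi h'.1, hlt hxi hbj hij h'.2, ⟨a, hah, haZ⟩, ⟨x, hxi, hxZ⟩, ⟨b, hbj, hbZ⟩⟩, hK,
      hin hA0 hah haA, hout hA0 hxi hxA, hout hA0 hbj hbA, hin hB0 hbj hbB, hout hB0 hah haB,
      hout hB0 hxi hxB⟩
  · obtain ⟨K, h1, h2, h3⟩ := hK
    exact ⟨⟨B, hBR⟩, ⟨A', hAR⟩, T, hT, k, child, hnode, j', i, h,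
      ⟨hlt hbj hxi hij.symm h'.1, hlt hxi hah hhi.symm h'.2, ⟨b, hbj, hbZ⟩, ⟨x, hxi, hxZ⟩,
        ⟨a, hah, haZ⟩⟩, ⟨K, h2, h1, h3⟩,
      hin hB0 hbj hbB, hout hB0 hxi hxB, hout hB0 hah haB, hin hA0 hah haA, hout hA0 hbj hbA,
      hout hA0 hxi hxA⟩

/-- The information that is extracted from a 1-0-1 configuration: in some order of the columns for
which the rows in `R` are consecutive, a 0 of `Z` lies between a 1 of `Z` in `A` and
a 1 of `Z` in `B`. -/
theorem IsCorral.exists_key {A B : {i // i ∈ R}} (h : IsCorral M R Z A B) :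
    (overlapGraph M R).Reachable A B ∧ HasConsecutiveOnes M {i | i ∈ R} ∧
    ∃ (f : Fin n → ℤ) (a x b : Fin n), (∀ i ∈ R, Cvx f (rowSet M i)) ∧ f a < f x ∧ f x < f b ∧
      (a ∈ rowSet M A ∧ a ∈ rowSet M Z) ∧ (b ∈ rowSet M B ∧ b ∈ rowSet M Z) ∧
      (x ∉ rowSet M A ∧ x ∉ rowSet M B ∧ x ∉ rowSet M Z) := by
  obtain ⟨T, hT, k, child, hnode, h, i, j, ⟨hhi, hij, ⟨a, hah, haZ⟩, ⟨x, hxi, hxZ⟩, b, hbj, hbZ⟩,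
    ⟨K, hAK, hBK, -⟩, hA, hAi, -, hB, -, hBi⟩ := h
  obtain ⟨f, hinj, hf, hfc⟩ := hT.exists_key hnode
  refine ⟨SimpleGraph.ConnectedComponent.exact (hAK.trans hBK.symm),
    hasConsecutiveOnes_of_key hinj hf, f, a, x, b, hf, hfc h i hhi a hah x hxi,
    hfc i j hij x hxi b hbj, ⟨hA hah, haZ⟩, ⟨hB hbj, hbZ⟩, fun h => Set.disjoint_left.1 hAi h hxi,
    fun h => Set.disjoint_left.1 hBi h hxi, hxZ⟩

/-- The rows on a walk of the overlap graph. -/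
theorem linked_support {A B : {i // i ∈ R}} (w : (overlapGraph M R).Walk A B) :
    Linked (Ov (rowSet M)) {i | ∃ r ∈ w.support, r.val = i} := by
  induction w with
  | @nil u =>
    convert linked_singleton (Ov (rowSet M)) (u : Fin m) using 1
    ext i
    simp [eq_comm]
  | @cons u v w hadj p ih =>
    have := ih.insert_of_rel Ov.symm (i := v) (j := u) ⟨v, p.start_mem_support, rfl⟩
      (Ov.symm _ _ hadj)
    convert this using 1
    ext i
    simp only [SimpleGraph.Walk.support_cons, List.mem_cons, Set.mem_ofPred_eq, Set.mem_insert_iff]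
    constructor
    · rintro ⟨r, rfl | hr, rfl⟩
      · exact .inl rfl
      · exact .inr ⟨r, hr, rfl⟩
    · rintro (rfl | ⟨r, hr, rfl⟩)
      · exact ⟨u, .inl rfl, rfl⟩
      · exact ⟨r, .inr hr, rfl⟩

/-- The order of the columns of a linked family is unique up to reversal, so the 1-0-1 configuration
remains in each order for the rows of a path from `A` to `B`. -/
theorem IsCorral.failsWith {A B : {i // i ∈ R}} (h : IsCorral M R Z A B)
    (w : (overlapGraph M R).Walk A B) : FailsWith M Z w.support := by
  obtain ⟨-, -, f, a, x, b, hf, hax, hxb, ⟨haA, haZ⟩, ⟨hbB, hbZ⟩, hxA, hxB, hxZ⟩ := h.exists_key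
  rintro ⟨l, hl⟩
  obtain ⟨g, -, -, hg⟩ := hl.exists_key
  have hlink := linked_support w
  have hfG : ∀ i ∈ {i | ∃ r ∈ w.support, r.val = i}, Cvx f (rowSet M i) := by
    rintro _ ⟨r, -, rfl⟩
    exact hf r r.2
  have hAG : A.val ∈ {i | ∃ r ∈ w.support, r.val = i} := ⟨A, w.start_mem_support, rfl⟩
  have hBG : B.val ∈ {i | ∃ r ∈ w.support, r.val = i} := ⟨B, w.end_mem_support, rfl⟩
  obtain ⟨g', -, hg', hord⟩ := exists_same_orientation hlink hfG fun i hi => hg i (.inr hi)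
  have hca : Cov (rowSet M) _ a := ⟨A, hAG, haA⟩
  have hcb : Cov (rowSet M) _ b := ⟨B, hBG, hbB⟩
  have hcx : Cov (rowSet M) _ x := cov_cvx hlink hfG a hca b hcb x hax.le hxb.le
  have h1 := hord a x hca hcx ⟨A, hAG, fun h => hxA (h.1 haA)⟩ hax
  have h2 := hord x b hcx hcb ⟨B, hBG, fun h => hxB (h.2 hbB)⟩ hxb
  exact hxZ (hg' _ (hg Z (.inl rfl)) a haZ b hbZ x h1.le h2.le)

end

/-! ### Shortest paths -/

theorem exists_isShortestPath {V : Type*} {G : SimpleGraph V} {A B : V} (h : G.Reachable A B) :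
    ∃ P : G.Walk A B, IsShortestPath P := by
  obtain ⟨P, hP, hlen⟩ := h.exists_path_of_dist
  exact ⟨P, hP, fun P' => hlen ▸ SimpleGraph.dist_le P'⟩

theorem IsShortestPath.le_succ_of_adj {V : Type*} {G : SimpleGraph V} {A B : V} {P : G.Walk A B}
    (h : IsShortestPath P) {a b : ℕ} (ha : a < P.support.length) (hb : b < P.support.length)
    (hadj : G.Adj P.support[a] P.support[b]) : b ≤ a + 1 := by
  rw [SimpleGraph.Walk.support_getElem_eq_getVert, SimpleGraph.Walk.support_getElem_eq_getVert]
    at hadj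
  have := h.2 ((P.take a).append (.cons hadj (P.drop b)))
  rw [SimpleGraph.Walk.length_support] at ha hb
  simp only [SimpleGraph.Walk.length_append, SimpleGraph.Walk.take_length,
    SimpleGraph.Walk.length_cons, SimpleGraph.Walk.drop_length] at this
  omega

/-! ### Minimal prefixes and suffixes -/

theorem exists_isMinimalPrefix {α : Type*} {p : List α → Prop} {L : List α} (h : p L) :
    ∃ L₁, IsMinimalPrefix p L L₁ := by
  classical
  have hex : ∃ k, ∃ L₁, L₁ <+: L ∧ p L₁ ∧ L₁.length = k := ⟨_, L, List.prefix_rfl, h, rfl⟩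
  obtain ⟨L₁, h1, h2, h3⟩ := Nat.find_spec hex
  refine ⟨L₁, h1, h2, fun L' h' hp => h'.eq_of_length (le_antisymm h'.length_le ?_)⟩
  rw [h3]
  exact Nat.find_min' hex ⟨L', h'.trans h1, hp, rfl⟩

theorem exists_isMinimalSuffix {α : Type*} {p : List α → Prop} {L : List α} (h : p L) :
    ∃ L₁, IsMinimalSuffix p L L₁ := by
  classical
  have hex : ∃ k, ∃ L₁, L₁ <:+ L ∧ p L₁ ∧ L₁.length = k := ⟨_, L, List.suffix_rfl, h, rfl⟩
  obtain ⟨L₁, h1, h2, h3⟩ := Nat.find_spec hex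
  refine ⟨L₁, h1, h2, fun L' h' hp => h'.eq_of_length (le_antisymm h'.length_le ?_)⟩
  rw [h3]
  exact Nat.find_min' hex ⟨L', h'.trans h1, hp, rfl⟩

section

variable {m n : ℕ} {M : Matrix (Fin m) (Fin n) Bool}

/-! ### The initial row sequences -/

theorem five_le_length (hT : ∀ X, IsTuckerRowSet M X → 5 ≤ X.ncard) {L : List (Fin m)}
    (hL : ¬ HasConsecutiveOnes M {i | i ∈ L}) : 5 ≤ L.length := by
  classical
  rw [hasConsecutiveOnes_iff] at hL
  obtain ⟨S, hSL, hS, hmin⟩ := exists_minimal_not_C1 hL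
  refine (hT S (structure_of_minimal hT hS hmin).1).trans ?_
  calc S.ncard ≤ (L.toFinset : Set (Fin m)).ncard :=
        Set.ncard_le_ncard (fun i hi => by simpa using hSL hi) (Finset.finite_toSet _)
    _ ≤ L.length := by
        rw [Set.ncard_coe_finset]
        exact L.toFinset_card_le

theorem exists_initialRowsStep {L : List (Fin m)} (hL : ¬ HasConsecutiveOnes M {i | i ∈ L})
    (hT : ∀ X, IsTuckerRowSet M X → 5 ≤ X.ncard) :
    ∃ R Z, InitialRowsStep M L (Z :: R) ∧ R ++ [Z] <+: L ∧
      ¬ HasConsecutiveOnes M {i | i ∈ Z :: R} ∧ HasConsecutiveOnes M {i | i ∈ R} ∧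
      4 ≤ R.length := by
  obtain ⟨L₁, hL₁⟩ := exists_isMinimalPrefix (p := fun L₁ => ¬ HasConsecutiveOnes M {i | i ∈ L₁}) hL
  have h5 := five_le_length hT hL₁.2.1
  rcases L₁.eq_nil_or_concat with rfl | ⟨R, Z, rfl⟩
  · simp at h5
  rw [List.concat_eq_append] at hL₁ h5
  refine ⟨R, Z, ⟨R, Z, hL₁, rfl⟩, hL₁.1, ?_, ?_, by simpa using h5⟩
  · have : ¬ HasConsecutiveOnes M {i | i ∈ R ++ [Z]} := hL₁.2.1
    rwa [show {i | i ∈ R ++ [Z]} = {i | i ∈ Z :: R} from Set.ext fun i => by simp [or_comm]] at this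
  · by_contra h
    have := congrArg List.length (hL₁.2.2 R (List.prefix_append _ _) h)
    simp at this

/-- The last rows found so far are at the beginning of the row sequence: a minimal failing prefix has
at least five rows, so the row found by one of the first five iterations comes after those found
before. -/
theorem exists_afterIteration (hM : ¬ HasConsecutiveOnes M Set.univ)
    (hT : ∀ X, IsTuckerRowSet M X → 5 ≤ X.ncard) {t : ℕ} (ht : t ≤ 5) :
    ∃ L Zs : List (Fin m), AfterIteration M 4 t L ∧ L.Nodup ∧
      ¬ HasConsecutiveOnes M {i | i ∈ L} ∧ Zs <+: L ∧ Zs.length = t ∧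
      ∀ Z ∈ Zs, ∃ t' R, 1 ≤ t' ∧ AfterIteration M 4 t' (Z :: R) ∧
        HasConsecutiveOnes M {i | i ∈ R} ∧ ∀ i ∈ L, i ∈ Z :: R := by
  induction t with
  | zero =>
    refine ⟨List.finRange m, [], .start, List.nodup_finRange m, ?_, List.nil_prefix, rfl, by simp⟩
    simpa using hM
  | succ t ih =>
    obtain ⟨L, Zs, hL, hnd, hfail, hZs, hlen, hZ⟩ := ih (by omega)
    obtain ⟨R, Z, hstep, hpre, hfail', hR, h4⟩ := exists_initialRowsStep hfail hT
    have h5 := five_le_length hT hfail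
    have hafter : AfterIteration M 4 (t + 1) (Z :: R) := .step hL (by omega) (by omega) hstep
    have hsub : ∀ i ∈ Z :: R, i ∈ L := fun i hi =>
      hpre.subset (by simpa [or_comm] using hi)
    refine ⟨Z :: R, Z :: Zs, hafter, ?_, hfail', ?_, by simp [hlen], ?_⟩
    · have := hnd.sublist hpre.sublist
      exact (List.perm_append_singleton Z R).nodup_iff.1 this
    · exact List.cons_prefix_cons.2 ⟨rfl, List.prefix_of_prefix_length_le hZs
        ((List.prefix_append _ _).trans hpre) (by omega)⟩
    · rintro Z' hZ'
      rcases List.mem_cons.1 hZ' with rfl | hZ'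
      · exact ⟨t + 1, R, by omega, hafter, hR, fun i hi => hi⟩
      · obtain ⟨t', R', h1, h2, h3, h6⟩ := hZ Z' hZ'
        exact ⟨t', R', h1, h2, h3, fun i hi => h6 i (hsub i hi)⟩

theorem exists_initialRowsReturns (hM : ¬ HasConsecutiveOnes M Set.univ)
    (hT : ∀ X, IsTuckerRowSet M X → 5 ≤ X.ncard) : ∃ L, InitialRowsReturns M 4 L := by
  obtain ⟨L, -, hL, -⟩ := exists_afterIteration hM hT le_rfl
  exact ⟨L, 5, hL, by omega⟩

theorem pos_of_not_hasConsecutiveOnes {S : Set (Fin m)} (h : ¬ HasConsecutiveOnes M S) : 0 < n := by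
  rcases Nat.eq_zero_or_pos n with rfl | hn
  · exact absurd ⟨[], List.nodup_nil, fun c => c.elim0, fun _ _ a => a.elim0⟩ h
  · exact hn

/-- One of the five rows found first is straddled by its neighbours in a minimal family of rows of the
last row sequence, all five being in this family. -/
theorem exists_finds (hM : ¬ HasConsecutiveOnes M Set.univ)
    (hT : ∀ X, IsTuckerRowSet M X → 5 ≤ X.ncard) : ∃ R Z A B, Finds M R Z A B := by
  classical
  obtain ⟨L, Zs, -, hnd, hfail, hZs, hlen, hZ⟩ := exists_afterIteration hM hT le_rfl
  rw [hasConsecutiveOnes_iff] at hfail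
  obtain ⟨S, hSL, hS, hmin⟩ := exists_minimal_not_C1 hfail
  obtain ⟨-, hlink, bad, hbad, hgood⟩ := structure_of_minimal hT hS hmin
  obtain ⟨Z, hZZs, hZbad⟩ : ∃ Z ∈ Zs, Z ∉ bad := by
    by_contra! h
    have := Finset.card_le_card (show Zs.toFinset ⊆ bad from fun i hi => h i (by simpa using hi))
    rw [List.toFinset_card_of_nodup (hnd.sublist hZs.sublist)] at this
    omega
  obtain ⟨t, R, ht, hafter, hR, hLR⟩ := hZ Z hZZs
  have hSR : S \ {Z} ⊆ {i | i ∈ R} := fun i hi =>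
    (List.mem_cons.1 (hLR i (hSL hi.1))).resolve_left hi.2
  have hZS : Z ∈ S := by
    by_contra h
    exact hS ((hasConsecutiveOnes_iff.1 hR).mono fun i hi =>
      hSR ⟨hi, fun h' => h (Set.mem_singleton_iff.1 h' ▸ hi)⟩)
  obtain ⟨A, B, hAB⟩ := exists_isCorral (pos_of_not_hasConsecutiveOnes hM) hR hSR (hlink Z hZS)
    (hgood Z hZS hZbad)
  exact ⟨R, Z, A, B, ⟨t, ht, hafter⟩, hAB⟩

/-! ### The returned rows -/

/-- The minimal family without the consecutive-ones property among the returned rows contains `Z` and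
both ends of the subpath; its rows other than `Z` are linked, and as the path has no chords, all rows
of the subpath are among them. -/
theorem isTuckerRowSet_rowsWith (hT : ∀ X, IsTuckerRowSet M X → 5 ≤ X.ncard) {R : List (Fin m)}
    {Z : Fin m} {A B : {i // i ∈ R}} (hAB : IsCorral M R Z A B) {P : (overlapGraph M R).Walk A B}
    (hP : IsShortestPath P) {P₁ P₂ : List {i // i ∈ R}}
    (h₁ : IsMinimalPrefix (FailsWith M Z) P.support P₁)
    (h₂ : IsMinimalSuffix (FailsWith M Z) P₁ P₂) : IsTuckerRowSet M (rowsWith Z P₂) := by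
  obtain ⟨-, hR, f, a, x, b, hf, hax, hxb, ⟨-, haZ⟩, ⟨-, hbZ⟩, -, -, hxZ⟩ := hAB.exists_key
  have hZR : Z ∉ R := fun h => hxZ (hf Z h a haZ b hbZ x hax.le hxb.le)
  have hfail : ¬ C1 (rowO M) (rowsWith Z P₂) := fun h => h₂.2.1 (hasConsecutiveOnes_iff.2 h)
  obtain ⟨S, hSX, hS, hmin⟩ := exists_minimal_not_C1 hfail
  obtain ⟨htucker, hlink, -⟩ := structure_of_minimal hT hS hmin
  have hfails : ∀ L : List {i // i ∈ R}, S ⊆ rowsWith Z L → FailsWith M Z L := fun L hL h =>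
    hS ((hasConsecutiveOnes_iff.1 h).mono hL)
  have hZS : Z ∈ S := by
    by_contra h
    refine hS ((hasConsecutiveOnes_iff.1 hR).mono fun i hi => ?_)
    rcases hSX hi with rfl | ⟨r, -, rfl⟩
    · exact absurd hi h
    · exact r.2
  have hlen : P₂.length ≤ P.support.length := h₂.1.length_le.trans h₁.1.length_le
  obtain ⟨s, hs⟩ := h₂.1
  obtain ⟨e, he⟩ := h₁.1
  have hget : ∀ i (hi : i < P₂.length), ∃ h : s.length + i < P.support.length,
      P₂[i] = P.support[s.length + i] := by
    intro i hi
    have hsupp : P.support = s ++ P₂ ++ e := by rw [hs, he]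
    refine ⟨by simp [hsupp]; omega, ?_⟩
    simp [hsupp, hi]
  have hnd : P₂.Nodup :=
    hP.1.support_nodup.sublist (h₂.1.sublist.trans h₁.1.sublist)
  have hSP : ∀ i ∈ S \ {Z}, ∃ k, ∃ hk : k < P₂.length, P₂[k].val = i := by
    rintro i ⟨hi, hiZ⟩
    obtain ⟨r, hr, rfl⟩ := (hSX hi).resolve_left hiZ
    obtain ⟨k, hk, rfl⟩ := List.mem_iff_getElem.1 hr
    exact ⟨k, hk, rfl⟩
  -- both ends of `P₂` are in `S`
  have hfirst : ∀ h : 0 < P₂.length, P₂[0].val ∈ S := by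
    intro h
    by_contra hn
    have htail : P₂.tail = P₂ := by
      refine h₂.2.2 _ (List.tail_suffix _) (hfails _ fun i hi => ?_)
      by_cases hiZ : i = Z
      · exact .inl hiZ
      obtain ⟨k, hk, rfl⟩ := hSP i ⟨hi, hiZ⟩
      refine .inr ⟨_, ?_, rfl⟩
      have hk0 : k ≠ 0 := by
        rintro rfl
        exact hn hi
      rw [List.mem_iff_getElem]
      refine ⟨k - 1, by simp; omega, ?_⟩
      simp only [List.getElem_tail]
      congr 1
      omega
    have := congrArg List.length htail
    simp at this
    omega
  have hlast : ∀ h : 0 < P₂.length, P₂[P₂.length - 1].val ∈ S := by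
    intro h
    by_contra hn
    have hinit : s ++ P₂.dropLast = P₁ := by
      refine h₁.2.2 _ ?_ (hfails _ fun i hi => ?_)
      · rw [← hs]
        exact (List.prefix_append_right_inj s).2 (List.dropLast_prefix _)
      by_cases hiZ : i = Z
      · exact .inl hiZ
      obtain ⟨k, hk, rfl⟩ := hSP i ⟨hi, hiZ⟩
      refine .inr ⟨_, List.mem_append_right _ ?_, rfl⟩
      have hkl : k ≠ P₂.length - 1 := by
        rintro rfl
        exact hn hi
      rw [List.mem_iff_getElem]
      exact ⟨k, by simp; omega, by simp⟩
    have := congrArg List.length (hinit.trans hs.symm)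
    simp at this
    omega
  have hall : ∀ k (hk : k < P₂.length), P₂[k].val ∈ S := by
    intro k hk
    by_contra hn
    have hne : ∀ i (hi : i < P₂.length), P₂[i].val ≠ Z := fun i hi h => hZR (h ▸ P₂[i].2)
    obtain ⟨i, hi, j, hj, ⟨a, ha, hak, rfl⟩, hjC, hov⟩ := (hlink Z hZS).exists_rel
      (C := {i | ∃ a, ∃ ha : a < P₂.length, a < k ∧ P₂[a].val = i})
      ⟨_, ⟨hfirst (by omega), hne 0 (by omega)⟩, 0, by omega, Nat.pos_of_ne_zero fun h => by
        subst h
        exact hn (hfirst (by omega)), rfl⟩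
      ⟨_, ⟨hlast (by omega), hne _ (by omega)⟩, fun ⟨a, ha, hak, h⟩ => by
        have := (hnd.getElem_inj_iff).1 (Subtype.ext h)
        omega⟩
    obtain ⟨b, hb, rfl⟩ := hSP j hj
    have hbk : k ≤ b := by
      by_contra h
      exact hjC ⟨b, hb, by omega, rfl⟩
    have hbk' : b ≠ k := by
      rintro rfl
      exact hn hj.1
    obtain ⟨ha', haP⟩ := hget a ha
    obtain ⟨hb', hbP⟩ := hget b hb
    have := hP.le_succ_of_adj ha' hb' (by rw [← haP, ← hbP]; exact hov)
    omega
  have : rowsWith Z P₂ = S := by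
    refine subset_antisymm ?_ hSX
    rintro i (rfl | ⟨r, hr, rfl⟩)
    · exact hZS
    · obtain ⟨k, hk, rfl⟩ := List.mem_iff_getElem.1 hr
      exact hall k hk
  rwa [this]

end

end ConsOnes

/-- If `M` fails the consecutive-ones property and each of its Tucker submatrices has at least
five rows, then every step of `findRows` can be carried out, whatever choices were made in the
steps before it, and every set that is returned is the row set of a Tucker submatrix of `M`. -/
theorem mainTheorem3 (m n : ℕ) (M : Matrix (Fin m) (Fin n) Bool)
    (hM : ¬ ConsOnes.HasConsecutiveOnes M Set.univ)
    (hT : ∀ X, ConsOnes.IsTuckerRowSet M X → 5 ≤ X.ncard) :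
    (∃ L, ConsOnes.InitialRowsReturns M 4 L) ∧
    (∃ R Z A B, ConsOnes.Finds M R Z A B) ∧
    (∀ R Z A B, ConsOnes.Finds M R Z A B →
      (∃ P : (ConsOnes.overlapGraph M R).Walk A B, ConsOnes.IsShortestPath P) ∧
      ∀ P : (ConsOnes.overlapGraph M R).Walk A B, ConsOnes.IsShortestPath P →
        (∃ P₁, ConsOnes.IsMinimalPrefix (ConsOnes.FailsWith M Z) P.support P₁) ∧
        ∀ P₁, ConsOnes.IsMinimalPrefix (ConsOnes.FailsWith M Z) P.support P₁ →
          ∃ P₂, ConsOnes.IsMinimalSuffix (ConsOnes.FailsWith M Z) P₁ P₂) ∧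
    (∃ X, ConsOnes.FindRowsReturns M X) ∧
    (∀ X, ConsOnes.FindRowsReturns M X → ConsOnes.IsTuckerRowSet M X) := by
  have key : ∀ R Z A B, ConsOnes.Finds M R Z A B →
      (∃ P : (ConsOnes.overlapGraph M R).Walk A B, ConsOnes.IsShortestPath P) ∧
      ∀ P : (ConsOnes.overlapGraph M R).Walk A B, ConsOnes.IsShortestPath P →
        (∃ P₁, ConsOnes.IsMinimalPrefix (ConsOnes.FailsWith M Z) P.support P₁) ∧
        ∀ P₁, ConsOnes.IsMinimalPrefix (ConsOnes.FailsWith M Z) P.support P₁ →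
          ∃ P₂, ConsOnes.IsMinimalSuffix (ConsOnes.FailsWith M Z) P₁ P₂ := fun R Z A B h =>
    ⟨ConsOnes.exists_isShortestPath h.2.exists_key.1, fun P _ =>
      ⟨ConsOnes.exists_isMinimalPrefix (h.2.failsWith P), fun P₁ h₁ =>
        ConsOnes.exists_isMinimalSuffix h₁.2.1⟩⟩
  refine ⟨ConsOnes.exists_initialRowsReturns hM hT, ConsOnes.exists_finds hM hT, key, ?_, ?_⟩
  · obtain ⟨R, Z, A, B, h⟩ := ConsOnes.exists_finds hM hT
    obtain ⟨⟨P, hP⟩, h'⟩ := key R Z A B h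
    obtain ⟨⟨P₁, h₁⟩, h''⟩ := h' P hP
    obtain ⟨P₂, h₂⟩ := h'' P₁ h₁
    exact ⟨_, R, Z, A, B, P, P₁, P₂, h, hP, h₁, h₂, rfl⟩
  · rintro X ⟨R, Z, A, B, P, P₁, P₂, h, hP, h₁, h₂, rfl⟩
    exact ConsOnes.isTuckerRowSet_rowsWith hT h.2 hP h₁ h₂
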